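/- **Setting.** Let $\mathbb K$ be an algebraic closure of $\mathbb C(q)$, fix a square root $q^{1/2}\in\mathbb K$ of $q$ and an element $c\in\mathbb K$ with $c^2=q^{1/2}+q^{-1/2}$. Let $A=(a_{ij})_{0\le i,j\le n}$ be the untwisted affine Cartan matrix of one of the types $A^{(1)}_n$ ($n\ge1$, $\widehat{\mathfrak{sl}}_N$ with $N=n+1$), $B^{(1)}_n$ ($n\ge1$, $\widehat{\mathfrak{so}}_N$ with $N=2n+1$), $C^{(1)}_n$ ($n\ge1$, $\widehat{\mathfrak{sp}}_N$ with $N=2n$), $D^{(1)}_n$ ($n\ge3$, $\widehat{\mathfrak{so}}_N$ with $N=2n$), with standard labelling of the nodes; for $B^{(1)}_1$ this means $a_{01}=a_{10}=-2$. Let $d_i$ be the symmetrizers $d_i=1$, except that $d_n=\tfrac12$ in type $B$ (and $d_0=d_1=\tfrac12$ for $B^{(1)}_1$) and $d_0=d_n=2$ in type $C$. Put $q_i=q^{d_i}$. Let $U_q(\mathfrak g)$ be the Hopf algebra over $\mathbb K$ generated by $x_i,y_i,k_i^{\pm1}$, $0\le i\le n$, with $k_ik_i^{-1}=k_i^{-1}k_i=1$,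 $k_ik_j=k_jk_i$, $k_ix_j=q_i^{a_{ij}}x_jk_i$, $k_iy_j=q_i^{-a_{ij}}y_jk_i$, $[x_i,y_j]=\delta_{ij}\frac{k_i-k_i^{-1}}{q_i-q_i^{-1}}$ and the $q$-Serre relations; its coproduct is $\Delta(x_i)=x_i\otimes1+k_i\otimes x_i$, $\Delta(y_i)=y_i\otimes k_i^{-1}+1\otimes y_i$, $\Delta(k_i)=k_i\otimes k_i$, and its antipode is $S(x_i)=-k_i^{-1}x_i$, $S(y_i)=-y_ik_i$, $S(k_i)=k_i^{-1}$. Label the standard basis of $\mathbb K^N$ by $\langle N\rangle=\{1,\dots,N\}$ in type $A$, $\{-n,\dots,n\}$ in type $B$, $\{-n,\dots,-1,1,\dots,n\}$ in types $C$ and $D$. Let $E_{ij}$ be the elementary matrices, $^t$ the transposition, $\vartheta_i=\mathrm{sgn}(i)$ in type $C$ and $\vartheta_i=1$ in types $B,D$, $F_{ij}=E_{ij}-\vartheta_i\vartheta_jE_{-j,-i}$ in types $B,C,D$, $\bar\imath=n+1-i$, and $q^{\sum m_iE_{ii}}=\sum q^{m_i}E_{ii}$. For $u\ne0$ the vector representation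 $T_u$ of $U_q(\mathfrak g)$ on the column space with this basis is given as follows. * Type $A$: $x_i\mapsto E_{i,i+1}$, $y_i\mapsto E_{i+1,i}$, $k_i\mapsto q^{E_{ii}-E_{i+1,i+1}}$ for $1\le i\le n$; $x_0\mapsto uE_{N1}$, $y_0\mapsto u^{-1}E_{1N}$, $k_0\mapsto q^{E_{NN}-E_{11}}$. * Types $B,C,D$, $1\le i<n$: $x_i\mapsto F_{-\bar\imath,-\bar\imath+1}$, $y_i\mapsto F_{-\bar\imath+1,-\bar\imath}$, $k_i\mapsto q^{F_{\bar\imath-1,\bar\imath-1}-F_{\bar\imath\bar\imath}}$. * Node $n$: in type $B$, $x_n\mapsto c(E_{-1,0}-q^{-1/2}E_{01})$, $y_n\mapsto c(E_{0,-1}-q^{1/2}E_{10})$, $k_n\mapsto q^{-F_{11}}$; in type $C$, $x_n\mapsto E_{-1,1}$, $y_n\mapsto E_{1,-1}$, $k_n\mapsto q^{-2F_{11}}$; in type $D$, $x_n\mapsto F_{-2,1}$, $y_n\mapsto F_{1,-2}$, $k_n\mapsto q^{-F_{11}-F_{22}}$. * Node $0$: in types $B$ ($n\ge2$) and $D$,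 $x_0\mapsto uF_{n-1,-n}$, $y_0\mapsto u^{-1}F_{-n,n-1}$, $k_0\mapsto q^{F_{n-1,n-1}+F_{nn}}$; in type $C$, $x_0\mapsto uE_{n,-n}$, $y_0\mapsto u^{-1}E_{-n,n}$, $k_0\mapsto q^{2F_{nn}}$; for $B^{(1)}_1$, $x_0\mapsto uc(E_{0,-1}-q^{1/2}E_{10})$, $y_0\mapsto u^{-1}c(E_{-1,0}-q^{-1/2}E_{01})$, $k_0\mapsto q^{F_{11}}$. Let $P=\sum_{i,j}E_{ij}\otimes E_{ji}$. In type $A$ put $Q_q=0$ and $$R_q=\sum_{i,j}q^{\delta_{ij}}E_{ii}\otimes E_{jj}+(q-q^{-1})\sum_{i<j}E_{ij}\otimes E_{ji}.$$ In types $B,C,D$ put $\nu_i=i-\tfrac12\mathrm{sgn}(i)$, $\nu_i=i$, $\nu_i=i-\mathrm{sgn}(i)$ and $2\kappa=2n-1$, $2n+2$, $2n-2$, respectively, and $Q_q=\sum_{i,j}\vartheta_i\vartheta_jq^{\nu_i-\nu_j}E_{ij}\otimes E_{-i,-j}$, $$R_q=\sum_{i,j}q^{\delta_{ij}-\delta_{i,-j}}E_{ii}\otimes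 E_{jj}+(q-q^{-1})\sum_{i<j}\bigl(E_{ij}\otimes E_{ji}-\vartheta_i\vartheta_jq^{\nu_i-\nu_j}E_{ij}\otimes E_{-i,-j}\bigr).$$ In all types the $R$-matrix is $$R(u)=\frac{1-u}{q-q^{-1}u}\,R_q+\frac{(q-q^{-1})u}{q-q^{-1}u}\Bigl(P-\frac{1-u}{q^{2\kappa}-u}\,Q_q\Bigr)$$ (the last term is absent in type $A$). Let $^{t_1}$ be the partial transpose $(E_{ij}\otimes E_{kl})^{t_1}=E_{ji}\otimes E_{kl}$, and for an $N\times N$ matrix $K$ put $K_1=K\otimes1$, $K_2=1\otimes K$. **Proposition.** Let $\mathcal B\subset U_q(\mathfrak g)$ be a right coideal subalgebra, that is, a unital subalgebra with $\Delta(\mathcal B)\subset\mathcal B\otimes U_q(\mathfrak g)$. Let $\eta\in\mathbb K^\times$ and let $K(u)\neq0$ be an $N\times N$ matrix of rational functions of $u$ over $\mathbb K$ such that $$K(u)\,T_{\eta u}(b)=T_{\eta/u}(S(b))^{t}\,K(u)\qquad\text{for all }b\in\mathcal B,$$ as an identity of rational functions of $u$. Suppose that the restriction to $\mathcal B$ of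 the tensor product representation $(T_u\otimes T_v)\circ\Delta$ on $\mathbb K^N\otimes\mathbb K^N$ is irreducible for generic $u,v$, that is, for all $(u,v)\in\mathbb K^\times\times\mathbb K^\times$ outside the zero set of some nonzero polynomial. Then $K(u)$ satisfies the twisted reflection equation $$R(\tfrac uv)\,K_1(u)\,R(\tfrac1{uv})^{t_1}\,K_2(v)=K_2(v)\,R(\tfrac1{uv})^{t_1}\,K_1(u)\,R(\tfrac uv)$$ as an identity of rational functions of $u$ and $v$. -/

import Mathlib

open scoped TensorProduct Kronecker

namespace QRefl

set_option linter.all false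

/-! ### Drinfeld-Jimbo quantum groups as Hopf algebras -/

section DrinfeldJimbo

variable {k : Type*} [Field k]

/-- The `q`-integer `[r]_a = (a ^ r - a ^ (-r)) / (a - a ^ (-1))`. -/
def qInt (a : k) (r : ℕ) : k := (a ^ r - a⁻¹ ^ r) / (a - a⁻¹)

/-- The `q`-factorial `[r]_a! = [r]_a [r-1]_a ⋯ [1]_a`. -/
def qFact (a : k) (r : ℕ) : k := ∏ s ∈ Finset.range r, qInt a (s + 1)

/-- The divided power `X ^ (r) = X ^ r / [r]_a!`. -/
def divPow {A : Type*} [Ring A] [Algebra k A] (a : k) (X : A) (r : ℕ) : A :=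
  (qFact a r)⁻¹ • X ^ r

/-- The `q`-Serre expression `∑_{r=0}^m (-1)^r X^(m-r) Y X^(r)`. -/
def serre {A : Type*} [Ring A] [Algebra k A] (a : k) (m : ℕ) (X Y : A) : A :=
  ∑ r ∈ Finset.range (m + 1), (-1 : k) ^ r • (divPow a X (m - r) * Y * divPow a X r)

/-- Names of the algebra generators `x_i, y_i, k_i, k_i⁻¹`. -/
inductive Gen (I : Type) : Type
  | x (i : I) : Gen I
  | y (i : I) : Gen I
  | k (i : I) : Gen I
  | kInv (i : I) : Gen I

/-- The defining relations of the quantum group with Cartan matrix `a` and `q_i = Q i`,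
for a family of elements of a `k`-algebra. -/
structure DJRel {I : Type} (a : I → I → ℤ) (Q : I → k) {A : Type*} [Ring A] [Algebra k A]
    (g : Gen I → A) : Prop where
  k_kInv : ∀ i, g (.k i) * g (.kInv i) = 1
  kInv_k : ∀ i, g (.kInv i) * g (.k i) = 1
  k_k : ∀ i j, g (.k i) * g (.k j) = g (.k j) * g (.k i)
  k_x : ∀ i j, g (.k i) * g (.x j) = (Q i ^ a i j) • (g (.x j) * g (.k i))
  k_y : ∀ i j, g (.k i) * g (.y j) = (Q i ^ (-a i j)) • (g (.y j) * g (.k i))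
  x_y : ∀ i, g (.x i) * g (.y i) - g (.y i) * g (.x i) =
    (Q i - (Q i)⁻¹)⁻¹ • (g (.k i) - g (.kInv i))
  x_y_ne : ∀ i j, i ≠ j → g (.x i) * g (.y j) - g (.y j) * g (.x i) = 0
  serre_x : ∀ i j, i ≠ j → serre (Q i) (1 - a i j).toNat (g (.x i)) (g (.x j)) = 0
  serre_y : ∀ i j, i ≠ j → serre (Q i) (1 - a i j).toNat (g (.y i)) (g (.y j)) = 0

/-- The same relations, as a relation on the free algebra on the generators. -/
inductive FreeRel {I : Type} (a : I → I → ℤ) (Q : I → k) :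
    FreeAlgebra k (Gen I) → FreeAlgebra k (Gen I) → Prop
  | k_kInv (i : I) : FreeRel a Q (.ι k (.k i) * .ι k (.kInv i)) 1
  | kInv_k (i : I) : FreeRel a Q (.ι k (.kInv i) * .ι k (.k i)) 1
  | k_k (i j : I) : FreeRel a Q (.ι k (.k i) * .ι k (.k j)) (.ι k (.k j) * .ι k (.k i))
  | k_x (i j : I) : FreeRel a Q (.ι k (.k i) * .ι k (.x j))
      ((Q i ^ a i j) • (.ι k (.x j) * .ι k (.k i)))
  | k_y (i j : I) : FreeRel a Q (.ι k (.k i) * .ι k (.y j))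
      ((Q i ^ (-a i j)) • (.ι k (.y j) * .ι k (.k i)))
  | x_y (i : I) : FreeRel a Q (.ι k (.x i) * .ι k (.y i) - .ι k (.y i) * .ι k (.x i))
      ((Q i - (Q i)⁻¹)⁻¹ • (.ι k (.k i) - .ι k (.kInv i)))
  | x_y_ne (i j : I) (h : i ≠ j) :
      FreeRel a Q (.ι k (.x i) * .ι k (.y j) - .ι k (.y j) * .ι k (.x i)) 0
  | serre_x (i j : I) (h : i ≠ j) :
      FreeRel a Q (serre (Q i) (1 - a i j).toNat (.ι k (.x i)) (.ι k (.x j))) 0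
  | serre_y (i j : I) (h : i ≠ j) :
      FreeRel a Q (serre (Q i) (1 - a i j).toNat (.ι k (.y i)) (.ι k (.y j))) 0

/-- The quantum group: the `k`-algebra with generators `x_i, y_i, k_i^{±1}` and the
relations `FreeRel`. -/
def Uq {I : Type} (a : I → I → ℤ) (Q : I → k) : Type _ := RingQuot (FreeRel a Q)

namespace Uq

variable {I : Type} (a : I → I → ℤ) (Q : I → k)

noncomputable instance : Ring (Uq a Q) := inferInstanceAs (Ring (RingQuot (FreeRel a Q)))

noncomputable instance : Algebra k (Uq a Q) :=
  inferInstanceAs (Algebra k (RingQuot (FreeRel a Q)))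

/-- The quotient map from the free algebra on the generators. -/
noncomputable def mk : FreeAlgebra k (Gen I) →ₐ[k] Uq a Q := RingQuot.mkAlgHom k (FreeRel a Q)

/-- The generators of the quantum group. -/
noncomputable def gen (g : Gen I) : Uq a Q := mk a Q (FreeAlgebra.ι k g)

end Uq

section lift

variable {I : Type} {a : I → I → ℤ} {Q : I → k}

theorem map_serre {A B : Type*} [Ring A] [Algebra k A] [Ring B] [Algebra k B] (f : A →ₐ[k] B)
    (c : k) (m : ℕ) (X Y : A) : f (serre c m X Y) = serre c m (f X) (f Y) := by
  simp [serre, divPow]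

theorem Uq.rel : DJRel a Q (Uq.gen a Q) := by
  have key : ∀ {p r}, FreeRel a Q p r →
      Uq.mk a Q p = Uq.mk a Q r :=
    fun h => RingQuot.mkAlgHom_rel k h
  constructor
  · intro i; simpa [Uq.gen] using key (.k_kInv i)
  · intro i; simpa [Uq.gen] using key (.kInv_k i)
  · intro i j; simpa [Uq.gen] using key (.k_k i j)
  · intro i j; simpa [Uq.gen] using key (.k_x i j)
  · intro i j; simpa [Uq.gen] using key (.k_y i j)
  · intro i; simpa [Uq.gen] using key (.x_y i)
  · intro i j h; simpa [Uq.gen] using key (.x_y_ne i j h)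
  · intro i j h; simpa [map_serre, Uq.gen] using key (.serre_x i j h)
  · intro i j h; simpa [map_serre, Uq.gen] using key (.serre_y i j h)

/-- Universal property of the quantum group. -/
noncomputable def Uq.lift {A : Type*} [Ring A] [Algebra k A] (g : Gen I → A)
    (hg : DJRel a Q g) : Uq a Q →ₐ[k] A :=
  RingQuot.liftAlgHom k ⟨FreeAlgebra.lift k g, by
    intro p r h
    induction h with
    | k_kInv i => simpa using hg.k_kInv i
    | kInv_k i => simpa using hg.kInv_k i
    | k_k i j => simpa using hg.k_k i j
    | k_x i j => simpa using hg.k_x i j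
    | k_y i j => simpa using hg.k_y i j
    | x_y i => simpa using hg.x_y i
    | x_y_ne i j h => simpa using hg.x_y_ne i j h
    | serre_x i j h => simpa [map_serre] using hg.serre_x i j h
    | serre_y i j h => simpa [map_serre] using hg.serre_y i j h⟩

@[simp]
theorem Uq.lift_gen {A : Type*} [Ring A] [Algebra k A] (g : Gen I → A) (hg : DJRel a Q g)
    (s : Gen I) : Uq.lift g hg (Uq.gen a Q s) = g s := by
  simp only [Uq.lift, Uq.gen, Uq.mk]
  erw [RingQuot.liftAlgHom_mkAlgHom_apply]
  simp

theorem Uq.algHom_ext {A : Type*} [Ring A] [Algebra k A] {f g : Uq a Q →ₐ[k] A}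
    (h : ∀ s, f (Uq.gen a Q s) = g (Uq.gen a Q s)) : f = g := by
  apply RingQuot.ringQuot_ext'
  apply FreeAlgebra.hom_ext
  funext s
  exact h s

end lift


/-! ### The Hopf algebra structure -/

section twisted

variable {A : Type*} [Ring A] [Algebra k A]

/-- The twisted commutator `X Z - t Z X`. -/
def tc (t : k) (X Z : A) : A := X * Z - t • (Z * X)

theorem tc_comm (s t : k) (X Y : A) : tc s X (tc t X Y) = tc t X (tc s X Y) := by
  simp only [tc, mul_sub, sub_mul, smul_sub, mul_smul_comm, smul_mul_assoc, mul_assoc,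
    smul_comm s t]
  abel

theorem tc_add (t : k) (X Y Z : A) : tc t X (Y + Z) = tc t X Y + tc t X Z := by
  simp only [tc, mul_add, add_mul, smul_add]; abel

theorem tc_smul (t c : k) (X Y : A) : tc t X (c • Y) = c • tc t X Y := by
  simp only [tc, mul_smul_comm, smul_mul_assoc, smul_sub, smul_comm t c]

theorem tc_smul_left (t c : k) (X Y : A) : tc t (c • X) Y = c • tc t X Y := by
  simp only [tc, mul_smul_comm, smul_mul_assoc, smul_sub, smul_comm t c]

theorem map_tc {B : Type*} [Ring B] [Algebra k B] (f : A →ₐ[k] B) (t : k) (X Y : A) :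
    f (tc t X Y) = tc t (f X) (f Y) := by
  simp [tc]

theorem qInt_one {a : k} (h : a - a⁻¹ ≠ 0) : qInt a 1 = 1 := by
  simp [qInt, div_self h]

theorem qInt_two {a : k} (h : a - a⁻¹ ≠ 0) : qInt a 2 = a + a⁻¹ := by
  rw [qInt, div_eq_iff h]; ring

theorem qInt_three {a : k} (h0 : a ≠ 0) (h : a - a⁻¹ ≠ 0) :
    qInt a 3 = a ^ 2 + 1 + a⁻¹ ^ 2 := by
  rw [qInt, div_eq_iff h]; field_simp; ring

theorem serre_one {a : k} (h : a - a⁻¹ ≠ 0) (X Y : A) : serre a 1 X Y = tc (1 : k) X Y := by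
  simp [serre, divPow, qFact, Finset.sum_range_succ, qInt_one h, tc, sub_eq_add_neg]

theorem serre_two {a : k} (h0 : a ≠ 0) (h : a - a⁻¹ ≠ 0) (h2 : a + a⁻¹ ≠ 0) (X Y : A) :
    serre a 2 X Y = (a + a⁻¹)⁻¹ • tc a X (tc a⁻¹ X Y) := by
  simp only [serre, divPow, qFact, Finset.sum_range_succ, Finset.prod_range_succ, qInt_one h,
    qInt_two h, tc]
  simp only [Finset.range_zero, Finset.sum_empty, Finset.prod_empty, pow_zero, pow_one, one_mul,
    mul_one, inv_one, one_smul, zero_add, neg_smul, pow_two, mul_sub, sub_mul, smul_sub,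
    mul_smul_comm, smul_mul_assoc, smul_smul, mul_assoc, neg_mul, neg_neg, Nat.sub_zero,
    Nat.reduceSub, Nat.sub_self]
  have h2' : a ^ 2 + 1 ≠ 0 := by
    intro h'; apply h2; field_simp; linear_combination h'
  match_scalars
  all_goals field_simp
  ring

theorem serre_three {a : k} (h0 : a ≠ 0) (h : a - a⁻¹ ≠ 0) (h2 : a + a⁻¹ ≠ 0)
    (h3 : a ^ 2 + 1 + a⁻¹ ^ 2 ≠ 0) (X Y : A) :
    serre a 3 X Y = ((a + a⁻¹) * (a ^ 2 + 1 + a⁻¹ ^ 2))⁻¹ •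
      tc (a ^ 2) X (tc (1 : k) X (tc (a⁻¹ ^ 2) X Y)) := by
  have e1 : (-1 : k) ^ 3 = -1 := by norm_num
  have e2 : (-1 : k) ^ 2 = 1 := by norm_num
  simp only [serre, divPow, qFact, Finset.sum_range_succ, Finset.prod_range_succ, qInt_one h,
    qInt_two h, qInt_three h0 h, tc, e1, e2]
  simp only [Finset.range_zero, Finset.sum_empty, Finset.prod_empty, pow_zero, pow_one, one_mul,
    mul_one, inv_one, one_smul, zero_add, neg_smul, pow_succ X, mul_sub, sub_mul, smul_sub,
    mul_smul_comm, smul_mul_assoc, smul_smul, mul_assoc, neg_mul, Nat.sub_zero,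
    Nat.reduceSub, Nat.sub_self]
  have h2' : a ^ 2 + 1 ≠ 0 := by
    intro h'; apply h2; field_simp; linear_combination h'
  have h3' : a ^ 2 * (a ^ 2 + 1) + 1 ≠ 0 := by
    intro h'; apply h3; field_simp; linear_combination h'
  match_scalars <;> field_simp <;> ring

/-- The `q`-Serre expression, up to a scalar, as an iterated twisted commutator. -/
def serreTC (c : k) (m : ℕ) (X Y : A) : A :=
  match m with
  | 2 => tc c X (tc c⁻¹ X Y)
  | 3 => tc (c ^ 2) X (tc (1 : k) X (tc (c⁻¹ ^ 2) X Y))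
  | _ => tc (1 : k) X Y

/-- Conditions on a Cartan matrix `a` and elements `q_i = Q i`: the Cartan integers off the
diagonal are at least `-2`, the matrix is symmetrizable by the `q_i`, and no `q_i` is
a root of unity. -/
class DJDatum {I : Type} (a : I → I → ℤ) (Q : I → k) : Prop where
  ne_zero : ∀ i, Q i ≠ 0
  not_root : ∀ i (r : ℕ), 0 < r → Q i ^ r ≠ 1
  diag : ∀ i, a i i = 2
  off : ∀ i j, i ≠ j → a i j = 0 ∨ a i j = -1 ∨ a i j = -2
  symm : ∀ i j, Q i ^ a i j = Q j ^ a j i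

theorem serre_eq_zero_iff {c : k} (h0 : c ≠ 0) (hc : ∀ r : ℕ, 0 < r → c ^ r ≠ 1) {m : ℕ}
    (hm : m = 1 ∨ m = 2 ∨ m = 3) (X Y : A) : serre c m X Y = 0 ↔ serreTC c m X Y = 0 := by
  have h2 := hc 2 (by norm_num)
  have h : c - c⁻¹ ≠ 0 := by
    intro h'; apply h2; field_simp at h'; linear_combination h'
  have hp : c + c⁻¹ ≠ 0 := by
    intro h'; apply hc 4 (by norm_num); field_simp at h'; linear_combination (c ^ 2 - 1) * h'
  have h3 : c ^ 2 + 1 + c⁻¹ ^ 2 ≠ 0 := by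
    intro h'; apply hc 6 (by norm_num); field_simp at h'; linear_combination (c ^ 2 - 1) * h'
  rcases hm with rfl | rfl | rfl
  · simp [serreTC, serre_one h]
  · simp [serreTC, serre_two h0 h hp, hp]
  · rw [serre_three h0 h hp h3, smul_eq_zero, serreTC,
      or_iff_right (inv_ne_zero (mul_ne_zero hp h3))]

theorem tc_absorb {t : k} {a b z : A} (h : b * z = t • (z * b)) :
    tc t (a + b) z = tc t a z := by
  simp only [tc, add_mul, mul_add, h, smul_add]; abel

theorem tc_absorb' {t : k} {a b z : A} (h : a * z = t • (z * a)) :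
    tc t (a + b) z = tc t b z := by
  rw [add_comm, tc_absorb h]

theorem tc_weight {r s t : k} {a b z : A} (h : b * a = s • (a * b)) (h' : b * z = t • (z * b)) :
    b * tc r a z = (s * t) • (tc r a z * b) := by
  have e1 : b * (a * z) = (s * t) • (a * z * b) := by
    rw [← mul_assoc, h, smul_mul_assoc, mul_assoc, h', mul_smul_comm, smul_smul, mul_assoc]
  have e2 : b * (z * a) = (s * t) • (z * a * b) := by
    rw [← mul_assoc, h', smul_mul_assoc, mul_assoc, h, mul_smul_comm, smul_smul, mul_assoc,
      mul_comm]
  simp only [tc, mul_sub, sub_mul, mul_smul_comm, smul_mul_assoc, e1, e2, smul_sub,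
    smul_comm r]

theorem serreTC_add {c : k} (h0 : c ≠ 0) {m : ℕ} (hm : m = 1 ∨ m = 2 ∨ m = 3) {a b z w : A}
    (hba : b * a = (c ^ 2) • (a * b)) (hbz : b * z = (c ^ (1 - (m : ℤ))) • (z * b))
    (hwa : w * a = (c ^ (1 - (m : ℤ))) • (a * w)) :
    serreTC c m (a + b) (z + w) = serreTC c m a z + serreTC c m b w := by
  have hab : a * b = (c ^ 2)⁻¹ • (b * a) := by
    rw [hba, smul_smul, inv_mul_cancel₀ (pow_ne_zero _ h0), one_smul]
  have haw : a * w = (c ^ (1 - (m : ℤ)))⁻¹ • (w * a) := by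
    rw [hwa, smul_smul, inv_mul_cancel₀ (zpow_ne_zero _ h0), one_smul]
  rcases hm with rfl | rfl | rfl
  · simp only [serreTC]
    norm_num at hbz haw
    rw [tc_add, tc_absorb (by rw [hbz, one_smul]), tc_absorb' (by rw [haw, one_smul])]
  · simp only [serreTC]
    norm_num at hbz haw
    rw [tc_add, tc_add, tc_absorb hbz]
    congr 1
    · apply tc_absorb
      rw [tc_weight hba hbz]; congr 1; field_simp
    · rw [tc_comm, tc_absorb' haw, tc_absorb', tc_comm]
      rw [tc_weight hab haw]; congr 1; field_simp
  · simp only [serreTC]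
    have e : c ^ (1 - ((3 : ℕ) : ℤ)) = c⁻¹ ^ 2 := by
      rw [show (1 - ((3 : ℕ) : ℤ)) = -((2 : ℕ) : ℤ) by norm_num, zpow_neg, zpow_natCast, inv_pow]
    rw [e] at hbz haw
    have haw' : a * w = c ^ 2 • (w * a) := by rw [haw]; congr 1; simp
    rw [tc_add, tc_add, tc_add, tc_absorb hbz]
    have h1 := tc_weight (r := c⁻¹ ^ 2) hba hbz
    have h2 := tc_weight (r := c ^ 2) hab haw'
    rw [show c ^ 2 * c⁻¹ ^ 2 = 1 by field_simp] at h1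
    rw [show (c ^ 2)⁻¹ * c ^ 2 = 1 by field_simp] at h2
    congr 1
    · rw [tc_absorb h1]
      apply tc_absorb
      rw [tc_weight hba h1, mul_one]
    · rw [tc_comm (1 : k), tc_comm (c ^ 2) (c⁻¹ ^ 2), tc_comm (c ^ 2) (1 : k),
        tc_absorb' haw', tc_absorb' h2, tc_absorb' (t := c⁻¹ ^ 2)]
      · rw [tc_comm (1 : k) (c ^ 2), tc_comm (c⁻¹ ^ 2) (c ^ 2), tc_comm (c⁻¹ ^ 2) (1 : k)]
      · rw [tc_weight hab h2, mul_one, inv_pow]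

theorem tc_mul {s β : k} {x z h g : A} (hxg : x * g = β • (g * x)) (hzh : z * h = β • (h * z))
    (hhg : h * g = g * h) : tc s (h * x) (g * z) = β • (h * g * tc s x z) := by
  have e1 : h * x * (g * z) = β • (h * g * (x * z)) := by
    rw [mul_assoc, ← mul_assoc x, hxg]; simp [mul_assoc]
  have e2 : g * z * (h * x) = β • (h * g * (z * x)) := by
    rw [mul_assoc, ← mul_assoc z, hzh, hhg]; simp [mul_assoc]
  simp only [tc, e1, e2, mul_sub, smul_sub, mul_smul_comm, smul_comm s]

theorem tc_weight' {r s t : k} {a b z : A} (h : a * b = s • (b * a)) (h' : z * b = t • (b * z)) :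
    tc r a z * b = (s * t) • (b * tc r a z) := by
  have e1 : a * z * b = (s * t) • (b * (a * z)) := by
    rw [mul_assoc, h', mul_smul_comm, ← mul_assoc, h]; simp [smul_smul, mul_assoc, mul_comm]
  have e2 : z * a * b = (s * t) • (b * (z * a)) := by
    rw [mul_assoc, h, mul_smul_comm, ← mul_assoc, h']; simp [smul_smul, mul_assoc]
  simp only [tc, mul_sub, sub_mul, mul_smul_comm, smul_mul_assoc, e1, e2, smul_sub,
    smul_comm r]

theorem weight_mul {s t : k} {x h g : A} (hx : x * h = s • (h * x)) (hg : x * g = t • (g * x)) :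
    x * (h * g) = (s * t) • (h * g * x) := by
  rw [← mul_assoc, hx, smul_mul_assoc, mul_assoc, hg]; simp [smul_smul, mul_assoc]

theorem serreTC_mul {c γ β : k} {m : ℕ} {x z h g : A} (hxh : x * h = γ • (h * x))
    (hxg : x * g = β • (g * x)) (hzh : z * h = β • (h * z))
    (hhg : h * g = g * h) (H : serreTC c m x z = 0) : serreTC c m (h * x) (g * z) = 0 := by
  have step1 : ∀ s : k, tc s (h * x) (g * z) = β • (h * g * tc s x z) :=
    fun s => tc_mul hxg hzh hhg
  have hhg1 : h * (h * g) = (h * g) * h := by rw [hhg, ← mul_assoc, hhg]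
  have hhg2 : h * (h * (h * g)) = (h * (h * g)) * h := by rw [hhg1, ← mul_assoc, hhg1]
  have step2 : ∀ s r : k, tc s (h * x) (h * g * tc r x z) =
      (γ * β) • (h * (h * g) * tc s x (tc r x z)) := fun s r =>
    tc_mul (weight_mul hxh hxg) (tc_weight' hxh hzh) hhg1
  have step3 : ∀ s r t : k, tc s (h * x) (h * (h * g) * tc r x (tc t x z)) =
      (γ * (γ * β)) • (h * (h * (h * g)) * tc s x (tc r x (tc t x z))) := fun s r t =>
    tc_mul (weight_mul hxh (weight_mul hxh hxg))
      (tc_weight' hxh (tc_weight' hxh hzh)) hhg2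
  unfold serreTC at H ⊢
  split at H
  · simp only [step1, tc_smul, step2, H, mul_zero, smul_zero]
  · simp only [step1, tc_smul, step2, step3, H, mul_zero, smul_zero]
  · simp only [step1, H, mul_zero, smul_zero]

theorem tc_op {t : k} (ht : t ≠ 0) (X Z : A) :
    tc t (MulOpposite.op X) (MulOpposite.op Z) = (-t) • MulOpposite.op (tc t⁻¹ X Z) := by
  apply MulOpposite.unop_injective
  simp [tc, smul_sub, smul_smul, ht]
  abel

theorem serreTC_op {c : k} (h0 : c ≠ 0) {m : ℕ} {X Z : A} (H : serreTC c m X Z = 0) :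
    serreTC c m (MulOpposite.op X) (MulOpposite.op Z) = 0 := by
  unfold serreTC at H ⊢
  split at H
  · rw [tc_op (inv_ne_zero h0), tc_smul, tc_op h0, inv_inv, tc_comm, H]; simp
  · rw [tc_op (pow_ne_zero _ (inv_ne_zero h0)), tc_smul, tc_op one_ne_zero, tc_smul, tc_smul,
      tc_op (pow_ne_zero _ h0), ← inv_pow, ← inv_pow, inv_inv, inv_one,
      tc_comm (1 : k) (c ^ 2), tc_comm (c⁻¹ ^ 2) (c ^ 2), tc_comm (c⁻¹ ^ 2) (1 : k), H]
    simp
  · rw [tc_op one_ne_zero, inv_one, H]; simp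

theorem serreTC_smul {c s t : k} {m : ℕ} {X Z : A} (H : serreTC c m X Z = 0) :
    serreTC c m (s • X) (t • Z) = 0 := by
  unfold serreTC at H ⊢
  split at H
  · simp only [tc_smul, tc_smul_left, H, smul_zero]
  · simp only [tc_smul, tc_smul_left, H, smul_zero]
  · simp only [tc_smul, tc_smul_left, H, smul_zero]

theorem tc_tmul {B : Type*} [Ring B] [Algebra k B] (t : k) {u v : B} (h : u * v = v * u)
    (X Z : A) : tc t (u ⊗ₜ[k] X) (v ⊗ₜ[k] Z) = (u * v) ⊗ₜ[k] tc t X Z := by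
  simp [tc, TensorProduct.tmul_sub, h]

theorem tc_tmul' {B : Type*} [Ring B] [Algebra k B] (t : k) {u v : B} (h : u * v = v * u)
    (X Z : A) : tc t (X ⊗ₜ[k] u) (Z ⊗ₜ[k] v) = tc t X Z ⊗ₜ[k] (u * v) := by
  simp [tc, TensorProduct.sub_tmul, h, TensorProduct.smul_tmul']

theorem serreTC_tmul {B : Type*} [Ring B] [Algebra k B] {c : k} {m : ℕ} {u v : B}
    (h : u * v = v * u) {X Z : A} (H : serreTC c m X Z = 0) :
    serreTC c m (u ⊗ₜ[k] X) (v ⊗ₜ[k] Z) = 0 := by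
  have h1 : u * (u * v) = (u * v) * u := by rw [h, ← mul_assoc, h]
  have h2 : u * (u * (u * v)) = (u * (u * v)) * u := by rw [h1, ← mul_assoc, h1]
  unfold serreTC at H ⊢
  split at H
  · rw [tc_tmul _ h, tc_tmul _ h1, H, TensorProduct.tmul_zero]
  · rw [tc_tmul _ h, tc_tmul _ h1, tc_tmul _ h2, H, TensorProduct.tmul_zero]
  · rw [tc_tmul _ h, H, TensorProduct.tmul_zero]

theorem serreTC_tmul' {B : Type*} [Ring B] [Algebra k B] {c : k} {m : ℕ} {u v : B}
    (h : u * v = v * u) {X Z : A} (H : serreTC c m X Z = 0) :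
    serreTC c m (X ⊗ₜ[k] u) (Z ⊗ₜ[k] v) = 0 := by
  have h1 : u * (u * v) = (u * v) * u := by rw [h, ← mul_assoc, h]
  have h2 : u * (u * (u * v)) = (u * (u * v)) * u := by rw [h1, ← mul_assoc, h1]
  unfold serreTC at H ⊢
  split at H
  · rw [tc_tmul' _ h, tc_tmul' _ h1, H, TensorProduct.zero_tmul]
  · rw [tc_tmul' _ h, tc_tmul' _ h1, tc_tmul' _ h2, H, TensorProduct.zero_tmul]
  · rw [tc_tmul' _ h, H, TensorProduct.zero_tmul]

end twisted

section Hopf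

variable {I : Type} {a : I → I → ℤ} {Q : I → k}

theorem DJDatum.serre_iff [D : DJDatum a Q] {A : Type*} [Ring A] [Algebra k A] {i j : I}
    (h : i ≠ j) (X Y : A) :
    serre (Q i) (1 - a i j).toNat X Y = 0 ↔ serreTC (Q i) (1 - a i j).toNat X Y = 0 := by
  apply serre_eq_zero_iff (D.ne_zero i) (D.not_root i)
  have := D.off i j h
  omega

theorem DJDatum.m_cast [D : DJDatum a Q] {i j : I} (h : i ≠ j) :
    (1 - (((1 - a i j).toNat : ℕ) : ℤ)) = a i j := by
  have := D.off i j h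
  omega

theorem DJDatum.m_cases [D : DJDatum a Q] {i j : I} (h : i ≠ j) :
    (1 - a i j).toNat = 1 ∨ (1 - a i j).toNat = 2 ∨ (1 - a i j).toNat = 3 := by
  have := D.off i j h
  omega

section consequences

variable {A : Type*} [Ring A] [Algebra k A] {g : Gen I → A}

theorem inv_weight {K K' X : A} {c : k} (h1 : K * K' = 1) (h2 : K' * K = 1)
    (h : K * X = c • (X * K)) : X * K' = c • (K' * X) := by
  calc X * K' = K' * (K * X) * K' := by rw [← mul_assoc K', h2, one_mul]
    _ = c • (K' * X * (K * K')) := by rw [h]; simp [mul_assoc]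
    _ = c • (K' * X) := by rw [h1, mul_one]

theorem DJRel.kInv_x (hg : DJRel a Q g) (i j : I) :
    g (.x j) * g (.kInv i) = (Q i ^ a i j) • (g (.kInv i) * g (.x j)) :=
  inv_weight (hg.k_kInv i) (hg.kInv_k i) (hg.k_x i j)

theorem DJRel.kInv_y (hg : DJRel a Q g) (i j : I) :
    g (.y j) * g (.kInv i) = (Q i ^ (-a i j)) • (g (.kInv i) * g (.y j)) :=
  inv_weight (hg.k_kInv i) (hg.kInv_k i) (hg.k_y i j)

theorem DJRel.kInv_x' [D : DJDatum a Q] (hg : DJRel a Q g) (i j : I) :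
    g (.kInv i) * g (.x j) = (Q i ^ (-a i j)) • (g (.x j) * g (.kInv i)) := by
  rw [hg.kInv_x, smul_smul, ← zpow_add₀ (D.ne_zero i)]; simp

theorem DJRel.kInv_y' [D : DJDatum a Q] (hg : DJRel a Q g) (i j : I) :
    g (.kInv i) * g (.y j) = (Q i ^ a i j) • (g (.y j) * g (.kInv i)) := by
  rw [hg.kInv_y, smul_smul, ← zpow_add₀ (D.ne_zero i)]; simp

theorem DJRel.x_k [D : DJDatum a Q] (hg : DJRel a Q g) (i j : I) :
    g (.x j) * g (.k i) = (Q i ^ (-a i j)) • (g (.k i) * g (.x j)) := by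
  rw [hg.k_x, smul_smul, ← zpow_add₀ (D.ne_zero i)]; simp

theorem DJRel.y_k [D : DJDatum a Q] (hg : DJRel a Q g) (i j : I) :
    g (.y j) * g (.k i) = (Q i ^ a i j) • (g (.k i) * g (.y j)) := by
  rw [hg.k_y, smul_smul, ← zpow_add₀ (D.ne_zero i)]; simp

theorem DJRel.kInv_kInv (hg : DJRel a Q g) (i j : I) :
    g (.kInv i) * g (.kInv j) = g (.kInv j) * g (.kInv i) := by
  have h : g (.k j) * g (.kInv i) = g (.kInv i) * g (.k j) := by
    have := inv_weight (c := (1 : k)) (hg.k_kInv i) (hg.kInv_k i) (X := g (.k j))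
      (by rw [one_smul, hg.k_k])
    simpa using this
  have := inv_weight (c := (1 : k)) (hg.k_kInv j) (hg.kInv_k j) (X := g (.kInv i))
      (by rw [one_smul, h])
  simpa using this

end consequences

/-- Values of the coproduct on the generators. -/
noncomputable def comulGen (a : I → I → ℤ) (Q : I → k) : Gen I → Uq a Q ⊗[k] Uq a Q
  | .x i => Uq.gen a Q (.x i) ⊗ₜ 1 + Uq.gen a Q (.k i) ⊗ₜ Uq.gen a Q (.x i)
  | .y i => Uq.gen a Q (.y i) ⊗ₜ Uq.gen a Q (.kInv i) + 1 ⊗ₜ Uq.gen a Q (.y i)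
  | .k i => Uq.gen a Q (.k i) ⊗ₜ Uq.gen a Q (.k i)
  | .kInv i => Uq.gen a Q (.kInv i) ⊗ₜ Uq.gen a Q (.kInv i)

/-- Values of the counit on the generators. -/
def counitGen (k : Type*) [Field k] {I : Type} : Gen I → k
  | .x _ => 0
  | .y _ => 0
  | .k _ => 1
  | .kInv _ => 1

/-- Values of the antipode on the generators. -/
noncomputable def antipodeGen (a : I → I → ℤ) (Q : I → k) : Gen I → Uq a Q
  | .x i => -(Uq.gen a Q (.kInv i) * Uq.gen a Q (.x i))
  | .y i => -(Uq.gen a Q (.y i) * Uq.gen a Q (.k i))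
  | .k i => Uq.gen a Q (.kInv i)
  | .kInv i => Uq.gen a Q (.k i)

theorem comulGen_rel [D : DJDatum a Q] : DJRel a Q (comulGen a Q) := by
  have R := Uq.rel (a := a) (Q := Q)
  constructor
  · intro i; simp [comulGen, R.k_kInv, Algebra.TensorProduct.one_def]
  · intro i; simp [comulGen, R.kInv_k, Algebra.TensorProduct.one_def]
  · intro i j; simp [comulGen, R.k_k i j]
  · intro i j
    simp only [comulGen, mul_add, add_mul, Algebra.TensorProduct.tmul_mul_tmul, R.k_x, mul_one,
      one_mul, smul_add, TensorProduct.smul_tmul', TensorProduct.tmul_smul, R.k_k i j]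
  · intro i j
    simp only [comulGen, mul_add, add_mul, Algebra.TensorProduct.tmul_mul_tmul, R.k_y, mul_one,
      one_mul, smul_add, TensorProduct.smul_tmul', TensorProduct.tmul_smul]
    have := inv_weight (c := (1 : k)) (R.k_kInv j) (R.kInv_k j)
      (X := Uq.gen a Q (.k i)) (by rw [one_smul, R.k_k])
    rw [one_smul] at this
    rw [this]
  · intro i
    have e1 := R.x_y i
    have e2 : Uq.gen a Q (.k i) * Uq.gen a Q (.y i) = (Q i ^ (-a i i)) •
      (Uq.gen a Q (.y i) * Uq.gen a Q (.k i)) := R.k_y i i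
    have e3 := R.kInv_x i i
    simp only [comulGen, mul_add, add_mul, Algebra.TensorProduct.tmul_mul_tmul, mul_one,
      one_mul]
    rw [e2, e3, TensorProduct.tmul_smul, ← TensorProduct.smul_tmul', smul_smul,
      ← zpow_add₀ (D.ne_zero i), add_neg_cancel, zpow_zero, one_smul]
    rw [sub_eq_iff_eq_add] at e1
    rw [e1]
    simp only [TensorProduct.add_tmul, TensorProduct.tmul_add, ← TensorProduct.smul_tmul',
      TensorProduct.tmul_smul, TensorProduct.sub_tmul, TensorProduct.tmul_sub, smul_sub]
    abel
  · intro i j h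
    have e1 := R.x_y_ne i j h
    have e3 := R.kInv_x j i
    simp only [comulGen, mul_add, add_mul, Algebra.TensorProduct.tmul_mul_tmul, mul_one,
      one_mul]
    rw [R.k_y i j, e3, TensorProduct.tmul_smul, ← TensorProduct.smul_tmul', smul_smul,
      D.symm i j |> fun h => show Q i ^ (-a i j) = Q j ^ (-a j i) by rw [zpow_neg, h, zpow_neg]]
    rw [← zpow_add₀ (D.ne_zero j), add_neg_cancel, zpow_zero, one_smul]
    rw [sub_eq_zero] at e1
    rw [e1]
    abel
  · intro i j h
    rw [DJDatum.serre_iff h]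
    have hs := (DJDatum.serre_iff h _ _).1 (R.serre_x i j h)
    simp only [comulGen]
    rw [serreTC_add (D.ne_zero i) (DJDatum.m_cases (Q := Q) h), serreTC_tmul' rfl hs,
      serreTC_tmul (R.k_k i j) hs, add_zero]
    · have := R.k_x i i
      rw [D.diag i] at this
      simp only [Algebra.TensorProduct.tmul_mul_tmul, mul_one, one_mul, this,
        ← TensorProduct.smul_tmul']
      norm_cast
    · simp only [Algebra.TensorProduct.tmul_mul_tmul, mul_one, one_mul, R.k_x i j,
        ← TensorProduct.smul_tmul', DJDatum.m_cast (Q := Q) h]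
    · simp only [Algebra.TensorProduct.tmul_mul_tmul, mul_one, one_mul, R.k_x j i,
        ← TensorProduct.smul_tmul', DJDatum.m_cast (Q := Q) h, D.symm i j]
  · intro i j h
    rw [DJDatum.serre_iff h]
    have hs := (DJDatum.serre_iff h _ _).1 (R.serre_y i j h)
    simp only [comulGen]
    rw [add_comm, add_comm (Uq.gen a Q (.y j) ⊗ₜ[k] Uq.gen a Q (.kInv j)),
      serreTC_add (D.ne_zero i) (DJDatum.m_cases (Q := Q) h), serreTC_tmul rfl hs,
      serreTC_tmul' (R.kInv_kInv i j) hs, add_zero]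
    · have := R.kInv_y' i i
      rw [D.diag i] at this
      simp only [Algebra.TensorProduct.tmul_mul_tmul, mul_one, one_mul, this,
        TensorProduct.tmul_smul]
      norm_cast
    · simp only [Algebra.TensorProduct.tmul_mul_tmul, mul_one, one_mul, R.kInv_y' i j,
        TensorProduct.tmul_smul, DJDatum.m_cast (Q := Q) h]
    · simp only [Algebra.TensorProduct.tmul_mul_tmul, mul_one, one_mul, R.kInv_y' j i,
        TensorProduct.tmul_smul, DJDatum.m_cast (Q := Q) h, D.symm i j]

theorem counitGen_rel [D : DJDatum a Q] : DJRel a Q (counitGen k (I := I)) := by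
  constructor
  · intro i; simp [counitGen]
  · intro i; simp [counitGen]
  · intro i j; simp [counitGen]
  · intro i j; simp [counitGen]
  · intro i j; simp [counitGen]
  · intro i; simp [counitGen]
  · intro i j h; simp [counitGen]
  · intro i j h
    rw [DJDatum.serre_iff h]
    simp [counitGen, serreTC, tc]; split <;> simp
  · intro i j h
    rw [DJDatum.serre_iff h]
    simp [counitGen, serreTC, tc]; split <;> simp

theorem antipodeGen_rel [D : DJDatum a Q] :
    DJRel a Q (fun s => MulOpposite.op (antipodeGen a Q s)) := by
  have R := Uq.rel (a := a) (Q := Q)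
  constructor
  · intro i; simp only [antipodeGen, ← MulOpposite.op_mul, R.k_kInv, MulOpposite.op_one]
  · intro i; simp only [antipodeGen, ← MulOpposite.op_mul, R.kInv_k, MulOpposite.op_one]
  · intro i j; simp only [antipodeGen, ← MulOpposite.op_mul, R.kInv_kInv i j]
  · intro i j
    simp only [antipodeGen, ← MulOpposite.op_mul, ← MulOpposite.op_smul]
    rw [neg_mul, mul_assoc, R.kInv_x, mul_smul_comm, ← mul_assoc, R.kInv_kInv j i, mul_neg,
      smul_neg, mul_assoc]
  · intro i j
    have h : Uq.gen a Q (.k j) * Uq.gen a Q (.kInv i) = Uq.gen a Q (.kInv i) * Uq.gen a Q (.k j) := by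
      have := inv_weight (c := (1 : k)) (R.k_kInv i) (R.kInv_k i) (X := Uq.gen a Q (.k j))
        (by rw [one_smul, R.k_k])
      simpa using this
    simp only [antipodeGen, ← MulOpposite.op_mul, ← MulOpposite.op_smul]
    rw [neg_mul, mul_assoc, h, ← mul_assoc, R.kInv_y, smul_mul_assoc, mul_neg,
      smul_neg, mul_assoc]
  · intro i
    simp only [antipodeGen, ← MulOpposite.op_mul, ← MulOpposite.op_smul, ← MulOpposite.op_sub]
    congr 1
    have e := R.x_y i
    rw [sub_eq_iff_eq_add] at e
    have e1 : Uq.gen a Q (.y i) * Uq.gen a Q (.k i) * (Uq.gen a Q (.kInv i) * Uq.gen a Q (.x i)) =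
        Uq.gen a Q (.y i) * Uq.gen a Q (.x i) := by
      rw [mul_assoc, ← mul_assoc (Uq.gen a Q (.k i)), R.k_kInv, one_mul]
    have e2 : Uq.gen a Q (.kInv i) * Uq.gen a Q (.x i) * (Uq.gen a Q (.y i) * Uq.gen a Q (.k i)) =
        Uq.gen a Q (.x i) * Uq.gen a Q (.y i) := by
      calc _ = Uq.gen a Q (.kInv i) * ((Uq.gen a Q (.x i) * Uq.gen a Q (.y i)) *
            Uq.gen a Q (.k i)) := by simp only [mul_assoc]
        _ = Uq.gen a Q (.kInv i) * (Uq.gen a Q (.k i) *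
            (Uq.gen a Q (.x i) * Uq.gen a Q (.y i))) := by
          congr 1
          rw [← mul_assoc (Uq.gen a Q (.k i)), R.k_x, smul_mul_assoc, mul_assoc _ _ (Uq.gen a Q (.y i)),
            R.k_y, mul_smul_comm, smul_smul, ← zpow_add₀ (D.ne_zero i)]
          simp [mul_assoc]
        _ = _ := by rw [← mul_assoc, R.kInv_k, one_mul]
    rw [neg_mul_neg, neg_mul_neg, e1, e2, e]
    simp only [smul_sub]; abel
  · intro i j hij
    simp only [antipodeGen, ← MulOpposite.op_mul, ← MulOpposite.op_sub]
    have e := R.x_y_ne i j hij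
    rw [sub_eq_zero] at e
    have h : Uq.gen a Q (.k j) * Uq.gen a Q (.kInv i) = Uq.gen a Q (.kInv i) * Uq.gen a Q (.k j) := by
      have := inv_weight (c := (1 : k)) (R.k_kInv i) (R.kInv_k i) (X := Uq.gen a Q (.k j))
        (by rw [one_smul, R.k_k])
      simpa using this
    have e1 : Uq.gen a Q (.y j) * Uq.gen a Q (.k j) * (Uq.gen a Q (.kInv i) * Uq.gen a Q (.x i)) =
        Uq.gen a Q (.kInv i) * Uq.gen a Q (.x i) * (Uq.gen a Q (.y j) * Uq.gen a Q (.k j)) := by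
      calc _ = (Uq.gen a Q (.y j) * Uq.gen a Q (.kInv i)) *
            (Uq.gen a Q (.k j) * Uq.gen a Q (.x i)) := by
            rw [mul_assoc, ← mul_assoc (Uq.gen a Q (.k j)), h]; simp only [mul_assoc]
        _ = Uq.gen a Q (.kInv i) * (Uq.gen a Q (.y j) * Uq.gen a Q (.x i)) *
            Uq.gen a Q (.k j) := by
            rw [R.kInv_y, R.k_x, ← D.symm i j, smul_mul_assoc, mul_smul_comm, smul_smul,
              ← zpow_add₀ (D.ne_zero i)]
            simp [mul_assoc]
        _ = _ := by rw [← e]; simp only [mul_assoc]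
    rw [neg_mul_neg, neg_mul_neg, e1, sub_self]; rfl
  · intro i j h
    rw [DJDatum.serre_iff h]
    simp only [antipodeGen]
    apply serreTC_op (D.ne_zero i)
    rw [← neg_one_smul k, ← neg_one_smul k (Uq.gen a Q (.kInv j) * _)]
    apply serreTC_smul
    apply serreTC_mul (R.kInv_x i i) (β := Q i ^ a i j) _ (R.kInv_x i j) (R.kInv_kInv i j)
      ((DJDatum.serre_iff h _ _).1 (R.serre_x i j h))
    rw [D.symm i j]; exact R.kInv_x j i
  · intro i j h
    rw [DJDatum.serre_iff h]
    simp only [antipodeGen]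
    apply serreTC_op (D.ne_zero i)
    rw [R.y_k i i, R.y_k j j, ← smul_neg, ← smul_neg, ← neg_one_smul k,
      ← neg_one_smul k (Uq.gen a Q (.k j) * _)]
    apply serreTC_smul
    apply serreTC_smul
    apply serreTC_mul (R.y_k i i) (β := Q i ^ a i j) _ (R.y_k i j) (R.k_k i j)
      ((DJDatum.serre_iff h _ _).1 (R.serre_y i j h))
    rw [D.symm i j]; exact R.y_k j i

variable (a Q)

/-- The coproduct as an algebra homomorphism. -/
noncomputable def comulHom [DJDatum a Q] : Uq a Q →ₐ[k] Uq a Q ⊗[k] Uq a Q :=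
  Uq.lift _ comulGen_rel

/-- The counit as an algebra homomorphism. -/
noncomputable def counitHom [DJDatum a Q] : Uq a Q →ₐ[k] k := Uq.lift _ counitGen_rel

/-- The antipode as an algebra homomorphism to the opposite algebra. -/
noncomputable def antipodeHom [DJDatum a Q] : Uq a Q →ₐ[k] (Uq a Q)ᵐᵒᵖ :=
  Uq.lift _ antipodeGen_rel

noncomputable instance [DJDatum a Q] : Bialgebra k (Uq a Q) :=
  Bialgebra.ofAlgHom (comulHom a Q) (counitHom a Q)
    (by
      apply Uq.algHom_ext
      rintro (i | i | i | i) <;>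
        simp [comulHom, comulGen, TensorProduct.add_tmul, TensorProduct.tmul_add, add_assoc,
          Algebra.TensorProduct.one_def])
    (by
      apply Uq.algHom_ext
      rintro (i | i | i | i) <;> simp [comulHom, comulGen, counitHom, counitGen])
    (by
      apply Uq.algHom_ext
      rintro (i | i | i | i) <;> simp [comulHom, comulGen, counitHom, counitGen])

theorem counit_gen [DJDatum a Q] (s : Gen I) :
    Coalgebra.counit (R := k) (Uq.gen a Q s) = counitGen k s :=
  Uq.lift_gen _ counitGen_rel s

theorem comul_gen [DJDatum a Q] (s : Gen I) :
    Coalgebra.comul (R := k) (Uq.gen a Q s) = comulGen a Q s :=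
  Uq.lift_gen _ comulGen_rel s

/-- The antipode as a linear map. -/
noncomputable def antipodeLin [DJDatum a Q] : Uq a Q →ₗ[k] Uq a Q :=
  (MulOpposite.opLinearEquiv k).symm.toLinearMap ∘ₗ (antipodeHom a Q).toLinearMap

theorem antipodeLin_mul [DJDatum a Q] (u v : Uq a Q) :
    antipodeLin a Q (u * v) = antipodeLin a Q v * antipodeLin a Q u := by
  simp [antipodeLin]

theorem antipodeLin_one [DJDatum a Q] : antipodeLin a Q 1 = 1 := by
  simp [antipodeLin]

theorem antipodeLin_gen [DJDatum a Q] (s : Gen I) :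
    antipodeLin a Q (Uq.gen a Q s) = antipodeGen a Q s := by
  simp [antipodeLin, antipodeHom]

theorem Uq.induction {p : Uq a Q → Prop} (hgen : ∀ s, p (Uq.gen a Q s))
    (hone : p 1) (hmul : ∀ u v, p u → p v → p (u * v)) (hadd : ∀ u v, p u → p v → p (u + v))
    (hsmul : ∀ (c : k) u, p u → p (c • u)) (u : Uq a Q) : p u := by
  obtain ⟨w, rfl⟩ := RingQuot.mkAlgHom_surjective k (FreeRel a Q) u
  change p (Uq.mk a Q w)
  induction w using FreeAlgebra.induction with
  | grade0 r => rw [AlgHom.commutes, Algebra.algebraMap_eq_smul_one]; exact hsmul _ _ hone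
  | grade1 s => exact hgen s
  | mul x y hx hy => rw [map_mul]; exact hmul _ _ hx hy
  | add x y hx hy => rw [map_add]; exact hadd _ _ hx hy

theorem antipode_left [DJDatum a Q] (u : Uq a Q) :
    LinearMap.mul' k (Uq a Q) ((antipodeLin a Q).rTensor (Uq a Q) (Coalgebra.comul u)) =
      algebraMap k (Uq a Q) (Coalgebra.counit u) := by
  have R := Uq.rel (a := a) (Q := Q)
  induction u using Uq.induction with
  | hgen s =>
    rw [comul_gen, counit_gen]
    rcases s with i | i | i | i
    · simp [comulGen, counitGen, antipodeLin_gen, antipodeGen]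
    · simp [comulGen, counitGen, antipodeLin_gen, antipodeGen, antipodeLin_one, mul_assoc,
        R.k_kInv]
    · simp [comulGen, counitGen, antipodeLin_gen, antipodeGen, R.kInv_k]
    · simp [comulGen, counitGen, antipodeLin_gen, antipodeGen, R.k_kInv]
  | hone => simp [Algebra.TensorProduct.one_def, antipodeLin_one]
  | hmul u v hu hv =>
    have key : ∀ (t s : Uq a Q ⊗[k] Uq a Q) (c : k),
        LinearMap.mul' k (Uq a Q) ((antipodeLin a Q).rTensor (Uq a Q) t) =
          algebraMap k (Uq a Q) c →
        LinearMap.mul' k (Uq a Q) ((antipodeLin a Q).rTensor (Uq a Q) (t * s)) =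
        c • LinearMap.mul' k (Uq a Q) ((antipodeLin a Q).rTensor (Uq a Q) s) := by
      intro t s c ht
      have h1 : ∀ z w : Uq a Q, LinearMap.mul' k (Uq a Q) ((antipodeLin a Q).rTensor (Uq a Q)
          (t * z ⊗ₜ[k] w)) = antipodeLin a Q z * LinearMap.mul' k (Uq a Q)
          ((antipodeLin a Q).rTensor (Uq a Q) t) * w := by
        intro z w
        clear ht
        induction t using TensorProduct.induction_on with
        | zero => simp
        | tmul x y => simp [antipodeLin_mul, mul_assoc]
        | add x y hx hy => simp only [add_mul, map_add, hx, hy, mul_add]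
      induction s using TensorProduct.induction_on with
      | zero => simp
      | tmul z w =>
        rw [h1, ht, Algebra.algebraMap_eq_smul_one]
        simp
      | add x y hx hy => simp only [mul_add, map_add, hx, hy, smul_add]
    rw [Bialgebra.comul_mul, key _ _ _ hu, hv, Bialgebra.counit_mul, map_mul, Algebra.smul_def]
  | hadd u v hu hv => simp only [map_add, hu, hv]
  | hsmul c u hu => simp only [map_smul, hu, smul_eq_mul, map_mul]; rw [Algebra.smul_def]

theorem antipode_right [DJDatum a Q] (u : Uq a Q) :
    LinearMap.mul' k (Uq a Q) ((antipodeLin a Q).lTensor (Uq a Q) (Coalgebra.comul u)) =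
      algebraMap k (Uq a Q) (Coalgebra.counit u) := by
  have R := Uq.rel (a := a) (Q := Q)
  induction u using Uq.induction with
  | hgen s =>
    rw [comul_gen, counit_gen]
    rcases s with i | i | i | i
    · simp [comulGen, counitGen, antipodeLin_gen, antipodeGen, antipodeLin_one, ← mul_assoc,
        R.k_kInv]
    · simp [comulGen, counitGen, antipodeLin_gen, antipodeGen]
    · simp [comulGen, counitGen, antipodeLin_gen, antipodeGen, R.k_kInv]
    · simp [comulGen, counitGen, antipodeLin_gen, antipodeGen, R.kInv_k]
  | hone => simp [Algebra.TensorProduct.one_def, antipodeLin_one]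
  | hmul u v hu hv =>
    have h1 : ∀ (z w : Uq a Q) (s : Uq a Q ⊗[k] Uq a Q), LinearMap.mul' k (Uq a Q)
        ((antipodeLin a Q).lTensor (Uq a Q) (z ⊗ₜ[k] w * s)) = z * LinearMap.mul' k (Uq a Q)
        ((antipodeLin a Q).lTensor (Uq a Q) s) * antipodeLin a Q w := by
      intro z w s
      induction s using TensorProduct.induction_on with
      | zero => simp
      | tmul x y => simp [antipodeLin_mul, mul_assoc]
      | add x y hx hy => simp only [add_mul, map_add, hx, hy, mul_add]
    have key : ∀ (t s : Uq a Q ⊗[k] Uq a Q) (c : k),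
        LinearMap.mul' k (Uq a Q) ((antipodeLin a Q).lTensor (Uq a Q) s) =
          algebraMap k (Uq a Q) c →
        LinearMap.mul' k (Uq a Q) ((antipodeLin a Q).lTensor (Uq a Q) (t * s)) =
        c • LinearMap.mul' k (Uq a Q) ((antipodeLin a Q).lTensor (Uq a Q) t) := by
      intro t s c hs
      induction t using TensorProduct.induction_on with
      | zero => simp
      | tmul z w =>
        rw [h1, hs, Algebra.algebraMap_eq_smul_one]
        simp
      | add x y hx hy => simp only [add_mul, map_add, hx, hy, smul_add]
    rw [Bialgebra.comul_mul, key _ _ _ hv, hu, Bialgebra.counit_mul, mul_comm, map_mul,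
      Algebra.smul_def]
  | hadd u v hu hv => simp only [map_add, hu, hv]
  | hsmul c u hu => simp only [map_smul, hu, smul_eq_mul, map_mul]; rw [Algebra.smul_def]

/-- The Hopf algebra structure of the quantum group. -/
noncomputable instance [DJDatum a Q] : HopfAlgebra k (Uq a Q) where
  antipode := antipodeLin a Q
  mul_antipode_rTensor_comul := LinearMap.ext fun u => antipode_left a Q u
  mul_antipode_lTensor_comul := LinearMap.ext fun u => antipode_right a Q u

end Hopf

end DrinfeldJimbo

/-! ### The ground field -/

/-- An algebraic closure of the field `ℂ(q)` of rational functions in `q`. -/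
def KK : Type := AlgebraicClosure (RatFunc ℂ)

noncomputable instance : Field KK := inferInstanceAs (Field (AlgebraicClosure (RatFunc ℂ)))

noncomputable instance : Algebra (RatFunc ℂ) KK :=
  inferInstanceAs (Algebra (RatFunc ℂ) (AlgebraicClosure (RatFunc ℂ)))

instance : IsAlgClosure (RatFunc ℂ) KK :=
  inferInstanceAs (IsAlgClosure (RatFunc ℂ) (AlgebraicClosure (RatFunc ℂ)))

instance : IsAlgClosed KK := inferInstanceAs (IsAlgClosed (AlgebraicClosure (RatFunc ℂ)))

instance : CharZero KK := charZero_of_injective_algebraMap (algebraMap (RatFunc ℂ) KK).injective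

/-- The indeterminate `q`. -/
noncomputable def q : KK := algebraMap (RatFunc ℂ) KK RatFunc.X

/-- A square root `q^(1/2)` of `q`. -/
noncomputable def qh : KK := (IsAlgClosed.exists_pow_nat_eq q two_pos).choose

theorem qh_sq : qh ^ 2 = q := (IsAlgClosed.exists_pow_nat_eq q two_pos).choose_spec

/-- A square root `c` of `[2]_{q^(1/2)} = q^(1/2) + q^(-1/2)`. -/
noncomputable def cst : KK := (IsAlgClosed.exists_pow_nat_eq (qh + qh⁻¹) two_pos).choose

theorem cst_sq : cst ^ 2 = qh + qh⁻¹ :=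
  (IsAlgClosed.exists_pow_nat_eq (qh + qh⁻¹) two_pos).choose_spec

theorem q_ne_zero : q ≠ 0 := by
  rw [q, Ne, map_eq_zero_iff _ (algebraMap (RatFunc ℂ) KK).injective]
  exact RatFunc.X_ne_zero

theorem qh_ne_zero : qh ≠ 0 := by
  intro h; apply q_ne_zero; rw [← qh_sq, h]; simp

theorem qh_not_root (r : ℕ) (hr : 0 < r) : qh ^ r ≠ 1 := by
  intro h
  have h1 : q ^ r = 1 := by rw [← qh_sq, ← pow_mul, mul_comm, pow_mul, h, one_pow]
  rw [q, ← map_pow, ← map_one (algebraMap (RatFunc ℂ) KK)] at h1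
  have h2 := (algebraMap (RatFunc ℂ) KK).injective h1
  rw [← RatFunc.algebraMap_X, ← map_pow, ← map_one (algebraMap (Polynomial ℂ) (RatFunc ℂ))] at h2
  have h3 := congrArg Polynomial.natDegree (RatFunc.algebraMap_injective ℂ h2)
  simp at h3
  omega

/-! ### Untwisted affine Cartan matrices of classical type -/

/-- The classical families. -/
inductive Family
  | A | B | C | D

/-- The smallest rank considered in each family. -/
def Family.minRank : Family → ℕ
  | .A => 1
  | .B => 1
  | .C => 1
  | .D => 3

/-- An untwisted affine type `A_n^(1)` (`n ≥ 1`), `B_n^(1)` (`n ≥ 1`), `C_n^(1)` (`n ≥ 1`) or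
`D_n^(1)` (`n ≥ 3`). -/
structure AffineType where
  family : Family
  n : ℕ
  le_n : family.minRank ≤ n

namespace AffineType

variable (t : AffineType)

/-- Adjacency of distinct nodes in the Dynkin diagram for the families `B` and `D`. -/
def forkAdj (n i j : ℕ) : Family → Prop
  | .B => (1 ≤ i ∧ i + 1 = j) ∨ (i = 0 ∧ j = 2)
  | .D => (1 ≤ i ∧ i + 1 = j ∧ j < n) ∨ (i = 0 ∧ j = 2) ∨ (i + 2 = n ∧ j = n) ∨
      (n = 3 ∧ i = 0 ∧ j = 3)
  | _ => False

instance (n i j : ℕ) (f : Family) : Decidable (forkAdj n i j f) := by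
  cases f <;> unfold forkAdj <;> infer_instance

/-- The entries `a_ij`, `0 ≤ i, j ≤ n`, of the affine Cartan matrix. -/
def cartan (i j : ℕ) : ℤ :=
  match t.family with
  | .A => if i = j then 2 else if t.n = 1 then -2 else
      if i + 1 = j ∨ j + 1 = i ∨ (i = 0 ∧ j = t.n) ∨ (i = t.n ∧ j = 0) then -1 else 0
  | .B => if i = j then 2 else if t.n = 1 then -2 else
      if forkAdj t.n i j .B ∨ forkAdj t.n j i .B then (if i = t.n then -2 else -1) else 0
  | .C => if i = j then 2 else
      if i + 1 = j ∨ j + 1 = i then (if j = 0 ∨ j = t.n then -2 else -1) else 0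
  | .D => if i = j then 2 else
      if forkAdj t.n i j .D ∨ forkAdj t.n j i .D then -1 else 0

/-- Twice the numbers `d_i` that symmetrize the Cartan matrix. -/
def twoD (i : ℕ) : ℕ :=
  match t.family with
  | .A => 2
  | .B => if i = t.n ∨ t.n = 1 then 1 else 2
  | .C => if i = 0 ∨ i = t.n then 4 else 2
  | .D => 2

/-- The index set `I = {0, …, n}`. -/
abbrev I : Type := Fin (t.n + 1)

/-- The affine Cartan matrix. -/
def cartanMat (i j : t.I) : ℤ := t.cartan i j

/-- The parameters `q_i = q ^ (d_i)`. -/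
noncomputable def Q (i : t.I) : KK := qh ^ t.twoD i

theorem twoD_symm (i j : ℕ) (hi : i ≤ t.n) (hj : j ≤ t.n) :
    t.twoD i * t.cartan i j = t.twoD j * t.cartan j i := by
  obtain ⟨f, n, hn⟩ := t
  cases f <;> simp only [twoD, cartan, forkAdj] <;> simp only [Family.minRank] at hn hi hj <;> grind

theorem twoD_pos (i : ℕ) : 0 < t.twoD i := by
  obtain ⟨f, n, hn⟩ := t
  cases f <;> simp only [twoD] <;> grind

instance : DJDatum t.cartanMat t.Q where
  ne_zero i := pow_ne_zero _ qh_ne_zero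
  not_root i r hr := by
    rw [Q, ← pow_mul]; exact qh_not_root _ (Nat.mul_pos (t.twoD_pos i) hr)
  diag i := by
    obtain ⟨f, n, hn⟩ := t
    cases f <;> simp [cartanMat, cartan]
  off i j h := by
    have h' : (i : ℕ) ≠ j := fun h' => h (Fin.ext h')
    obtain ⟨f, n, hn⟩ := t
    cases f <;> simp only [cartanMat, cartan, h', if_false] <;> split_ifs <;> simp
  symm i j := by
    rw [Q, Q, ← zpow_natCast, ← zpow_natCast, ← zpow_mul, ← zpow_mul]
    congr 1
    exact t.twoD_symm i j (Nat.lt_succ_iff.1 i.2) (Nat.lt_succ_iff.1 j.2)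

/-- The quantum group `U_q(𝔤)` of the affine type `t`. -/
abbrev Uqg : Type := Uq t.cartanMat t.Q

/-! ### The vector representation -/

/-- The labels `⟨N⟩` of the standard basis of the vector representation. -/
noncomputable def labels : Finset ℤ :=
  match t.family with
  | .A => Finset.Icc 1 (t.n + 1)
  | .B => Finset.Icc (-t.n) t.n
  | .C => (Finset.Icc (-t.n : ℤ) t.n).erase 0
  | .D => (Finset.Icc (-t.n : ℤ) t.n).erase 0

/-- The index type of the standard basis. -/
abbrev Lab : Type := {a : ℤ // a ∈ t.labels}

section rep

variable {F : Type*} [Field F] [Algebra KK F]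

variable (F) in
/-- Elementary matrices `E_ij`, for labels `i, j`. -/
def E (i j : ℤ) : Matrix t.Lab t.Lab F :=
  Matrix.of fun a b => if (a : ℤ) = i ∧ (b : ℤ) = j then 1 else 0

/-- The signs `ϑ_i` in the orthogonal (`B`, `D`) and symplectic (`C`) cases. -/
def theta (i : ℤ) : ℤ :=
  match t.family with
  | .C => i.sign
  | _ => 1

variable (F) in
/-- The matrices `F_ij = E_ij - ϑ_i ϑ_j E_{-j,-i}`. -/
def Fm (i j : ℤ) : Matrix t.Lab t.Lab F :=
  t.E F i j - ((t.theta i * t.theta j : ℤ) : F) • t.E F (-j) (-i)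

/-- The diagonal entry of `F_ii` at the label `a`. -/
def fdiag (i a : ℤ) : ℤ := (if a = i then 1 else 0) - (if a = -i then 1 else 0)

/-- The exponent `m_a` in `T(k_i) = q ^ (∑ m_a E_aa)`. -/
def wt (i : ℕ) (a : ℤ) : ℤ :=
  match t.family with
  | .A => if i = 0 then (if a = t.n + 1 then 1 else 0) - (if a = 1 then 1 else 0)
      else (if a = i then 1 else 0) - (if a = i + 1 then 1 else 0)
  | .B => if i = 0 then (if t.n = 1 then fdiag 1 a else fdiag (t.n - 1) a + fdiag t.n a)
      else if i = t.n then -fdiag 1 a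
      else fdiag (t.n + 1 - i - 1) a - fdiag (t.n + 1 - i) a
  | .C => if i = 0 then 2 * fdiag t.n a
      else if i = t.n then -2 * fdiag 1 a
      else fdiag (t.n + 1 - i - 1) a - fdiag (t.n + 1 - i) a
  | .D => if i = 0 then fdiag (t.n - 1) a + fdiag t.n a
      else if i = t.n then -fdiag 1 a - fdiag 2 a
      else fdiag (t.n + 1 - i - 1) a - fdiag (t.n + 1 - i) a

variable (F) in
/-- The matrix `T_w(k_i) ^ e`. -/
noncomputable def vecK (i : ℕ) (e : ℤ) : Matrix t.Lab t.Lab F :=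
  Matrix.diagonal fun a => algebraMap KK F q ^ (e * t.wt i a)

/-- The matrix `T_w(x_i)`. In type `C`, `½ F_{-1,1} = E_{-1,1}` and `½ F_{n,-n} = E_{n,-n}`. -/
noncomputable def vecX (w : F) (i : ℕ) : Matrix t.Lab t.Lab F :=
  match t.family with
  | .A => if i = 0 then w • t.E F (t.n + 1) 1 else t.E F i (i + 1)
  | .B => if i = 0 then
        (if t.n = 1 then w • algebraMap KK F cst •
            (t.E F 0 (-1) - algebraMap KK F qh • t.E F 1 0)
          else w • t.Fm F (t.n - 1) (-t.n))
      else if i = t.n then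
        algebraMap KK F cst • (t.E F (-1) 0 - (algebraMap KK F qh)⁻¹ • t.E F 0 1)
      else t.Fm F (-(t.n + 1 - i)) (-(t.n + 1 - i) + 1)
  | .C => if i = 0 then w • t.E F t.n (-t.n)
      else if i = t.n then t.E F (-1) 1
      else t.Fm F (-(t.n + 1 - i)) (-(t.n + 1 - i) + 1)
  | .D => if i = 0 then w • t.Fm F (t.n - 1) (-t.n)
      else if i = t.n then t.Fm F (-2) 1
      else t.Fm F (-(t.n + 1 - i)) (-(t.n + 1 - i) + 1)

/-- The matrix `T_w(y_i)`. In type `C`, `½ F_{1,-1} = E_{1,-1}` and `½ F_{-n,n} = E_{-n,n}`. -/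
noncomputable def vecY (w : F) (i : ℕ) : Matrix t.Lab t.Lab F :=
  match t.family with
  | .A => if i = 0 then w⁻¹ • t.E F 1 (t.n + 1) else t.E F (i + 1) i
  | .B => if i = 0 then
        (if t.n = 1 then w⁻¹ • algebraMap KK F cst •
            (t.E F (-1) 0 - (algebraMap KK F qh)⁻¹ • t.E F 0 1)
          else w⁻¹ • t.Fm F (-t.n) (t.n - 1))
      else if i = t.n then
        algebraMap KK F cst • (t.E F 0 (-1) - algebraMap KK F qh • t.E F 1 0)
      else t.Fm F (-(t.n + 1 - i) + 1) (-(t.n + 1 - i))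
  | .C => if i = 0 then w⁻¹ • t.E F (-t.n) t.n
      else if i = t.n then t.E F 1 (-1)
      else t.Fm F (-(t.n + 1 - i) + 1) (-(t.n + 1 - i))
  | .D => if i = 0 then w⁻¹ • t.Fm F (-t.n) (t.n - 1)
      else if i = t.n then t.Fm F 1 (-2)
      else t.Fm F (-(t.n + 1 - i) + 1) (-(t.n + 1 - i))

/-- The values of the vector representation `T_w` on the generators. -/
noncomputable def vecGen (w : F) : Gen t.I → Matrix t.Lab t.Lab F
  | .x i => t.vecX w i
  | .y i => t.vecY w i
  | .k i => t.vecK F i 1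
  | .kInv i => t.vecK F i (-1)

/-! #### Verification of the defining relations -/

theorem E_mul_ne {a b c d : ℤ} (h : b ≠ c) : t.E F a b * t.E F c d = 0 := by
  ext i j
  simp only [Matrix.mul_apply, E, Matrix.of_apply, Matrix.zero_apply]
  apply Finset.sum_eq_zero
  intro x _
  split_ifs <;> simp_all

theorem E_mul_eq {a b c d : ℤ} (h : b = c) (hb : b ∈ t.labels) :
    t.E F a b * t.E F c d = t.E F a d := by
  subst h
  ext i j
  simp only [Matrix.mul_apply, E, Matrix.of_apply]
  rw [Finset.sum_eq_single ⟨b, hb⟩]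
  · by_cases h1 : (i : ℤ) = a <;> by_cases h2 : (j : ℤ) = d <;> simp [h1, h2]
  · rintro ⟨x, hx⟩ _ hne
    have : x ≠ b := fun h => hne (Subtype.ext h)
    simp [this]
  · simp

theorem vecK_mul_E (i : ℕ) (e a b : ℤ) :
    t.vecK F i e * t.E F a b = (algebraMap KK F q ^ (e * t.wt i a)) • t.E F a b := by
  ext x y
  simp only [vecK, Matrix.diagonal_mul, E, Matrix.of_apply, Matrix.smul_apply, smul_eq_mul]
  split_ifs with h
  · rw [h.1]
  · simp

theorem E_mul_vecK (i : ℕ) (e a b : ℤ) :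
    t.E F a b * t.vecK F i e = (algebraMap KK F q ^ (e * t.wt i b)) • t.E F a b := by
  ext x y
  simp only [vecK, Matrix.mul_diagonal, E, Matrix.of_apply, Matrix.smul_apply, smul_eq_mul]
  split_ifs with h
  · rw [h.2]; ring
  · simp

theorem qF_ne_zero : algebraMap KK F q ≠ 0 := by
  rw [Ne, map_eq_zero_iff _ (algebraMap KK F).injective]; exact q_ne_zero

/-- `M` has weight `m` with respect to `k_i` (exponent of `q^(1/2)`). -/
def HasWt (i : ℕ) (m : ℤ) (M : Matrix t.Lab t.Lab F) : Prop :=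
  t.vecK F i 1 * M = (qh ^ m : KK) • (M * t.vecK F i 1)

variable {t}

theorem HasWt.E {i : ℕ} {m a b : ℤ} (h : 2 * t.wt i a = m + 2 * t.wt i b) :
    t.HasWt i m (t.E F a b) := by
  have h2 : t.wt i a * 2 = m + t.wt i b * 2 := by omega
  rw [HasWt, vecK_mul_E, E_mul_vecK, one_mul, one_mul, algebra_compatible_smul F (qh ^ m),
    smul_smul, ← map_zpow₀, ← map_zpow₀, ← map_mul, ← qh_sq, ← zpow_natCast, ← zpow_mul, ← zpow_mul,
    ← zpow_add₀ qh_ne_zero]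
  congr 3

theorem HasWt.sub {i : ℕ} {m : ℤ} {M M' : Matrix t.Lab t.Lab F} (h : t.HasWt i m M)
    (h' : t.HasWt i m M') : t.HasWt i m (M - M') := by
  unfold HasWt at *
  rw [mul_sub, h, h', sub_mul, smul_sub]

theorem HasWt.smul {i : ℕ} {m : ℤ} {M : Matrix t.Lab t.Lab F} (c : F) (h : t.HasWt i m M) :
    t.HasWt i m (c • M) := by
  unfold HasWt at *
  rw [mul_smul_comm, h, smul_mul_assoc, smul_comm]

set_option maxHeartbeats 4000000 in
theorem hasWt_x (w : F) {i j : ℕ} (hi : i ≤ t.n) (hj : j ≤ t.n) :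
    t.HasWt i (t.twoD i * t.cartan i j) (t.vecX w j) := by
  obtain ⟨f, n, hn⟩ := t
  cases f <;> simp only [vecX] <;> simp only [Family.minRank] at hn hi hj <;> split_ifs <;>
    repeat' first | apply HasWt.smul | apply HasWt.sub | apply HasWt.E
  all_goals
    simp only [twoD, cartan, wt, fdiag, forkAdj]
    grind (splits := 40)

end rep

section verification

variable {F : Type*} [Field F] [Algebra KK F] {t : AffineType}

theorem mem_labels (b : ℤ) : b ∈ t.labels ↔ match t.family with
  | .A => 1 ≤ b ∧ b ≤ t.n + 1
  | .B => -t.n ≤ b ∧ b ≤ t.n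
  | _ => b ≠ 0 ∧ -t.n ≤ b ∧ b ≤ t.n := by
  cases hf : t.family <;> simp [labels, hf]

set_option maxHeartbeats 4000000 in
theorem x_y_ne (w : F) (hw : w ≠ 0) {i j : ℕ} (hi : i ≤ t.n) (hj : j ≤ t.n) (h : i ≠ j) :
    t.vecX w i * t.vecY w j - t.vecY w j * t.vecX w i = 0 := by
  have hn := t.le_n
  cases hf : t.family <;> simp only [hf, Family.minRank] at hn <;>
    simp only [vecX, vecY, Fm, hf] <;> split_ifs <;>
    (try omega) <;> (try simp only [theta, hf, sub_mul, mul_sub, smul_mul_assoc, mul_smul_comm]) <;>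
    by_cases h1 : j = i + 1 <;> by_cases h2 : i = j + 1 <;> (try omega) <;>
    try simp (disch := first | omega | (rw [mem_labels, hf]; dsimp only; omega)) only
      [E_mul_ne, E_mul_eq, smul_zero, sub_zero, zero_sub]
  all_goals
    (try rw [show (t.n + 1 - j : ℤ) = t.n by omega])
    (try rw [show (t.n + 1 - j : ℤ) = 2 by omega])
    (try rw [show (t.n + 1 - i : ℤ) = t.n by omega])
    (try rw [show (t.n + 1 - i : ℤ) = 2 by omega])
    (try simp only [mul_one, Int.cast_one, one_smul, neg_neg, Int.reduceNeg, Int.reduceAdd])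
    module

theorem EE_smul {a b a' b' : ℤ} (h : a = a') (h' : b = b') : t.E F a b = t.E F a' b' := by
  rw [h, h']

theorem cst_sq_F : algebraMap KK F cst ^ 2 = algebraMap KK F qh + (algebraMap KK F qh)⁻¹ := by
  rw [← map_pow, cst_sq, map_add, map_inv₀]

theorem qhF_ne_zero : algebraMap KK F qh ≠ 0 := by
  rw [Ne, map_eq_zero_iff _ (algebraMap KK F).injective]; exact qh_ne_zero

theorem E_diag_apply (a : ℤ) (x y : t.Lab) :
    t.E F a a x y = if x = y then (if (x : ℤ) = a then 1 else 0) else 0 := by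
  simp only [E, Matrix.of_apply]
  by_cases h : x = y
  · subst h; simp
  · have h' : (x : ℤ) ≠ y := fun h' => h (Subtype.ext h')
    rw [if_neg h, if_neg]
    rintro ⟨rfl, h2⟩
    exact h' h2.symm

theorem qh_pow_sub (r : ℕ) (hr : 0 < r) :
    algebraMap KK F qh ^ r - (algebraMap KK F qh ^ r)⁻¹ ≠ 0 := by
  intro h
  rw [sub_eq_zero] at h
  have h0 := pow_ne_zero r (qhF_ne_zero (F := F))
  have h1 : algebraMap KK F qh ^ r * algebraMap KK F qh ^ r = 1 := by
    nth_rewrite 2 [h]; exact mul_inv_cancel₀ h0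
  rw [← pow_add, ← map_pow, ← map_one (algebraMap KK F)] at h1
  exact qh_not_root (r + r) (by omega) ((algebraMap KK F).injective h1)

theorem theta_pred (p : ℤ) (hp : 2 ≤ p) : (-p).sign * (-p + 1).sign = 1 := by
  rw [Int.sign_eq_neg_one_of_neg (by omega), Int.sign_eq_neg_one_of_neg (by omega)]; rfl

theorem theta_pred' (p : ℤ) (hp : 2 ≤ p) : (-p + 1).sign * (-p).sign = 1 := by
  rw [mul_comm, theta_pred p hp]

theorem qF_eq : algebraMap KK F q = algebraMap KK F qh ^ 2 := by rw [← map_pow, qh_sq]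

set_option maxHeartbeats 4000000 in
theorem x_y_eq (w : F) (hw : w ≠ 0) {i : ℕ} (hi : i ≤ t.n) :
    t.vecX w i * t.vecY w i - t.vecY w i * t.vecX w i =
      (qh ^ t.twoD i - (qh ^ t.twoD i)⁻¹)⁻¹ • (t.vecK F i 1 - t.vecK F i (-1)) := by
  have hn := t.le_n
  cases hf : t.family <;> simp only [hf, Family.minRank] at hn <;>
    simp only [vecX, vecY, Fm, hf] <;> split_ifs <;>
    (try omega) <;> (try simp only [theta, hf, sub_mul, mul_sub, smul_mul_assoc, mul_smul_comm]) <;>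
    try simp (disch := first | omega | (rw [mem_labels, hf]; dsimp only; omega)) only
      [E_mul_ne, E_mul_eq, smul_zero, sub_zero, zero_sub]
  all_goals
    (try rw [theta_pred _ (by omega), theta_pred' _ (by omega)])
    rw [algebra_compatible_smul F ((qh ^ t.twoD i - (qh ^ t.twoD i)⁻¹)⁻¹)]
    ext a b
    simp only [vecK, Matrix.sub_apply, Matrix.smul_apply, Matrix.neg_apply, E_diag_apply,
      Matrix.diagonal_apply]
    by_cases hab : a = b
    swap
    · simp [hab]
    subst hab
    simp only [smul_eq_mul, map_inv₀, map_sub, map_pow, qF_eq, if_true]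
    have hs := qhF_ne_zero (F := F)
    have h1 := qh_pow_sub (F := F) 1 (by norm_num)
    have h2 := qh_pow_sub (F := F) 2 (by norm_num)
    have h4 := qh_pow_sub (F := F) 4 (by norm_num)
    have hc := cst_sq_F (F := F)
    have ha := a.2
    rw [mem_labels, hf] at ha
    obtain ⟨a, ha'⟩ := a
    dsimp only at ha ⊢
    generalize algebraMap KK F qh = s at *
    generalize algebraMap KK F cst = c at *
    rw [eq_inv_mul_iff_mul_eq₀ (by simp only [twoD, hf]; first | assumption | split_ifs <;> assumption)]
    simp only [twoD, wt, hf, fdiag]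
    (try simp (disch := omega) only [if_pos, if_neg])
    (try simp only [neg_neg, show ∀ p : ℤ, -(-p + 1) = p - 1 by intro p; ring,
      show ∀ p : ℤ, -p + 1 = -(p - 1) by intro p; ring])
    split_ifs <;> (try omega) <;> (try simp only [mul_one, mul_zero, neg_zero, Int.cast_one, one_mul, sub_self, sub_zero, zero_sub, mul_neg, neg_neg, zpow_neg, zpow_one, zpow_zero])
    all_goals
      (try simp only [Int.reduceNeg, Int.reduceAdd, Int.reduceMul, zero_add, add_zero, mul_zero,
        zpow_neg, zpow_one, zpow_ofNat, zpow_zero, sub_self])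
      try field_simp at hc ⊢
      first | done | ring1 | linear_combination (s ^ 2 - 1) * hc |
        linear_combination (1 - s ^ 2) * hc

/-- Non-adjacency, spelled out. -/
def NonAdj (t : AffineType) (i j : ℕ) : Prop :=
  match t.family with
  | .A => j ≠ i + 1 ∧ (i = 0 → j ≠ t.n)
  | .B => t.n ≠ 1 ∧ (0 < i → j ≠ i + 1) ∧ (i = 0 → j ≠ 2)
  | .C => j ≠ i + 1
  | .D => (0 < i → j < t.n → j ≠ i + 1) ∧ (i = 0 → j ≠ 2) ∧ (j = t.n → i + 2 ≠ t.n) ∧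
      (t.n = 3 → i = 0 → j ≠ 3)

theorem nonAdj_of {i j : ℕ} (hi : i ≤ t.n) (hj : j ≤ t.n) (h : i ≠ j)
    (hc : t.cartan i j = 0) : t.NonAdj i j ∧ t.NonAdj j i := by
  have hn := t.le_n
  cases hf : t.family <;> simp only [hf, Family.minRank] at hn <;>
    simp only [cartan, forkAdj, hf, h, if_false] at hc <;> simp only [NonAdj, hf] <;>
    split_ifs at hc with h1 h2 h3 <;> simp_all <;> omega

set_option maxHeartbeats 4000000 in
theorem serre_x_zero (w : F) {i j : ℕ} (hi : i ≤ t.n) (hj : j ≤ t.n) (h : i ≠ j)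
    (hc : t.cartan i j = 0) : t.vecX w i * t.vecX w j = t.vecX w j * t.vecX w i := by
  obtain ⟨g1, g2⟩ := nonAdj_of hi hj h hc
  clear hc
  have hn := t.le_n
  rw [← sub_eq_zero]
  cases hf : t.family <;> simp only [hf, Family.minRank] at hn <;>
    simp only [NonAdj, hf] at g1 g2 <;>
    simp only [vecX, Fm, hf] <;> split_ifs <;> (try omega) <;>
    (try simp only [theta, hf, sub_mul, mul_sub, smul_mul_assoc, mul_smul_comm])
  all_goals
    (try simp (disch := omega) only [E_mul_ne, smul_zero, sub_zero, zero_sub])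
  all_goals
    clear g1 g2
    by_cases h1 : j = i + 1 <;> by_cases h2 : i = j + 1 <;>
    (try simp (disch := omega) only [E_mul_ne, smul_zero, sub_zero, zero_sub]) <;>
    (try omega) <;>
    (try simp (disch := first | omega | (rw [mem_labels, hf]; dsimp only; omega)) only [E_mul_eq])
  all_goals
    (try rw [show (t.n + 1 - j : ℤ) = t.n by omega])
    (try rw [show (t.n + 1 - j : ℤ) = 2 by omega])
    (try rw [show (t.n + 1 - i : ℤ) = t.n by omega])
    (try rw [show (t.n + 1 - i : ℤ) = 2 by omega])
    (try simp only [mul_one, Int.cast_one, one_smul, neg_neg, neg_zero, smul_zero, sub_self,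
      Int.reduceNeg, Int.reduceAdd, show (-(-(t.n : ℤ) + 1)) = t.n - 1 by ring,
      show -((t.n : ℤ) - 1) = -t.n + 1 by ring])
    first | done | module

/-- Nodes with `T(x_i)² ≠ 0`. -/
def Short (t : AffineType) (i : ℕ) : Prop := t.family = .B ∧ (i = t.n ∨ t.n = 1)

set_option maxHeartbeats 4000000 in
theorem x_sq (w : F) {i : ℕ} (hi : i ≤ t.n) (h : ¬ t.Short i) : t.vecX w i * t.vecX w i = 0 := by
  have hn := t.le_n
  rw [Short] at h
  cases hf : t.family <;> simp only [hf, Family.minRank, true_and] at hn h <;>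
    simp only [vecX, Fm, hf] <;> split_ifs <;> (try omega) <;>
    (try simp only [theta, hf, sub_mul, mul_sub, smul_mul_assoc, mul_smul_comm]) <;>
    simp (disch := omega) only [E_mul_ne, smul_zero, sub_zero]

set_option maxHeartbeats 400000 in
theorem adj_of {i j : ℕ} (hi : i ≤ t.n) (hj : j ≤ t.n) (h : i ≠ j)
    (hc : t.cartan i j = -1) : ¬ t.Short i ∧ t.n ≠ 1 ∧ match t.family with
      | .A => j = i + 1 ∨ i = j + 1 ∨ (i = 0 ∧ j = t.n) ∨ (i = t.n ∧ j = 0)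
      | .B => (i ≠ 0 ∧ j = i + 1) ∨ (j ≠ 0 ∧ i = j + 1) ∨ (i = 0 ∧ j = 2) ∨ (j = 0 ∧ i = 2)
      | .C => (j = i + 1 ∨ i = j + 1) ∧ j ≠ 0 ∧ j ≠ t.n
      | .D => (i ≠ 0 ∧ j ≠ t.n ∧ j = i + 1) ∨ (j ≠ 0 ∧ i ≠ t.n ∧ i = j + 1) ∨ (i = 0 ∧ j = 2) ∨
        (j = 0 ∧ i = 2) ∨ (i + 2 = t.n ∧ j = t.n) ∨ (j + 2 = t.n ∧ i = t.n) ∨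
        (t.n = 3 ∧ i = 0 ∧ j = 3) ∨ (t.n = 3 ∧ i = 3 ∧ j = 0) := by
  have hn := t.le_n
  rw [Short]
  cases hf : t.family <;> simp only [hf, Family.minRank] at hn <;>
    simp only [cartan, hf, h, if_false] at hc
  · split_ifs at hc with h1 h2 <;> grind
  · split_ifs at hc with h1 h2 h3 <;> simp only [forkAdj] at * <;> grind
  · split_ifs at hc with h1 h2 <;> grind
  · refine ⟨by simp, by omega, ?_⟩
    have h1 : forkAdj t.n i j .D ∨ forkAdj t.n j i .D := by
      by_contra hcon
      rw [if_neg hcon] at hc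
      omega
    simp only [forkAdj] at h1
    rcases h1 with (⟨_, _, _⟩ | ⟨_, _⟩ | ⟨_, _⟩ | ⟨_, _, _⟩) |
      (⟨_, _, _⟩ | ⟨_, _⟩ | ⟨_, _⟩ | ⟨_, _, _⟩)
    · exact Or.inl ⟨by omega, by omega, by omega⟩
    · exact Or.inr <| Or.inr <| Or.inl ⟨by omega, by omega⟩
    · exact Or.inr <| Or.inr <| Or.inr <| Or.inr <| Or.inl ⟨by omega, by omega⟩
    · exact Or.inr <| Or.inr <| Or.inr <| Or.inr <| Or.inr <| Or.inr <| Or.inl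
        ⟨by omega, by omega, by omega⟩
    · exact Or.inr <| Or.inl ⟨by omega, by omega, by omega⟩
    · exact Or.inr <| Or.inr <| Or.inr <| Or.inl ⟨by omega, by omega⟩
    · exact Or.inr <| Or.inr <| Or.inr <| Or.inr <| Or.inr <| Or.inl ⟨by omega, by omega⟩
    · exact Or.inr <| Or.inr <| Or.inr <| Or.inr <| Or.inr <| Or.inr <| Or.inr
        ⟨by omega, by omega, by omega⟩

set_option maxHeartbeats 4000000 in
theorem x_x_x (w : F) {i j : ℕ} (hi : i ≤ t.n) (hj : j ≤ t.n) (h : i ≠ j)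
    (hc : t.cartan i j = -1) : t.vecX w i * t.vecX w j * t.vecX w i = 0 := by
  obtain ⟨g1, g2, g3⟩ := adj_of hi hj h hc
  clear hc
  rw [Short] at g1
  have hn := t.le_n
  cases hf : t.family <;> simp only [hf, Family.minRank, true_and] at hn g1 g3 <;>
    simp only [vecX, Fm, hf] <;> split_ifs <;> (try omega) <;>
    by_cases h1 : j = i + 1 <;> by_cases h2 : i = j + 1 <;> (try omega) <;>
    (try simp only [theta, hf, sub_mul, mul_sub, smul_mul_assoc, mul_smul_comm])
  all_goals
    (try simp (disch := omega) only [E_mul_ne, smul_zero, sub_zero, zero_sub, zero_mul])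
  all_goals
    (try simp (disch := first | omega | (rw [mem_labels, hf]; dsimp only; omega)) only [E_mul_eq, neg_mul, smul_mul_assoc])
  all_goals
    (try simp (disch := omega) only [E_mul_ne, smul_zero, sub_zero, zero_sub, zero_mul, neg_zero])

set_option maxHeartbeats 4000000 in
theorem short_cube (w : F) {i : ℕ} (hi : i ≤ t.n) (h : t.Short i) :
    t.vecX w i * t.vecX w i * t.vecX w i = 0 := by
  obtain ⟨hf, h⟩ := h
  simp only [vecX, Fm, hf] <;> split_ifs <;> (try omega) <;>
    (try simp only [sub_mul, mul_sub, smul_mul_assoc, mul_smul_comm]) <;>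
  (try simp (disch := first | omega | (rw [mem_labels, hf]; dsimp only; omega)) only
    [E_mul_ne, E_mul_eq, smul_zero, sub_zero, zero_sub, zero_mul, neg_zero, neg_mul, smul_mul_assoc, sub_self])

theorem short_adj {i j : ℕ} (hi : i ≤ t.n) (hj : j ≤ t.n) (h : i ≠ j) (hs : t.Short i)
    (hc : t.cartan i j ≠ 0) : t.n = 1 ∨ (i = t.n ∧ (i = j + 1 ∨ (t.n = 2 ∧ j = 0))) := by
  obtain ⟨hf, hs⟩ := hs
  simp only [cartan, forkAdj, hf, h, if_false] at hc
  split_ifs at hc with h1 h2 h3 <;> omega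

set_option maxHeartbeats 4000000 in
theorem short_adj_eq (w : F) {i j : ℕ} (hi : i ≤ t.n) (hj : j ≤ t.n) (h : i ≠ j) (hs : t.Short i)
    (hc : t.cartan i j ≠ 0) :
    t.vecX w i * t.vecX w i * t.vecX w j * t.vecX w i =
      t.vecX w i * t.vecX w j * t.vecX w i * t.vecX w i := by
  have g := short_adj hi hj h hs hc
  obtain ⟨hf, hs⟩ := hs
  have hn := t.le_n
  clear hc
  have hq := qhF_ne_zero (F := F)
  rw [← sub_eq_zero]
  simp only [hf, Family.minRank] at hn
  simp only [vecX, Fm, hf] <;> split_ifs <;> (try omega) <;>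
    by_cases h1 : i = j + 1 <;> (try omega) <;>
    (try simp only [sub_mul, mul_sub, smul_mul_assoc, mul_smul_comm]) <;>
  (try simp (disch := omega) only
    [E_mul_ne, smul_zero, sub_zero, zero_sub, zero_mul, neg_zero, neg_mul, smul_mul_assoc, sub_self]) <;>
  (try simp (disch := first | omega | (rw [mem_labels, hf]; dsimp only; omega)) only
    [E_mul_eq, smul_mul_assoc]) <;>
  (try simp (disch := omega) only
    [E_mul_ne, smul_zero, sub_zero, zero_sub, zero_mul, neg_zero, neg_mul, smul_mul_assoc, sub_self])
  all_goals
    match_scalars <;> field_simp <;> ring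

theorem serreTC_x (w : F) {i j : t.I} (h : i ≠ j) :
    serreTC (t.Q i) (1 - t.cartanMat i j).toNat (t.vecX w i) (t.vecX w j) = 0 := by
  have hi := Nat.lt_succ_iff.1 i.2
  have hj := Nat.lt_succ_iff.1 j.2
  have h' : (i : ℕ) ≠ j := fun e => h (Fin.ext e)
  have hQ := DJDatum.ne_zero (a := t.cartanMat) (Q := t.Q) i
  generalize hX : t.vecX w i = X
  generalize hY : t.vecX w j = Y
  generalize t.Q i = c at hQ
  rcases DJDatum.off (a := t.cartanMat) (Q := t.Q) i j h with e | e | e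
  · rw [e]
    have h1 := serre_x_zero w hi hj h' e
    rw [hX, hY] at h1
    simp [serreTC, tc, h1]
  · rw [e]
    have h1 := x_x_x w hi hj h' e
    have h2 := x_sq w hi (adj_of hi hj h' e).1
    rw [hX] at h1 h2
    rw [hY] at h1
    have h3 : Y * X * X = 0 := by rw [mul_assoc, h2, mul_zero]
    change tc c X (tc c⁻¹ X Y) = 0
    simp [tc, mul_sub, sub_mul, ← mul_assoc, h1, h2, h3]
  · rw [e]
    have key : X * X * X = 0 ∧ X * X * Y * X = X * Y * X * X := by
      by_cases hs : t.Short i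
      · have h1 := short_cube w hi hs
        have h2 := short_adj_eq w hi hj h' hs (by rw [cartanMat] at e; rw [e]; decide)
        rw [hX] at h1 h2
        rw [hY] at h2
        exact ⟨h1, h2⟩
      · have h2 := x_sq w hi hs
        rw [hX] at h2
        exact ⟨by rw [h2, zero_mul], by rw [h2, mul_assoc _ X X, h2, zero_mul, zero_mul, mul_zero]⟩
    obtain ⟨h1, h2⟩ := key
    have h3 : Y * X * X * X = 0 := by rw [mul_assoc, mul_assoc, ← mul_assoc X, h1, mul_zero]
    change tc (c ^ 2) X (tc (1 : KK) X (tc (c⁻¹ ^ 2) X Y)) = 0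
    simp only [tc, mul_sub, sub_mul, mul_smul_comm, smul_mul_assoc, smul_sub, ← mul_assoc, h1, h2,
      h3, smul_zero, zero_mul]
    match_scalars
    field_simp
    ring

theorem map_serreTC {A B : Type*} [Ring A] [Algebra KK A] [Ring B] [Algebra KK B] (f : A →ₐ[KK] B)
    (c : KK) (m : ℕ) (X Y : A) : f (serreTC c m X Y) = serreTC c m (f X) (f Y) := by
  unfold serreTC
  split <;> simp only [map_tc]

/-- The anti-automorphism `M ↦ D Mᵀ D⁻¹` for a diagonal matrix `D`. -/
noncomputable def conjT (d : t.Lab → Fˣ) :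
    (Matrix t.Lab t.Lab F)ᵐᵒᵖ →ₐ[KK] Matrix t.Lab t.Lab F :=
  AlgHom.ofLinearMap
    { toFun := fun M => Matrix.of fun a b => (d a : F) * M.unop b a * ((d b)⁻¹ : Fˣ)
      map_add' := fun M N => by ext a b; simp [mul_add, add_mul]
      map_smul' := fun c M => by ext a b; simp }
    (by
      ext a b
      by_cases h : a = b
      · subst h; simp
      · simp [h, Ne.symm h])
    (by
      intro M N
      ext a b
      simp only [LinearMap.coe_mk, AddHom.coe_mk, Matrix.of_apply, MulOpposite.unop_mul,
        Matrix.mul_apply, Finset.mul_sum, Finset.sum_mul]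
      apply Finset.sum_congr rfl
      intro x _
      have := (d x).inv_mul
      linear_combination (-(d a : F) * N.unop b x * M.unop x a * ((d b)⁻¹ : Fˣ)) * this)

/-- Weights used to compare `T(x_i)` and `T(y_i)`. -/
noncomputable def dfun (F : Type*) [Field F] [Algebra KK F] (t : AffineType) (a : ℤ) : Fˣ :=
  match t.family with
  | .B => if 0 < a then Units.mk0 (algebraMap KK F q) qF_ne_zero else 1
  | _ => 1

/-- The change of the spectral parameter in `vecY_eq`. -/
noncomputable def wfun (t : AffineType) (w : F) : F :=
  match t.family with
  | .B => if t.n = 1 then w⁻¹ else algebraMap KK F q * w⁻¹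
  | _ => w⁻¹

/-- The same weights, as elements of `F`. -/
noncomputable def dnum (F : Type*) [Field F] [Algebra KK F] (t : AffineType) (a : ℤ) : F :=
  match t.family with
  | .B => if 0 < a then algebraMap KK F q else 1
  | _ => 1

theorem dfun_coe (a : ℤ) : (dfun F t a : F) = dnum F t a := by
  simp only [dfun, dnum]; split <;> (try split_ifs) <;> rfl

theorem conjT_E (a b : ℤ) : conjT (fun a => dfun F t a) (MulOpposite.op (t.E F a b)) =
    (dnum F t b * (dnum F t a)⁻¹) • t.E F b a := by
  ext x y
  simp only [conjT, AlgHom.ofLinearMap_apply, LinearMap.coe_mk, AddHom.coe_mk, Matrix.of_apply,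
    MulOpposite.unop_op, E, Matrix.smul_apply, smul_eq_mul, Units.val_inv_eq_inv_val, dfun_coe]
  by_cases h1 : (x : ℤ) = b <;> by_cases h2 : (y : ℤ) = a <;> simp [h1, h2]

theorem conjT_smul (d : t.Lab → Fˣ) (c : F) (M : Matrix t.Lab t.Lab F) :
    conjT d (MulOpposite.op (c • M)) = c • conjT d (MulOpposite.op M) := by
  ext a b
  simp [conjT]
  ring

theorem vecY_eq (w : F) {i : ℕ} (hi : i ≤ t.n) :
    t.vecY w i = conjT (fun a => dfun F t a) (MulOpposite.op
      (t.vecX (wfun t w) i)) := by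
  have hn := t.le_n
  have hq := qF_ne_zero (F := F)
  have hs := qhF_ne_zero (F := F)
  cases hf : t.family <;> simp only [hf, Family.minRank] at hn <;>
    simp only [vecX, vecY, Fm, hf, wfun] <;> split_ifs <;> (try omega) <;>
    simp only [conjT_smul, MulOpposite.op_sub, map_sub, conjT_E, dnum, theta, hf] <;>
    (try simp (disch := omega) only [if_pos, if_neg, inv_one, mul_one, one_smul, one_mul,
      mul_comm, smul_smul, Int.cast_one, neg_neg, mul_inv_cancel₀ hq, Int.reduceLT, if_true, if_false, neg_zero])
  all_goals
    rw [qF_eq]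
    match_scalars <;> field_simp

theorem serreTC_y (w : F) {i j : t.I} (h : i ≠ j) :
    serreTC (t.Q i) (1 - t.cartanMat i j).toNat (t.vecY w i) (t.vecY w j) = 0 := by
  rw [vecY_eq w (Nat.lt_succ_iff.1 i.2), vecY_eq w (Nat.lt_succ_iff.1 j.2), ← map_serreTC,
    serreTC_op (DJDatum.ne_zero (a := t.cartanMat) (Q := t.Q) i) (serreTC_x _ h), map_zero]

theorem conjT_vecK (i : ℕ) (e : ℤ) :
    conjT (fun a => dfun F t a) (MulOpposite.op (t.vecK F i e)) = t.vecK F i e := by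
  ext a b
  simp only [conjT, AlgHom.ofLinearMap_apply, LinearMap.coe_mk, AddHom.coe_mk, Matrix.of_apply,
    MulOpposite.unop_op, vecK, Matrix.diagonal_apply]
  by_cases h : a = b
  · subst h
    simp only [if_true]
    rw [mul_right_comm, Units.mul_inv, one_mul]
  · simp [h, Ne.symm h]

theorem hasWt_y (w : F) {i j : ℕ} (hi : i ≤ t.n) (hj : j ≤ t.n) :
    t.HasWt i (-(t.twoD i * t.cartan i j)) (t.vecY w j) := by
  have h := hasWt_x (wfun t w) hi hj
  unfold HasWt at h ⊢
  have h2 := congrArg (fun M => conjT (fun a => dfun F t a) (MulOpposite.op M)) h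
  simp only [MulOpposite.op_mul, MulOpposite.op_smul, map_mul, map_smul, conjT_vecK,
    ← vecY_eq w hj] at h2
  rw [h2, smul_smul, ← zpow_add₀ qh_ne_zero, neg_add_cancel, zpow_zero, one_smul]

theorem vecK_mul (i j : ℕ) (e f : ℤ) : t.vecK F i e * t.vecK F j f =
    Matrix.diagonal fun a : t.Lab => algebraMap KK F q ^ (e * t.wt i a + f * t.wt j a) := by
  rw [vecK, vecK, Matrix.diagonal_mul_diagonal]
  congr 1
  funext a
  rw [zpow_add₀ qF_ne_zero]

theorem Q_zpow (i : t.I) (m : ℤ) : t.Q i ^ m = qh ^ (t.twoD i * m) := by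
  rw [Q, ← zpow_natCast, ← zpow_mul]

variable (t) in
/-- The matrices `vecGen` satisfy the defining relations. -/
theorem vecGen_rel (w : Fˣ) : DJRel t.cartanMat t.Q (t.vecGen (w : F)) where
  k_kInv i := by simp [vecGen, vecK_mul]
  kInv_k i := by simp [vecGen, vecK_mul]
  k_k i j := by
    simp only [vecGen, vecK_mul]
    simp only [add_comm]
  k_x i j := by
    have := hasWt_x (w : F) (Nat.lt_succ_iff.1 i.2) (Nat.lt_succ_iff.1 j.2)
    rw [HasWt] at this
    rw [Q_zpow]
    exact this
  k_y i j := by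
    have := hasWt_y (w : F) (Nat.lt_succ_iff.1 i.2) (Nat.lt_succ_iff.1 j.2)
    rw [HasWt] at this
    rw [Q_zpow, mul_neg]
    exact this
  x_y i := x_y_eq (w : F) w.ne_zero (Nat.lt_succ_iff.1 i.2)
  x_y_ne i j h := x_y_ne (w : F) w.ne_zero (Nat.lt_succ_iff.1 i.2) (Nat.lt_succ_iff.1 j.2)
    fun e => h (Fin.ext e)
  serre_x i j h := (DJDatum.serre_iff h _ _).2 (serreTC_x _ h)
  serre_y i j h := (DJDatum.serre_iff h _ _).2 (serreTC_y _ h)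

variable (t) in
/-- The vector representation `T_w : U_q(𝔤) → End(F^N)` with spectral parameter `w`, over an
extension field `F` of the ground field. -/
noncomputable def vecRep (w : Fˣ) : t.Uqg →ₐ[KK] Matrix t.Lab t.Lab F :=
  Uq.lift (t.vecGen (w : F)) (t.vecGen_rel w)

@[simp]
theorem vecRep_gen (w : Fˣ) (s : Gen t.I) :
    t.vecRep w (Uq.gen t.cartanMat t.Q s) = t.vecGen (w : F) s := Uq.lift_gen _ _ _

end verification

end AffineType

/-! ### R-matrices -/

section matrices

variable {m F : Type*} [Field F]

/-- The partial transpose `(E_ij ⊗ E_kl)^(t_1) = E_ji ⊗ E_kl`. -/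
def partialTranspose₁ (M : Matrix (m × m) (m × m) F) : Matrix (m × m) (m × m) F :=
  Matrix.of fun a b => M (b.1, a.2) (a.1, b.2)

end matrices

namespace AffineType

variable (t : AffineType)

section Rmatrix

variable (F : Type*) [Field F] [Algebra KK F]

/-- The flip `P = ∑ E_ij ⊗ E_ji`. -/
noncomputable def Pmat : Matrix (t.Lab × t.Lab) (t.Lab × t.Lab) F :=
  ∑ i : t.Lab, ∑ j : t.Lab, t.E F i j ⊗ₖ t.E F j i

/-- The numbers `2 ν_i`, with `ν_i = i - sgn(i)/2` (type `B`), `ν_i = i` (type `C`) and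
`ν_i = i - sgn(i)` (type `D`). -/
def twoNu (i : ℤ) : ℤ :=
  match t.family with
  | .A => 0
  | .B => 2 * i - i.sign
  | .C => 2 * i
  | .D => 2 * i - 2 * i.sign

/-- The numbers `2 κ`: `N - 2` for `𝔰𝔬_N` and `N + 2` for `𝔰𝔭_N`; no value is needed in
type `A`. -/
def twoKappa : ℤ :=
  match t.family with
  | .A => 0
  | .B => 2 * t.n - 1
  | .C => 2 * t.n + 2
  | .D => 2 * t.n - 2

/-- The coefficient `ϑ_i ϑ_j q ^ (ν_i - ν_j)`. -/
noncomputable def coef (i j : ℤ) : F :=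
  ((t.theta i * t.theta j : ℤ) : F) * algebraMap KK F qh ^ (t.twoNu i - t.twoNu j)

/-- The matrix `Q_q`: zero in type `A`, and `∑ ϑ_i ϑ_j q^(ν_i - ν_j) E_ij ⊗ E_{-i,-j}`
otherwise. -/
noncomputable def Qmat : Matrix (t.Lab × t.Lab) (t.Lab × t.Lab) F :=
  match t.family with
  | .A => 0
  | _ => ∑ i : t.Lab, ∑ j : t.Lab, t.coef F i j • (t.E F i j ⊗ₖ t.E F (-i) (-j))

/-- The constant R-matrix `R_q`. -/
noncomputable def Rconst : Matrix (t.Lab × t.Lab) (t.Lab × t.Lab) F :=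
  match t.family with
  | .A => ∑ i : t.Lab, ∑ j : t.Lab,
      (algebraMap KK F q ^ (if i = j then 1 else 0 : ℤ) • (t.E F i i ⊗ₖ t.E F j j) +
        if (i : ℤ) < j then
          (algebraMap KK F q - (algebraMap KK F q)⁻¹) • (t.E F i j ⊗ₖ t.E F j i)
        else 0)
  | _ => ∑ i : t.Lab, ∑ j : t.Lab,
      (algebraMap KK F q ^ ((if i = j then 1 else 0) - (if (i : ℤ) = -j then 1 else 0) : ℤ) •
          (t.E F i i ⊗ₖ t.E F j j) +
        if (i : ℤ) < j then
          (algebraMap KK F q - (algebraMap KK F q)⁻¹) •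
            (t.E F i j ⊗ₖ t.E F j i - t.coef F i j • (t.E F i j ⊗ₖ t.E F (-i) (-j)))
        else 0)

variable {F}

/-- The R-matrix `R(z)` with spectral parameter `z`. -/
noncomputable def R (z : F) : Matrix (t.Lab × t.Lab) (t.Lab × t.Lab) F :=
  ((1 - z) / (algebraMap KK F q - (algebraMap KK F q)⁻¹ * z)) • t.Rconst F +
    ((algebraMap KK F q - (algebraMap KK F q)⁻¹) * z /
        (algebraMap KK F q - (algebraMap KK F q)⁻¹ * z)) •
      (t.Pmat F - ((1 - z) / (algebraMap KK F q ^ t.twoKappa - z)) • t.Qmat F)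

end Rmatrix

end AffineType

/-! ### Coideal subalgebras and irreducibility -/

section coideal

variable {k H : Type*} [Field k] [Ring H] [HopfAlgebra k H]

/-- `B` is a right coideal: `Δ(B) ⊆ B ⊗ H`. -/
def IsRightCoideal (B : Subalgebra k H) : Prop :=
  ∀ b ∈ B, Coalgebra.comul (R := k) b ∈
    LinearMap.range (LinearMap.rTensor H (Subalgebra.toSubmodule B).subtype)

variable {m n : Type*} [Fintype m] [DecidableEq m] [Fintype n] [DecidableEq n]

/-- The tensor product `ρ ⊗ σ` of two matrix representations, `h ↦ (ρ ⊗ σ)(Δ(h))`. -/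
noncomputable def tensorRep (ρ : H →ₐ[k] Matrix m m k) (σ : H →ₐ[k] Matrix n n k) :
    H →ₐ[k] Matrix (m × n) (m × n) k :=
  ((Matrix.kroneckerAlgEquiv m n k).toAlgHom.comp (Algebra.TensorProduct.map ρ σ)).comp
    (Bialgebra.comulAlgHom k H)

/-- The restriction of a matrix representation to a subalgebra, as a representation on
column vectors. -/
noncomputable def restrictRep (ρ : H →ₐ[k] Matrix m m k) (B : Subalgebra k H) :
    Representation k B (m → k) :=
  ((Matrix.toLinAlgEquiv' : Matrix m m k ≃ₐ[k] _).toAlgHom.comp (ρ.comp B.val)).toRingHom.toMonoidHom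

end coideal

/-! ### The twisted intertwining and reflection equations -/

/-- The field `KK(u, v)` of rational functions in two variables. -/
abbrev RatFunc₂ : Type := FractionRing (MvPolynomial (Fin 2) KK)

/-- The variables `u` (index `0`) and `v` (index `1`). -/
noncomputable def var₂ (i : Fin 2) : RatFunc₂ :=
  algebraMap (MvPolynomial (Fin 2) KK) RatFunc₂ (MvPolynomial.X i)

theorem aeval_var₂_injective (i : Fin 2) :
    Function.Injective (Polynomial.aeval (R := KK) (var₂ i)) := by
  rw [← transcendental_iff_injective, var₂,
    transcendental_algebraMap_iff (IsFractionRing.injective (MvPolynomial (Fin 2) KK) RatFunc₂)]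
  exact MvPolynomial.transcendental_X KK i

/-- Substitution of the variable `u` or `v` in a rational function of one variable. -/
noncomputable def subst₂ (i : Fin 2) : RatFunc KK →ₐ[KK] RatFunc₂ :=
  RatFunc.liftAlgHom (Polynomial.aeval (R := KK) (var₂ i))
    (nonZeroDivisors_le_comap_nonZeroDivisors_of_injective _ (aeval_var₂_injective i))

/-- The variable `u` as a unit of `KK(u)`. -/
noncomputable def uVar : (RatFunc KK)ˣ := Units.mk0 RatFunc.X RatFunc.X_ne_zero

/-- A nonzero scalar as a unit of `KK(u)`. -/
noncomputable def scal (η : KKˣ) : (RatFunc KK)ˣ :=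
  Units.map (algebraMap KK (RatFunc KK)).toMonoidHom η

namespace AffineType

variable (t : AffineType)

/-- The twisted boundary intertwining equation
`K(u) T_{ηu}(b) = T_{η/u}(S(b))^t K(u)` for all `b ∈ B`, over `KK(u)`. -/
def TwistedIntertwining (B : Subalgebra KK t.Uqg) (K : Matrix t.Lab t.Lab (RatFunc KK))
    (η : KKˣ) : Prop :=
  ∀ b ∈ B, K * t.vecRep (scal η * uVar) b =
    (t.vecRep (scal η / uVar) (HopfAlgebra.antipode KK b)).transpose * K

/-- `(T_u ⊗ T_v)|_B` is irreducible for generic `u, v ∈ KKˣ`, that is, for all `(u, v)` at which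
some fixed nonzero polynomial does not vanish. -/
def GenericallyIrreducible (B : Subalgebra KK t.Uqg) : Prop :=
  ∃ p : MvPolynomial (Fin 2) KK, p ≠ 0 ∧
    ∀ u v : KKˣ, MvPolynomial.eval ![(u : KK), (v : KK)] p ≠ 0 →
      (restrictRep (tensorRep (t.vecRep u) (t.vecRep v)) B).IsIrreducible

/-- The twisted reflection equation
`R(u/v) K_1(u) R(1/(uv))^(t_1) K_2(v) = K_2(v) R(1/(uv))^(t_1) K_1(u) R(u/v)`, over `KK(u, v)`. -/
def TwistedReflection (K : Matrix t.Lab t.Lab (RatFunc KK)) : Prop :=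
  let u := var₂ 0
  let v := var₂ 1
  let K₁ := K.map (subst₂ 0) ⊗ₖ (1 : Matrix t.Lab t.Lab RatFunc₂)
  let K₂ := (1 : Matrix t.Lab t.Lab RatFunc₂) ⊗ₖ K.map (subst₂ 1)
  let R₁ := partialTranspose₁ (t.R (1 / (u * v)))
  t.R (u / v) * K₁ * R₁ * K₂ = K₂ * R₁ * K₁ * t.R (u / v)

end AffineType

end QRefl

open QRefl

namespace QRefl

/-! ### Kronecker products, the flip and the partial transpose, entrywise -/

section entries

variable {ι k : Type*} [Fintype ι] [DecidableEq ι] [Field k]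

/-! Both sides of the equation are intertwiners between the same two representations of `B`, so
Schur's lemma makes them proportional; determinants and the specialisation `u = v` then identify the
factor as 1.

Write Δ' for the opposite coproduct and T* for the dual `a ↦ T(S(a))ᵗ`. The matrix R(x/y)
intertwines (T_x ⊗ T_y)Δ' with (T_x ⊗ T_y)Δ (`Rnum_intertwines`). Dualising the first factor or both
factors gives similar relations for the partial transpose and for R itself
(`partialTranspose_intertwines`, `dual_Rnum_intertwines`). By hypothesis K(u) carries T_{ηu} to
T*_{η/u} over `B`; since `B` is a right coideal, K may be applied in the first factor of a tensor
product formed with Δ, and in the second factor of one formed with Δ'. The two ways of composing R,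
K(u), the partial transpose and K(v) both lead from (T_{ηu} ⊗ T_{ηv})Δ' to (T*_{η/u} ⊗ T*_{η/v})Δ'
(`reflL_intertwines`, `reflR_intertwines`). The source is conjugate by the flip to (T_{ηv} ⊗
T_{ηu})Δ, which is irreducible over `B` for generic parameters. Hence the left side is a scalar
multiple of the right side, and the right side is invertible, at generic points
(`refl_proportional`).

The scalar is found without computation. The two sides are products of the same four matrices, so
their determinants agree and a power of the scalar is 1. With denominators cleared the entries are
polynomials, so corresponding entries differ by a constant root of unity (`eq_of_pow_eq`). At `u =
v` the matrix R is a multiple of the flip, the two sides coincide there and are nonzero for a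
suitable `u` (`refl_self`, `reflR_self_ne_zero`), so the root of unity is 1
(`matrix_eq_of_proportional`).

The longest part is the intertwining property of R, checked on generators. In R_q the diagonal part
fails to intertwine x_i by a few terms with the factor `q - q⁻¹`; these are the boundary terms left
by the sums truncated to `i < j`. For i ≥ 1 this suffices, since Q_q annihilates the relation. For i
= 0 the spectral parameter enters, and comparing coefficients leaves two constant identities between
R_q, P and Q_q. The y_i follow from the x_i because T_w(y_i) is a multiple of T(k_i)⁻¹ T_{1/w}(x_i)ᵗ
and transposing R amounts to conjugating it by the flip; the k_i express conservation of weight. -/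

theorem mul_one_kron_apply (M : Matrix (ι × ι) (ι × ι) k) (X : Matrix ι ι k) (a b c d : ι) :
    (M * ((1 : Matrix ι ι k) ⊗ₖ X)) (a, b) (c, d) = ∑ m, M (a, b) (c, m) * X m d := by
  simp [Matrix.mul_apply, Fintype.sum_prod_type, Matrix.one_apply, Finset.sum_comm (γ := ι)]

theorem mul_kron_diagonal_apply (M : Matrix (ι × ι) (ι × ι) k) (X : Matrix ι ι k) (w : ι → k)
    (a b c d : ι) :
    (M * (X ⊗ₖ Matrix.diagonal w)) (a, b) (c, d) = (∑ m, M (a, b) (m, d) * X m c) * w d := by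
  simp [Matrix.mul_apply, Fintype.sum_prod_type, Matrix.diagonal_apply, Finset.sum_mul, mul_assoc]

theorem kron_one_mul_apply (M : Matrix (ι × ι) (ι × ι) k) (X : Matrix ι ι k) (a b c d : ι) :
    ((X ⊗ₖ (1 : Matrix ι ι k)) * M) (a, b) (c, d) = ∑ m, X a m * M (m, b) (c, d) := by
  simp [Matrix.mul_apply, Fintype.sum_prod_type, Matrix.one_apply]

theorem diagonal_kron_mul_apply (M : Matrix (ι × ι) (ι × ι) k) (X : Matrix ι ι k) (w : ι → k)
    (a b c d : ι) :
    ((Matrix.diagonal w ⊗ₖ X) * M) (a, b) (c, d) = w a * ∑ m, X b m * M (a, m) (c, d) := by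
  simp [Matrix.mul_apply, Fintype.sum_prod_type, Matrix.diagonal_apply, Finset.mul_sum, mul_assoc,
    Finset.sum_comm (γ := ι)]

variable (ι k) in
/-- The flip `∑ E_ij ⊗ E_ji`. -/
def flipMat : Matrix (ι × ι) (ι × ι) k :=
  Matrix.of fun p r => if p.1 = r.2 ∧ p.2 = r.1 then 1 else 0

theorem flipMat_mul_apply (M : Matrix (ι × ι) (ι × ι) k) (a b : ι) (r : ι × ι) :
    (flipMat ι k * M) (a, b) r = M (b, a) r := by
  rw [Matrix.mul_apply, Finset.sum_eq_single (b, a)]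
  · simp [flipMat]
  · rintro ⟨x, y⟩ _ h
    simp only [flipMat, Matrix.of_apply]
    rw [if_neg, zero_mul]
    rintro ⟨h1, h2⟩
    exact h (by simp_all)
  · simp

theorem mul_flipMat_apply (M : Matrix (ι × ι) (ι × ι) k) (r : ι × ι) (c d : ι) :
    (M * flipMat ι k) r (c, d) = M r (d, c) := by
  rw [Matrix.mul_apply, Finset.sum_eq_single (d, c)]
  · simp [flipMat]
  · rintro ⟨x, y⟩ _ h
    simp only [flipMat, Matrix.of_apply]
    rw [if_neg, mul_zero]
    rintro ⟨h1, h2⟩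
    exact h (by simp_all)
  · simp

theorem flipMat_mul_flipMat : flipMat ι k * flipMat ι k = 1 := by
  ext ⟨a, b⟩ ⟨c, d⟩
  rw [flipMat_mul_apply]
  simp [flipMat, Matrix.one_apply, and_comm]

theorem flipMat_mul_kron (X Y : Matrix ι ι k) :
    flipMat ι k * (X ⊗ₖ Y) = (Y ⊗ₖ X) * flipMat ι k := by
  ext ⟨a, b⟩ ⟨c, d⟩
  rw [flipMat_mul_apply, mul_flipMat_apply]
  simp [mul_comm]

end entries

/-! ### Quantum root vectors for `R_q` -/

section RootVectors

variable {ι k : Type*} [Fintype ι] [DecidableEq ι] [Field k]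

/-- The diagonal part `∑ q^(δ_ij) E_ii ⊗ E_jj` of `R_q` in type `A`. -/
def diagA (ι : Type*) [DecidableEq ι] (q : k) : Matrix (ι × ι) (ι × ι) k :=
  Matrix.diagonal fun p => if p.1 = p.2 then q else 1

/-- The upper triangular part of the flip with respect to a relation `lt`. -/
def upperFlip (k : Type*) [Field k] (lt : ι → ι → Prop) [DecidableRel lt] :
    Matrix (ι × ι) (ι × ι) k :=
  Matrix.of fun p r => if p.1 = r.2 ∧ p.2 = r.1 ∧ lt p.1 r.1 then 1 else 0

section products

variable (X : Matrix ι ι k) (w f : ι → k) (lt : ι → ι → Prop) [DecidableRel lt] (a b c d : ι)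
  (g : ι × ι → k)

theorem diag_mul_one_kron :
    (Matrix.diagonal g * ((1 : Matrix ι ι k) ⊗ₖ X)) (a, b) (c, d) =
      if a = c then g (a, b) * X b d else 0 := by
  simp [Matrix.diagonal_mul, Matrix.one_apply]

theorem diag_mul_kron_diagonal :
    (Matrix.diagonal g * (X ⊗ₖ Matrix.diagonal w)) (a, b) (c, d) =
      if b = d then g (a, b) * X a c * w b else 0 := by
  simp [Matrix.diagonal_mul, Matrix.diagonal_apply, mul_assoc]

theorem kron_one_mul_diag :
    ((X ⊗ₖ (1 : Matrix ι ι k)) * Matrix.diagonal g) (a, b) (c, d) =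
      if b = d then X a c * g (c, d) else 0 := by
  simp [Matrix.mul_diagonal, Matrix.one_apply]

theorem diagonal_kron_mul_diag :
    ((Matrix.diagonal w ⊗ₖ X) * Matrix.diagonal g) (a, b) (c, d) =
      if a = c then w a * X b d * g (c, d) else 0 := by
  simp [Matrix.mul_diagonal, Matrix.diagonal_apply]

theorem upperFlip_mul_one_kron :
    (upperFlip k lt * ((1 : Matrix ι ι k) ⊗ₖ X)) (a, b) (c, d) =
      if b = c ∧ lt a c then X a d else 0 := by
  rw [mul_one_kron_apply]
  simp only [upperFlip, Matrix.of_apply, ite_mul, one_mul, zero_mul]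
  simp only [ite_and, Finset.sum_ite_eq, Finset.mem_univ, if_true]

theorem upperFlip_mul_kron_diagonal :
    (upperFlip k lt * (X ⊗ₖ Matrix.diagonal w)) (a, b) (c, d) =
      if a = d ∧ lt a b then X b c * w a else 0 := by
  rw [mul_kron_diagonal_apply]
  simp only [upperFlip, Matrix.of_apply, ite_mul, one_mul, zero_mul]
  by_cases h : a = d
  · subst h
    simp only [true_and, ite_and, Finset.sum_ite_eq, Finset.mem_univ, if_true]
    split_ifs <;> simp
  · simp [h]

theorem kron_one_mul_upperFlip :
    ((X ⊗ₖ (1 : Matrix ι ι k)) * upperFlip k lt) (a, b) (c, d) =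
      if b = c ∧ lt d c then X a d else 0 := by
  rw [kron_one_mul_apply]
  simp only [upperFlip, Matrix.of_apply, mul_ite, mul_one, mul_zero]
  simp only [ite_and, Finset.sum_ite_eq', Finset.mem_univ, if_true]

theorem diagonal_kron_mul_upperFlip :
    ((Matrix.diagonal w ⊗ₖ X) * upperFlip k lt) (a, b) (c, d) =
      if a = d ∧ lt a c then w a * X b c else 0 := by
  rw [diagonal_kron_mul_apply]
  simp only [upperFlip, Matrix.of_apply, mul_ite, mul_one, mul_zero]
  by_cases h : a = d
  · subst h
    simp only [true_and, ite_and, Finset.sum_ite_eq', Finset.mem_univ, if_true]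
    split_ifs <;> simp
  · simp [h]

theorem flipMat_mul_kron_apply (X Y : Matrix ι ι k) :
    (flipMat ι k * (X ⊗ₖ Y)) (a, b) (c, d) = X b c * Y a d := by
  rw [flipMat_mul_apply]; rfl

theorem kron_mul_flipMat_apply (X Y : Matrix ι ι k) :
    ((X ⊗ₖ Y) * flipMat ι k) (a, b) (c, d) = X a d * Y b c := by
  rw [mul_flipMat_apply]; rfl

end products

/-- A relation `lt` is adjacent along the support of `X`: row index and column index of a nonzero
entry are neighbours. -/
structure AdjSupport (lt : ι → ι → Prop) (X : Matrix ι ι k) : Prop where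
  right : ∀ a c, X a c ≠ 0 → ∀ b, (lt a b ↔ b = c ∨ lt c b) ∧ ¬ lt c c
  left : ∀ a c, X a c ≠ 0 → ∀ b, (lt b c ↔ b = a ∨ lt b a) ∧ ¬ lt a a

/-- The two products carry the same entry `X a d`, truncated by `lt a b` and by `lt d b`. Since `d`
is the immediate successor of `a`, the truncations disagree only at `b = d`. The surviving term is a
residue that the diagonal part of R_q has to cancel. -/
theorem upperFlip_comm_right {lt : ι → ι → Prop} [DecidableRel lt] {X : Matrix ι ι k}
    (h : AdjSupport lt X) (a b c d : ι) :
    (upperFlip k lt * ((1 : Matrix ι ι k) ⊗ₖ X)) (a, b) (c, d) -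
      ((X ⊗ₖ (1 : Matrix ι ι k)) * upperFlip k lt) (a, b) (c, d) =
      if b = d ∧ b = c then X a c else 0 := by
  rw [upperFlip_mul_one_kron, kron_one_mul_upperFlip]
  by_cases hX : X a d = 0
  · by_cases h1 : b = d ∧ b = c
    · obtain ⟨rfl, rfl⟩ := h1; simp [hX]
    · simp [hX, h1]
  · by_cases hb : b = c
    · subst hb
      obtain ⟨h1, h2⟩ := h.right a d hX b
      by_cases hbd : b = d
      · subst hbd; simp [h1, h2]
      · simp [h1, hbd]
    · simp [hb]

/-- Mirror image of `upperFlip_comm_right`: the truncations `lt a b` and `lt a c` of the entry `X b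
c` disagree only at `a = b`, now with the opposite sign. -/
theorem upperFlip_comm_left {lt : ι → ι → Prop} [DecidableRel lt] {X : Matrix ι ι k}
    (h : AdjSupport lt X) (w : ι → k) (a b c d : ι) :
    (upperFlip k lt * (X ⊗ₖ Matrix.diagonal w)) (a, b) (c, d) -
      ((Matrix.diagonal w ⊗ₖ X) * upperFlip k lt) (a, b) (c, d) =
      - if b = d ∧ b = a then w a * X a c else 0 := by
  rw [upperFlip_mul_kron_diagonal, diagonal_kron_mul_upperFlip]
  by_cases hX : X b c = 0
  · by_cases h1 : b = d ∧ b = a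
    · obtain ⟨rfl, rfl⟩ := h1; simp [hX]
    · simp [hX, h1]
  · by_cases hb : a = d
    · subst hb
      obtain ⟨h1, h2⟩ := h.left b c hX a
      by_cases hbd : b = a
      · subst hbd; simp [h1, h2]
      · simp [h1, hbd, Ne.symm hbd, mul_comm]
    · have : ¬ (b = d ∧ b = a) := fun h' => hb (h'.2.symm.trans h'.1)
      simp [hb, this]

section typeA

variable {q : k} {lt : ι → ι → Prop} [DecidableRel lt] {X : Matrix ι ι k} {w : ι → k}

/-- The diagonal weights of a vector in type `A`. -/
def WeightA (q : k) (w : ι → k) (X : Matrix ι ι k) : Prop :=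
  ∀ a c, X a c ≠ 0 → a ≠ c ∧ ∀ b, w b = (if a = b then q else 1) * (if c = b then q⁻¹ else 1)

variable (q lt) in
/-- The constant R-matrix of type `A`. -/
def RqA : Matrix (ι × ι) (ι × ι) k := diagA ι q + (q - q⁻¹) • upperFlip k lt

/-- Replacing the row label `b` by the column label `d` changes the diagonal entry by a power of
`q`, and `w a` is exactly that ratio. -/
theorem diagA_weight (hq : q ≠ 0) (hw : WeightA q w X) (a b c d : ι) :
    (diagA ι q * ((1 : Matrix ι ι k) ⊗ₖ X)) (a, b) (c, d) =
      ((Matrix.diagonal w ⊗ₖ X) * diagA ι q) (a, b) (c, d) := by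
  rw [diagA, diag_mul_one_kron, diagonal_kron_mul_diag]
  by_cases hac : a = c
  · subst hac
    by_cases hX : X b d = 0
    · simp [hX]
    · simp only [if_true, (hw b d hX).2 a, eq_comm (a := a)]
      split_ifs <;> field_simp
  · simp [hac]

/-- With the Cartan factor on the other leg the two products still agree away from the labels of
`X`; at `b = a` and `b = c` the mismatch of powers of `q` is a multiple of `q - q⁻¹`. -/
theorem diagA_residue (hq : q ≠ 0) (hw : WeightA q w X) (a b c d : ι) :
    (diagA ι q * (X ⊗ₖ Matrix.diagonal w)) (a, b) (c, d) -
      ((X ⊗ₖ (1 : Matrix ι ι k)) * diagA ι q) (a, b) (c, d) =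
    (q - q⁻¹) * ((if b = d ∧ b = a then w a * X a c else 0) -
      (if b = d ∧ b = c then X a c else 0)) := by
  rw [diagA, diag_mul_kron_diagonal, kron_one_mul_diag]
  by_cases hbd : b = d
  · subst hbd
    by_cases hX : X a c = 0
    · simp [hX]
    · obtain ⟨hac, hw⟩ := hw a c hX
      simp only [if_true, true_and, hw, eq_comm (b := b)]
      by_cases h1 : b = a
      · subst h1
        simp [hac, hac.symm]
        field_simp
      · by_cases h2 : b = c
        · subst h2
          simp [hac, hac.symm]
          field_simp
          ring
        · simp [h1, h2]
  · simp [hbd]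

/-- Cancellation of residues: the defect of the diagonal part is `q - q⁻¹` times the two boundary
terms left by the truncated flip, with the opposite sign. -/
theorem RqA_finite (hq : q ≠ 0) (hw : WeightA q w X) (h : AdjSupport lt X) :
    RqA q lt * ((1 : Matrix ι ι k) ⊗ₖ X + X ⊗ₖ Matrix.diagonal w) =
      (X ⊗ₖ 1 + Matrix.diagonal w ⊗ₖ X) * RqA q lt := by
  ext ⟨a, b⟩ ⟨c, d⟩
  have h1 := diagA_weight hq hw a b c d
  have h2 := diagA_residue hq hw a b c d
  have h3 := upperFlip_comm_right h a b c d
  have h4 := upperFlip_comm_left h w a b c d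
  simp only [RqA, add_mul, mul_add, smul_mul_assoc, mul_smul_comm, Matrix.add_apply,
    Matrix.smul_apply, smul_eq_mul]
  linear_combination h1 + h2 + (q - q⁻¹) * (h3 + h4)

/-- No label lies above the row of `X` and none below its column, so the truncated flip contributes
to neither product. -/
theorem RqA_affine_one (hq : q ≠ 0) (hw : WeightA q w X)
    (h1 : ∀ a l, X a l ≠ 0 → ∀ c, ¬ lt a c) (h2 : ∀ b c, X b c ≠ 0 → ∀ a, ¬ lt a c) :
    RqA q lt * ((1 : Matrix ι ι k) ⊗ₖ X) = (Matrix.diagonal w ⊗ₖ X) * RqA q lt := by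
  ext ⟨a, b⟩ ⟨c, d⟩
  have h0 := diagA_weight hq hw a b c d
  have h3 : (upperFlip k lt * ((1 : Matrix ι ι k) ⊗ₖ X)) (a, b) (c, d) = 0 := by
    rw [upperFlip_mul_one_kron]
    by_cases hX : X a d = 0
    · simp [hX]
    · simp [h1 a d hX c]
  have h4 : ((Matrix.diagonal w ⊗ₖ X) * upperFlip k lt) (a, b) (c, d) = 0 := by
    rw [diagonal_kron_mul_upperFlip]
    by_cases hX : X b c = 0
    · simp [hX]
    · simp [h2 b c hX a]
  simp only [RqA, add_mul, mul_add, smul_mul_assoc, mul_smul_comm, Matrix.add_apply,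
    Matrix.smul_apply, smul_eq_mul]
  linear_combination h0 + (q - q⁻¹) * (h3 - h4)

/-- On these extreme labels the truncated flip differs from the full flip only by diagonal terms,
and those terms are the residues of `diagA`. -/
theorem RqA_affine_two (hq : q ≠ 0) (hw : WeightA q w X)
    (h1 : ∀ a l, X a l ≠ 0 → ∀ c, lt c a ↔ c ≠ a) (h2 : ∀ b c, X b c ≠ 0 → ∀ a, lt c a ↔ a ≠ c) :
    RqA q lt * (X ⊗ₖ Matrix.diagonal w) - (X ⊗ₖ (1 : Matrix ι ι k)) * RqA q lt =
      (q - q⁻¹) • (flipMat ι k * (X ⊗ₖ Matrix.diagonal w) - (X ⊗ₖ (1 : Matrix ι ι k)) * flipMat ι k) := by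
  ext ⟨a, b⟩ ⟨c, d⟩
  have h0 := diagA_residue hq hw a b c d
  have h3 : (upperFlip k lt * (X ⊗ₖ Matrix.diagonal w)) (a, b) (c, d) =
      (flipMat ι k * (X ⊗ₖ Matrix.diagonal w)) (a, b) (c, d) -
        if b = d ∧ b = a then w a * X a c else 0 := by
    rw [upperFlip_mul_kron_diagonal, flipMat_mul_kron_apply]
    by_cases hX : X b c = 0
    · by_cases h' : b = d ∧ b = a
      · obtain ⟨rfl, rfl⟩ := h'; simp [hX]
      · simp [hX, h']
    · by_cases had : a = d
      · subst had
        by_cases hab : a = b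
        · subst hab; simp [h1 a c hX a]; ring
        · simp [h1 b c hX a, hab, Ne.symm hab]
      · have : ¬ (b = d ∧ b = a) := fun h' => had (h'.2.symm.trans h'.1)
        simp [had, this]
  have h4 : ((X ⊗ₖ (1 : Matrix ι ι k)) * upperFlip k lt) (a, b) (c, d) =
      ((X ⊗ₖ (1 : Matrix ι ι k)) * flipMat ι k) (a, b) (c, d) - if b = d ∧ b = c then X a c else 0 := by
    rw [kron_one_mul_upperFlip, kron_mul_flipMat_apply]
    by_cases hX : X a d = 0
    · by_cases h' : b = d ∧ b = c
      · obtain ⟨rfl, rfl⟩ := h'; simp [hX]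
      · simp [hX, h']
    · by_cases had : b = c
      · subst had
        by_cases hab : b = d
        · subst hab; simp [h2 a b hX b]
        · simp [h2 a d hX b, hab, Ne.symm hab]
      · simp [had, Matrix.one_apply]
  simp only [RqA, add_mul, mul_add, smul_mul_assoc, mul_smul_comm, Matrix.add_apply,
    Matrix.smul_apply, smul_eq_mul, Matrix.sub_apply]
  linear_combination h0 + (q - q⁻¹) * (h3 - h4)

end typeA

end RootVectors

/-! ### The constant R-matrix in the presence of an invariant form -/

section skew

variable {ι k : Type*} [Fintype ι] [DecidableEq ι] [Field k]

/-- An involution of the labels and multiplicative coefficients `ϑ_i ϑ_j q^(ν_i - ν_j)`. -/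
structure SkewForm (ι k : Type*) [Field k] where
  neg : ι → ι
  neg_neg : ∀ a, neg (neg a) = a
  coef : ι → ι → k
  coef_self : ∀ a, coef a a = 1
  coef_mul : ∀ a b c, coef a b * coef b c = coef a c

namespace SkewForm

variable (F : SkewForm ι k)

/-- The part of `∑ ϑ_i ϑ_j q^(ν_i - ν_j) E_ij ⊗ E_{-i,-j}` with `lt i j`. -/
def upperQ (lt : ι → ι → Prop) [DecidableRel lt] : Matrix (ι × ι) (ι × ι) k :=
  Matrix.of fun p r =>
    if p.2 = F.neg p.1 ∧ r.2 = F.neg r.1 ∧ lt p.1 r.1 then F.coef p.1 r.1 else 0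

/-- The matrix `Q_q`. -/
def Q : Matrix (ι × ι) (ι × ι) k := F.upperQ fun _ _ => True

/-- The diagonal part of `R_q`. -/
def diag (q : k) : Matrix (ι × ι) (ι × ι) k :=
  Matrix.diagonal fun p =>
    (if p.1 = p.2 then q else 1) * (if p.1 = F.neg p.2 then q⁻¹ else 1)

/-- The constant R-matrix `R_q` of the types `B`, `C`, `D`. -/
def Rq (q : k) (lt : ι → ι → Prop) [DecidableRel lt] : Matrix (ι × ι) (ι × ι) k :=
  F.diag q + (q - q⁻¹) • (upperFlip k lt - F.upperQ lt)

section products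

variable (X : Matrix ι ι k) (w : ι → k) (lt : ι → ι → Prop) [DecidableRel lt] (a b c d : ι)

theorem eq_neg_comm {a b : ι} : a = F.neg b ↔ b = F.neg a :=
  ⟨fun h => by rw [h, F.neg_neg], fun h => by rw [h, F.neg_neg]⟩

theorem upperQ_mul_one_kron :
    (F.upperQ lt * ((1 : Matrix ι ι k) ⊗ₖ X)) (a, b) (c, d) =
      if b = F.neg a ∧ lt a c then F.coef a c * X (F.neg c) d else 0 := by
  rw [mul_one_kron_apply]
  simp only [upperQ, Matrix.of_apply, ite_mul, zero_mul]
  by_cases h : b = F.neg a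
  · simp only [h, true_and, ite_and, Finset.sum_ite_eq', Finset.mem_univ, if_true]
  · simp [h]

theorem upperQ_mul_kron_diagonal :
    (F.upperQ lt * (X ⊗ₖ Matrix.diagonal w)) (a, b) (c, d) =
      if b = F.neg a ∧ lt a (F.neg d) then F.coef a (F.neg d) * X (F.neg d) c * w d else 0 := by
  rw [mul_kron_diagonal_apply]
  simp only [upperQ, Matrix.of_apply, ite_mul, zero_mul, F.eq_neg_comm (a := d)]
  by_cases h : b = F.neg a
  · simp only [h, true_and, ite_and, Finset.sum_ite_eq', Finset.mem_univ, if_true]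
    split_ifs <;> simp
  · simp [h]

theorem kron_one_mul_upperQ :
    ((X ⊗ₖ (1 : Matrix ι ι k)) * F.upperQ lt) (a, b) (c, d) =
      if d = F.neg c ∧ lt (F.neg b) c then X a (F.neg b) * F.coef (F.neg b) c else 0 := by
  rw [kron_one_mul_apply]
  simp only [upperQ, Matrix.of_apply, mul_ite, mul_zero, F.eq_neg_comm (a := b)]
  by_cases h : d = F.neg c
  · simp only [h, true_and, ite_and, Finset.sum_ite_eq', Finset.mem_univ, if_true]
  · simp [h]

theorem diagonal_kron_mul_upperQ :
    ((Matrix.diagonal w ⊗ₖ X) * F.upperQ lt) (a, b) (c, d) =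
      if d = F.neg c ∧ lt a c then w a * X b (F.neg a) * F.coef a c else 0 := by
  rw [diagonal_kron_mul_apply]
  simp only [upperQ, Matrix.of_apply, mul_ite, mul_zero]
  by_cases h : d = F.neg c
  · simp only [h, true_and, ite_and, Finset.sum_ite_eq', Finset.mem_univ, if_true]
    split_ifs <;> simp [mul_assoc]
  · simp [h]

end products

/-- A weight vector `X` of the vector representation that satisfies the crossing relation
with parameter `e`; `w` are the diagonal entries of the matrix of the Cartan element. -/
structure RootVector (q e : k) (w : ι → k) (X : Matrix ι ι k) : Prop where
  ne : ∀ a c, X a c ≠ 0 → a ≠ c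
  weight : ∀ a c, X a c ≠ 0 → ∀ b, w b = (if a = b then q else 1) *
    (if a = F.neg b then q⁻¹ else 1) * (if c = b then q⁻¹ else 1) * (if c = F.neg b then q else 1)
  neg : ∀ b, w b * w (F.neg b) = 1
  cross : ∀ a d, w a * X (F.neg d) (F.neg a) = -(e * F.coef d a * X a d)

variable {F} {q e : k} {w : ι → k} {X : Matrix ι ι k} {lt : ι → ι → Prop} [DecidableRel lt]

theorem RootVector.cross_left (h : F.RootVector q e w X) (a c d : ι) :
    F.coef a c * X (F.neg c) d = -(e * (F.coef a (F.neg d) * X (F.neg d) c * w d)) := by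
  have h1 := h.cross (F.neg d) c
  rw [F.neg_neg] at h1
  rw [← F.coef_mul a c (F.neg d)]
  linear_combination (w d * F.coef a c) * h1 - F.coef a c * X (F.neg c) d * h.neg d

theorem RootVector.cross_right (h : F.RootVector q e w X) (a b c : ι) :
    w a * X b (F.neg a) * F.coef a c = -(e * (X a (F.neg b) * F.coef (F.neg b) c)) := by
  have h1 := h.cross a (F.neg b)
  rw [F.neg_neg] at h1
  rw [← F.coef_mul (F.neg b) a c]
  linear_combination F.coef a c * h1

/-- `F.Q` has rank one and lives on pairs of opposite labels, so `X` on one leg can be traded for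
`X` on the other leg accompanied by the Cartan factor; the crossing relation says that the price is
`-e`. Later `e` is 1 at the nodes i ≥ 1 and `t.eKap` at the node 0. -/
theorem Q_cross_left (h : F.RootVector q e w X) :
    F.Q * ((1 : Matrix ι ι k) ⊗ₖ X) = -(e • (F.Q * (X ⊗ₖ Matrix.diagonal w))) := by
  ext ⟨a, b⟩ ⟨c, d⟩
  rw [Matrix.neg_apply, Matrix.smul_apply, Q, upperQ_mul_one_kron, upperQ_mul_kron_diagonal,
    h.cross_left]
  split_ifs <;> simp

theorem Q_cross_right (h : F.RootVector q e w X) :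
    (Matrix.diagonal w ⊗ₖ X) * F.Q = -(e • ((X ⊗ₖ (1 : Matrix ι ι k)) * F.Q)) := by
  ext ⟨a, b⟩ ⟨c, d⟩
  rw [Matrix.neg_apply, Matrix.smul_apply, Q, diagonal_kron_mul_upperQ, kron_one_mul_upperQ,
    h.cross_right]
  split_ifs <;> simp

theorem diag_weight (hq : q ≠ 0) (h : F.RootVector q e w X) (a b c d : ι) :
    (F.diag q * ((1 : Matrix ι ι k) ⊗ₖ X)) (a, b) (c, d) =
      ((Matrix.diagonal w ⊗ₖ X) * F.diag q) (a, b) (c, d) := by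
  rw [diag, diag_mul_one_kron, diagonal_kron_mul_diag]
  by_cases hac : a = c
  · subst hac
    by_cases hX : X b d = 0
    · simp [hX]
    · simp only [if_true, h.weight b d hX a]
      have e1 : (b = a) = (a = b) := propext eq_comm
      have e2 : (d = a) = (a = d) := propext eq_comm
      have e3 : (b = F.neg a) = (a = F.neg b) := propext F.eq_neg_comm
      have e4 : (d = F.neg a) = (a = F.neg d) := propext F.eq_neg_comm
      simp only [e1, e2, e3, e4]
      split_ifs <;> field_simp
  · simp [hac]

/-- Besides the residues at the two labels of `X`, known from type A, the factor for opposite labels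
creates residues at their negatives. The first kind is matched by the truncated flip, the second by
the truncated `F.Q`. -/
theorem diag_residue (hq : q ≠ 0) (h : F.RootVector q e w X) (a b c d : ι) :
    (F.diag q * (X ⊗ₖ Matrix.diagonal w)) (a, b) (c, d) -
      ((X ⊗ₖ (1 : Matrix ι ι k)) * F.diag q) (a, b) (c, d) =
    (q - q⁻¹) * ((if b = d ∧ b = a then w a * X a c else 0) -
      (if b = d ∧ b = c then X a c else 0) + (if b = d ∧ b = F.neg c then X a c else 0) -
      (if b = d ∧ b = F.neg a then w b * X a c else 0)) := by
  rw [diag, diag_mul_kron_diagonal, kron_one_mul_diag]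
  by_cases hbd : b = d
  · subst hbd
    by_cases hX : X a c = 0
    · simp [hX]
    · have hac := h.ne a c hX
      have hca := hac.symm
      simp only [if_true, true_and, h.weight a c hX]
      have e1 : (a = b) = (b = a) := propext eq_comm
      have e2 : (c = b) = (b = c) := propext eq_comm
      have e3 : (a = F.neg b) = (b = F.neg a) := propext F.eq_neg_comm
      have e4 : (c = F.neg b) = (b = F.neg c) := propext F.eq_neg_comm
      have e5 : (c = F.neg a) = (a = F.neg c) := propext F.eq_neg_comm
      have e6 : F.neg a = F.neg c → False := fun h' => hac (by
        rw [← F.neg_neg a, h', F.neg_neg])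
      simp only [e1, e2, e3, e4, e5]
      have e7 := F.neg_neg c
      simp only [hca, if_true, if_false]
      split_ifs <;> first | (field_simp; done) | (field_simp; ring1) | (exfalso; grind)
  · simp [hbd]

/-- By crossing with `e = 1` the two products have opposite entries, truncated by `lt a c` and `lt a
(F.neg d)`. Where the entry is nonzero, `F.neg d` is the immediate predecessor of `c`, so only `a =
F.neg d` survives. -/
theorem upperQ_comm_left (h : F.RootVector q 1 w X) (hlt : AdjSupport lt X) (a b c d : ι) :
    (F.upperQ lt * ((1 : Matrix ι ι k) ⊗ₖ X)) (a, b) (c, d) +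
      (F.upperQ lt * (X ⊗ₖ Matrix.diagonal w)) (a, b) (c, d) =
    - if b = d ∧ b = F.neg a then w b * X a c else 0 := by
  rw [upperQ_mul_one_kron, upperQ_mul_kron_diagonal, h.cross_left]
  by_cases hb : b = F.neg a
  · by_cases hX : X (F.neg d) c = 0
    · by_cases hbd : b = d
      · rw [← hbd, hb, F.neg_neg] at hX
        simp [hX, ← hbd, hb, F.neg_neg]
      · simp [hX, hbd]
    · obtain ⟨h1, h2⟩ := hlt.left _ _ hX a
      by_cases hbd : b = d
      · have had : a = F.neg d := by rw [← hbd, hb, F.neg_neg]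
        rw [← had] at h2
        have hd : d = F.neg a := by rw [← hbd, hb]
        subst hd
        have h3 : lt a c := (hlt.left _ _ hX a |>.1).2 (Or.inl had)
        simp [F.neg_neg, h2, h3, hb, F.coef_self, mul_comm]
      · have had : a ≠ F.neg d := fun h' => hbd (by rw [hb, h', F.neg_neg])
        simp only [hb, h1, had, false_or, true_and]
        rw [if_neg (c := _ ∧ _) (fun h' => hbd (by rw [hb, h'.1]))]
        split_ifs <;> ring
  · simp [hb]

theorem upperQ_comm_right (h : F.RootVector q 1 w X) (hlt : AdjSupport lt X) (a b c d : ι) :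
    ((Matrix.diagonal w ⊗ₖ X) * F.upperQ lt) (a, b) (c, d) +
      ((X ⊗ₖ (1 : Matrix ι ι k)) * F.upperQ lt) (a, b) (c, d) =
    - if b = d ∧ b = F.neg c then X a c else 0 := by
  rw [diagonal_kron_mul_upperQ, kron_one_mul_upperQ, h.cross_right]
  by_cases hd : d = F.neg c
  · by_cases hX : X a (F.neg b) = 0
    · by_cases hbd : b = d
      · subst hd hbd
        rw [F.neg_neg] at hX
        simp [F.neg_neg, hX]
      · simp [hX, hbd]
    · obtain ⟨h1, h2⟩ := hlt.right _ _ hX c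
      by_cases hbd : b = d
      · have had : F.neg b = c := by rw [hbd, hd, F.neg_neg]
        rw [had] at h1 h2 ⊢
        simp [h1, h2, hd, F.coef_self, hbd]
      · have had : c ≠ F.neg b := fun h' => hbd (by rw [hd, h', F.neg_neg])
        simp only [hd, h1, had, false_or, true_and]
        rw [if_neg (c := _ ∧ _) (fun h' => hbd (by rw [hd, h'.1]))]
        split_ifs <;> ring
  · have : ¬ (b = d ∧ b = F.neg c) := fun h' => hd (by rw [← h'.1, h'.2])
    simp [hd, this]

/-- The four residues of `diag_residue` are used up in pairs: two by the truncated flip and two by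
the truncated `F.Q`. -/
theorem Rq_finite (hq : q ≠ 0) (h : F.RootVector q 1 w X) (hlt : AdjSupport lt X) :
    F.Rq q lt * ((1 : Matrix ι ι k) ⊗ₖ X + X ⊗ₖ Matrix.diagonal w) =
      (X ⊗ₖ (1 : Matrix ι ι k) + Matrix.diagonal w ⊗ₖ X) * F.Rq q lt := by
  ext ⟨a, b⟩ ⟨c, d⟩
  have h1 := diag_weight hq h a b c d
  have h2 := diag_residue hq h a b c d
  have h3 := upperFlip_comm_right hlt a b c d
  have h4 := upperFlip_comm_left hlt w a b c d
  have h5 := upperQ_comm_left h hlt a b c d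
  have h6 := upperQ_comm_right h hlt a b c d
  simp only [Rq, add_mul, mul_add, smul_mul_assoc, mul_smul_comm, Matrix.add_apply,
    Matrix.smul_apply, smul_eq_mul, mul_sub, sub_mul, Matrix.sub_apply, smul_sub]
  linear_combination h1 + h2 + (q - q⁻¹) * (h3 + h4 - h5 + h6)

/-- Positions of the nonzero entries of the affine root vector. -/
structure AffineSupport (F : SkewForm ι k) (e : k) (lt : ι → ι → Prop) (X : Matrix ι ι k) :
    Prop where
  row : ∀ a l, X a l ≠ 0 → ∀ c, lt a c → c = F.neg l ∧ e * F.coef (F.neg c) c = 1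
  col : ∀ b c, X b c ≠ 0 → ∀ a, lt a c → a = F.neg b ∧ e * F.coef a (F.neg a) = 1

/-- Unlike in type A, one further label may lie above the row of `X`, so the truncated terms need
not vanish one by one. They cancel crosswise: the flip on either side against `F.Q` on the other, by
crossing and the normalisation `e * coef = 1` in `AffineSupport`. -/
theorem Rq_affine_one (hq : q ≠ 0) (h : F.RootVector q e w X) (hX : F.AffineSupport e lt X) :
    F.Rq q lt * ((1 : Matrix ι ι k) ⊗ₖ X) = (Matrix.diagonal w ⊗ₖ X) * F.Rq q lt := by
  ext ⟨a, b⟩ ⟨c, d⟩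
  have h0 := diag_weight hq h a b c d
  have h1 : (upperFlip k lt * ((1 : Matrix ι ι k) ⊗ₖ X)) (a, b) (c, d) +
      ((Matrix.diagonal w ⊗ₖ X) * F.upperQ lt) (a, b) (c, d) = 0 := by
    rw [upperFlip_mul_one_kron, diagonal_kron_mul_upperQ, h.cross_right]
    by_cases hac : lt a c
    · by_cases hbc : b = c
      · by_cases hdc : d = F.neg c
        · by_cases h0 : X a d = 0
          · simp [hbc, hac, ← hdc, h0]
          · have h2 := (hX.row a d h0 c hac).2
            simp only [hbc, hac, hdc, and_self, if_true]
            linear_combination (-X a (F.neg c)) * h2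
        · have h0 : X a d = 0 := by
            by_contra h0
            exact hdc (F.eq_neg_comm.1 (hX.row a d h0 c hac).1)
          simp [hdc, h0]
      · have h0 : X a (F.neg b) = 0 := by
          by_contra h0
          exact hbc (by rw [(hX.row a _ h0 c hac).1, F.neg_neg])
        simp [hbc, h0]
    · simp [hac]
  have h2 : ((Matrix.diagonal w ⊗ₖ X) * upperFlip k lt) (a, b) (c, d) +
      (F.upperQ lt * ((1 : Matrix ι ι k) ⊗ₖ X)) (a, b) (c, d) = 0 := by
    rw [diagonal_kron_mul_upperFlip, upperQ_mul_one_kron, h.cross_left]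
    by_cases hac : lt a c
    · by_cases hbc : a = d
      · by_cases hdc : b = F.neg a
        · by_cases h0 : X b c = 0
          · simp [hbc, hac, ← hdc, h0]
            rw [hdc, hbc] at h0
            simp [h0]
          · have h2 := (hX.col b c h0 a hac).2
            simp only [hbc, hac, hdc, and_self, if_true]
            rw [hbc] at h2 hac
            simp only [hac, and_self, if_true]
            linear_combination (-(w d * X (F.neg d) c)) * h2
        · have h0 : X b c = 0 := by
            by_contra h0
            exact hdc (F.eq_neg_comm.1 (hX.col b c h0 a hac).1)
          simp [hdc, h0]
      · have h0 : X (F.neg d) c = 0 := by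
          by_contra h0
          exact hbc (by rw [(hX.col _ c h0 a hac).1, F.neg_neg])
        simp [hbc, h0]
    · simp [hac]
  simp only [Rq, add_mul, mul_add, smul_mul_assoc, mul_smul_comm, Matrix.add_apply,
    Matrix.smul_apply, smul_eq_mul, mul_sub, sub_mul, Matrix.sub_apply, smul_sub]
  linear_combination h0 + (q - q⁻¹) * (h1 - h2)

/-- Bringing the right-hand side over replaces each truncated sum by its complement, that is, by a
diagonal part and a strictly lower part. The diagonal parts are the four residues of `diag_residue`;
the lower parts of the flip and of `F.Q` cancel crosswise. -/
theorem Rq_affine_two (hq : q ≠ 0) (he : e ≠ 0) (h : F.RootVector q e w X)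
    (hX : F.AffineSupport e lt X) (htri : ∀ a b, ¬ lt a b ↔ a = b ∨ lt b a)
    (hneg : ∀ a b, lt a b → lt (F.neg b) (F.neg a)) :
    F.Rq q lt * (X ⊗ₖ Matrix.diagonal w) - (X ⊗ₖ (1 : Matrix ι ι k)) * F.Rq q lt =
      (q - q⁻¹) • ((flipMat ι k - F.Q) * (X ⊗ₖ Matrix.diagonal w) -
        (X ⊗ₖ (1 : Matrix ι ι k)) * (flipMat ι k - F.Q)) := by
  ext ⟨a, b⟩ ⟨c, d⟩
  have h0 := diag_residue hq h a b c d
  have hirr : ∀ a, ¬ lt a a := fun a => (htri a a).2 (Or.inl rfl)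
  have hcoef : ∀ a, F.coef a (F.neg a) * F.coef (F.neg a) a = 1 := fun a => by
    rw [F.coef_mul, F.coef_self]
  have split : ∀ (a b : ι) (x : k), x - (if lt a b then x else 0) =
      (if a = b then x else 0) + (if lt b a then x else 0) := by
    intro a b x
    by_cases h1 : a = b
    · subst h1; simp [hirr]
    · have := htri a b
      by_cases h2 : lt b a
      · simp [h1, h2, this]
      · have h3 : lt a b := by by_contra h3; exact (this.1 h3).elim h1 h2
        simp [h1, h2, h3]
  have UL : (flipMat ι k * (X ⊗ₖ Matrix.diagonal w)) (a, b) (c, d) -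
      (upperFlip k lt * (X ⊗ₖ Matrix.diagonal w)) (a, b) (c, d) =
      (if b = d ∧ b = a then w a * X a c else 0) +
        (if a = d ∧ lt b a then w a * X b c else 0) := by
    rw [flipMat_mul_kron_apply, upperFlip_mul_kron_diagonal]
    by_cases had : a = d
    · subst had
      have := split a b (X b c * w a)
      simp only [true_and, and_self, Matrix.diagonal_apply_eq, mul_comm (w a)]
      rw [this]
      by_cases hab : b = a
      · subst hab; simp
      · simp only [hab, Ne.symm hab, if_false]
    · have : ¬ (b = d ∧ b = a) := fun h' => had (h'.2.symm.trans h'.1)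
      simp [had, this]
  have UR : ((X ⊗ₖ (1 : Matrix ι ι k)) * flipMat ι k) (a, b) (c, d) -
      ((X ⊗ₖ (1 : Matrix ι ι k)) * upperFlip k lt) (a, b) (c, d) =
      (if b = d ∧ b = c then X a c else 0) + (if b = c ∧ lt c d then X a d else 0) := by
    rw [kron_mul_flipMat_apply, kron_one_mul_upperFlip]
    by_cases hbc : b = c
    · subst hbc
      have := split d b (X a d)
      simp only [true_and, and_true, Matrix.one_apply_eq, mul_one]
      rw [this]
      by_cases hab : b = d
      · subst hab; simp
      · simp only [hab, Ne.symm hab, if_false]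
    · simp [hbc, Matrix.one_apply]
  have QL : (F.Q * (X ⊗ₖ Matrix.diagonal w)) (a, b) (c, d) -
      (F.upperQ lt * (X ⊗ₖ Matrix.diagonal w)) (a, b) (c, d) =
      (if b = d ∧ b = F.neg a then w b * X a c else 0) +
        (if b = F.neg a ∧ lt (F.neg d) a then F.coef a (F.neg d) * X (F.neg d) c * w d
          else 0) := by
    rw [Q, upperQ_mul_kron_diagonal, upperQ_mul_kron_diagonal]
    by_cases hb : b = F.neg a
    · have := split a (F.neg d) (F.coef a (F.neg d) * X (F.neg d) c * w d)
      simp only [hb, true_and, and_true, if_true]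
      rw [this]
      by_cases hbd : d = F.neg a
      · subst hbd
        simp [F.neg_neg, F.coef_self, mul_comm]
      · have had : a ≠ F.neg d := fun h' => hbd (F.eq_neg_comm.1 h')
        simp only [had, Ne.symm hbd, if_false]
    · simp [hb]
  have QR : ((X ⊗ₖ (1 : Matrix ι ι k)) * F.Q) (a, b) (c, d) -
      ((X ⊗ₖ (1 : Matrix ι ι k)) * F.upperQ lt) (a, b) (c, d) =
      (if b = d ∧ b = F.neg c then X a c else 0) +
        (if d = F.neg c ∧ lt c (F.neg b) then X a (F.neg b) * F.coef (F.neg b) c else 0) := by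
    rw [Q, kron_one_mul_upperQ, kron_one_mul_upperQ]
    by_cases hd : d = F.neg c
    · have := split (F.neg b) c (X a (F.neg b) * F.coef (F.neg b) c)
      simp only [hd, true_and, and_self, and_true, if_true]
      rw [this]
      by_cases hbd : b = F.neg c
      · subst hbd
        simp [F.neg_neg, F.coef_self]
      · have had : F.neg b ≠ c := fun h' => hbd (by rw [← h', F.neg_neg])
        simp only [had, hbd, if_false]
    · have : ¬ (b = d ∧ b = F.neg c) := fun h' => hd (by rw [← h'.1, h'.2])
      simp [hd, this]
  -- The lower flip of the first product and the lower `F.Q` of the second live on the same entries,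
  -- `a = d` and `c = F.neg a`, where crossing makes them opposite.
  have S1 : (if a = d ∧ lt b a then w a * X b c else 0) +
      (if d = F.neg c ∧ lt c (F.neg b) then X a (F.neg b) * F.coef (F.neg b) c else 0) = 0 := by
    by_cases hac : a = d ∧ c = F.neg a
    · obtain ⟨rfl, rfl⟩ := hac
      have hlt : lt (F.neg a) (F.neg b) ↔ lt b a :=
        ⟨fun h' => by simpa [F.neg_neg] using hneg _ _ h', hneg _ _⟩
      by_cases hba : lt b a
      · simp only [hlt, hba, F.neg_neg, and_self, if_true]
        have h1 := h.cross_right a b (F.neg a)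
        have hc := hcoef a
        -- For a vanishing entry the normalisation of `AffineSupport` is not available, but crossing
        -- with `e ≠ 0` forces the partner entry to vanish too.
        by_cases hX0 : X b (F.neg a) = 0
        · rw [hX0]
          rw [hX0] at h1
          have : X a (F.neg b) * F.coef (F.neg b) (F.neg a) = 0 := by
            have : e * (X a (F.neg b) * F.coef (F.neg b) (F.neg a)) = 0 := by
              linear_combination h1
            exact (mul_eq_zero.1 this).resolve_left he
          rw [this]; ring
        · have h2 := (hX.row b _ hX0 a hba).2
          linear_combination (F.coef (F.neg a) a) * h1 - w a * X b (F.neg a) * hc +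
            (X a (F.neg b) * F.coef (F.neg b) (F.neg a)) * (-h2)
      · simp [hlt, hba]
    · have h1 : (if a = d ∧ lt b a then w a * X b c else 0) = 0 := by
        by_cases hX0 : X b c = 0
        · simp [hX0]
        · rw [if_neg]
          rintro ⟨h1, h2⟩
          exact hac ⟨h1, F.eq_neg_comm.1 (hX.row b c hX0 a h2).1⟩
      have h2 : (if d = F.neg c ∧ lt c (F.neg b) then
          X a (F.neg b) * F.coef (F.neg b) c else 0) = 0 := by
        by_cases hX0 : X a (F.neg b) = 0
        · simp [hX0]
        · rw [if_neg]
          rintro ⟨h1, h2⟩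
          have h3 := (hX.col a _ hX0 c h2).1
          exact hac ⟨by rw [h1, h3, F.neg_neg], h3⟩
      rw [h1, h2, add_zero]
  -- The companion cancellation, with the two products exchanged.
  have S2 : (if b = c ∧ lt c d then X a d else 0) +
      (if b = F.neg a ∧ lt (F.neg d) a then F.coef a (F.neg d) * X (F.neg d) c * w d
          else 0) = 0 := by
    by_cases hac : b = c ∧ c = F.neg a
    · obtain ⟨rfl, rfl⟩ := hac
      have hlt : lt (F.neg d) a ↔ lt (F.neg a) d :=
        ⟨fun h' => by simpa [F.neg_neg] using hneg _ _ h',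
          fun h' => by simpa [F.neg_neg] using hneg _ _ h'⟩
      by_cases hba : lt (F.neg a) d
      · simp only [hlt, hba, and_self, if_true]
        have h1 := h.cross_left a (F.neg a) d
        rw [F.neg_neg] at h1
        have hc := hcoef a
        by_cases hX0 : X a d = 0
        · rw [hX0]
          rw [hX0] at h1
          have : F.coef a (F.neg d) * X (F.neg d) (F.neg a) * w d = 0 := by
            have : e * (F.coef a (F.neg d) * X (F.neg d) (F.neg a) * w d) = 0 := by
              linear_combination h1
            exact (mul_eq_zero.1 this).resolve_left he
          rw [this]; ring
        · have h2 := (hX.col a _ hX0 _ hba).2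
          rw [F.neg_neg] at h2
          linear_combination (F.coef (F.neg a) a) * h1 - X a d * hc -
            (F.coef a (F.neg d) * X (F.neg d) (F.neg a) * w d) * h2
      · simp [hlt, hba]
    · have h1 : (if b = c ∧ lt c d then X a d else 0) = 0 := by
        by_cases hX0 : X a d = 0
        · simp [hX0]
        · rw [if_neg]
          rintro ⟨h1, h2⟩
          exact hac ⟨h1, (hX.col a d hX0 c h2).1⟩
      have h2 : (if b = F.neg a ∧ lt (F.neg d) a then F.coef a (F.neg d) * X (F.neg d) c * w d
          else 0) = 0 := by
        by_cases hX0 : X (F.neg d) c = 0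
        · simp [hX0]
        · rw [if_neg]
          rintro ⟨h1, h2⟩
          have h3 := (hX.row _ c hX0 a h2).1
          exact hac ⟨by rw [h1, h3, F.neg_neg], F.eq_neg_comm.1 h3⟩
      rw [h1, h2, add_zero]
  simp only [Rq, add_mul, mul_add, smul_mul_assoc, mul_smul_comm, Matrix.add_apply,
    Matrix.smul_apply, smul_eq_mul, mul_sub, sub_mul, Matrix.sub_apply, smul_sub]
  linear_combination h0 + (q - q⁻¹) * (-UL + UR + QL - QR - S1 + S2)

end SkewForm

end skew

/-! ### The matrices P, Q_q and R_q on the labels of each type -/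

namespace AffineType

variable {t : AffineType}

section sums

variable {F : Type*} [Field F] [Algebra KK F]

theorem E_apply (i j : ℤ) (a b : t.Lab) :
    t.E F i j a b = if (a : ℤ) = i ∧ (b : ℤ) = j then 1 else 0 := rfl

theorem sum_EE_diag (f : t.Lab → t.Lab → F) (a b c d : t.Lab) :
    (∑ i : t.Lab, ∑ j : t.Lab, f i j • (t.E F i i ⊗ₖ t.E F j j)) (a, b) (c, d) =
      if a = c ∧ b = d then f a b else 0 := by
  simp only [Matrix.sum_apply, Matrix.smul_apply, Matrix.kroneckerMap_apply, E_apply,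
    smul_eq_mul]
  rw [Finset.sum_eq_single a, Finset.sum_eq_single b]
  · simp only [true_and, Subtype.ext_iff, eq_comm (a := (a : ℤ)), eq_comm (a := (b : ℤ))]
    split_ifs <;> simp_all
  · intro x _ hx
    have : ¬ (b : ℤ) = x := fun h => hx (Subtype.ext h).symm
    simp [this]
  · simp
  · intro x _ hx
    have : ¬ (a : ℤ) = x := fun h => hx (Subtype.ext h).symm
    simp [this]
  · simp

theorem sum_EE_flip (f : t.Lab → t.Lab → F) (a b c d : t.Lab) :
    (∑ i : t.Lab, ∑ j : t.Lab, f i j • (t.E F i j ⊗ₖ t.E F j i)) (a, b) (c, d) =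
      if a = d ∧ b = c then f a c else 0 := by
  simp only [Matrix.sum_apply, Matrix.smul_apply, Matrix.kroneckerMap_apply, E_apply,
    smul_eq_mul]
  rw [Finset.sum_eq_single a, Finset.sum_eq_single c]
  · simp only [true_and, Subtype.ext_iff, eq_comm (a := (d : ℤ)), and_true]
    split_ifs <;> simp_all
  · intro x _ hx
    have : ¬ (c : ℤ) = x := fun h => hx (Subtype.ext h).symm
    simp [this]
  · simp
  · intro x _ hx
    have : ¬ (a : ℤ) = x := fun h => hx (Subtype.ext h).symm
    simp [this]
  · simp

theorem sum_EE_neg (f : t.Lab → t.Lab → F) (a b c d : t.Lab) :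
    (∑ i : t.Lab, ∑ j : t.Lab, f i j • (t.E F i j ⊗ₖ t.E F (-i) (-j))) (a, b) (c, d) =
      if (b : ℤ) = -a ∧ (d : ℤ) = -c then f a c else 0 := by
  simp only [Matrix.sum_apply, Matrix.smul_apply, Matrix.kroneckerMap_apply, E_apply,
    smul_eq_mul]
  rw [Finset.sum_eq_single a, Finset.sum_eq_single c]
  · simp
  · intro x _ hx
    have : ¬ (c : ℤ) = x := fun h => hx (Subtype.ext h).symm
    simp [this]
  · simp
  · intro x _ hx
    have : ¬ (a : ℤ) = x := fun h => hx (Subtype.ext h).symm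
    simp [this]
  · simp

theorem Pmat_eq : t.Pmat F = flipMat t.Lab F := by
  ext ⟨a, b⟩ ⟨c, d⟩
  have := sum_EE_flip (F := F) (fun _ _ => 1) a b c d
  simp only [one_smul] at this
  rw [Pmat, this]
  rfl

end sums

/-- The order of the labels. -/
def ltLab (t : AffineType) (a b : t.Lab) : Prop := (a : ℤ) < b

instance : DecidableRel t.ltLab := fun a b => inferInstanceAs (Decidable ((a : ℤ) < b))

theorem neg_mem_labels (hf : t.family ≠ .A) (a : t.Lab) : -(a : ℤ) ∈ t.labels := by
  have := a.2
  rw [mem_labels] at this ⊢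
  cases h : t.family <;> simp only [h] at this ⊢
  · exact absurd h hf
  · omega
  · omega
  · omega

theorem theta_sq (a : t.Lab) : (t.theta a : ℤ) * t.theta a = 1 := by
  have := a.2
  rw [mem_labels] at this
  cases h : t.family <;> simp only [h, theta] at this ⊢ <;> try rfl
  rcases lt_trichotomy (a : ℤ) 0 with h0 | h0 | h0
  · rw [Int.sign_eq_neg_one_of_neg h0]; rfl
  · exact absurd h0 this.1
  · rw [Int.sign_eq_one_of_pos h0]; rfl

/-- The skew form of the types `B`, `C`, `D`. -/
noncomputable def skew (t : AffineType) (hf : t.family ≠ .A) : SkewForm t.Lab KK where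
  neg a := ⟨-a, neg_mem_labels hf a⟩
  neg_neg a := Subtype.ext (_root_.neg_neg _)
  coef a b := t.coef KK a b
  coef_self a := by simp [coef, ← Int.cast_mul, theta_sq]
  coef_mul a b c := by
    have h : t.twoNu a - t.twoNu c = (t.twoNu a - t.twoNu b) + (t.twoNu b - t.twoNu c) := by ring
    simp only [coef]
    rw [h, zpow_add₀ (by rw [Algebra.algebraMap_self_apply]; exact qh_ne_zero)]
    have := theta_sq b
    have h2 : ((t.theta a * t.theta c : ℤ) : KK) =
        ((t.theta a * t.theta b : ℤ) : KK) * ((t.theta b * t.theta c : ℤ) : KK) := by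
      rw [← Int.cast_mul]
      congr 1
      linear_combination (-t.theta a * t.theta c) * this
    rw [h2]
    ring

theorem Qmat_eq (hf : t.family ≠ .A) : t.Qmat KK = (t.skew hf).Q := by
  have : t.Qmat KK =
      ∑ i : t.Lab, ∑ j : t.Lab, t.coef KK i j • (t.E KK i j ⊗ₖ t.E KK (-i) (-j)) := by
    rw [Qmat]; split
    · contradiction
    · rfl
  rw [this]
  ext ⟨a, b⟩ ⟨c, d⟩
  rw [sum_EE_neg (fun i j => t.coef KK i j)]
  simp [SkewForm.Q, SkewForm.upperQ, skew, Subtype.ext_iff]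

theorem Rconst_A (hf : t.family = .A) : t.Rconst KK = RqA q t.ltLab := by
  have h1 : t.Rconst KK =
      (∑ i : t.Lab, ∑ j : t.Lab, (if i = j then q else 1) • (t.E KK i i ⊗ₖ t.E KK j j)) +
      ∑ i : t.Lab, ∑ j : t.Lab, (if (i : ℤ) < j then q - q⁻¹ else 0) •
        (t.E KK i j ⊗ₖ t.E KK j i) := by
    rw [Rconst, hf]
    simp only [← Finset.sum_add_distrib]
    refine Finset.sum_congr rfl fun i _ => Finset.sum_congr rfl fun j _ => ?_
    congr 1
    · congr 1; split_ifs <;> simp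
    · split_ifs <;> simp
  rw [h1]
  ext ⟨a, b⟩ ⟨c, d⟩
  rw [Matrix.add_apply, sum_EE_diag (fun i j => if i = j then q else 1),
    sum_EE_flip (fun i j => if (i : ℤ) < j then q - q⁻¹ else 0)]
  simp only [RqA, diagA, upperFlip, Matrix.add_apply, Matrix.smul_apply, Matrix.of_apply,
    Matrix.diagonal_apply, Prod.mk.injEq, ltLab, smul_eq_mul]
  congr 1
  by_cases h1 : a = d <;> by_cases h2 : b = c <;> simp [h1, h2]

theorem Rconst_BCD (hf : t.family ≠ .A) : t.Rconst KK = (t.skew hf).Rq q t.ltLab := by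
  have h1 : t.Rconst KK =
      (∑ i : t.Lab, ∑ j : t.Lab, ((if i = j then q else 1) *
        (if (i : ℤ) = -j then q⁻¹ else 1)) • (t.E KK i i ⊗ₖ t.E KK j j)) +
      ((∑ i : t.Lab, ∑ j : t.Lab, (if (i : ℤ) < j then q - q⁻¹ else 0) •
        (t.E KK i j ⊗ₖ t.E KK j i)) -
      ∑ i : t.Lab, ∑ j : t.Lab, (if (i : ℤ) < j then (q - q⁻¹) * t.coef KK i j else 0) •
        (t.E KK i j ⊗ₖ t.E KK (-i) (-j))) := by
    rw [Rconst]
    split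
    · contradiction
    simp only [← Finset.sum_add_distrib, ← Finset.sum_sub_distrib]
    refine Finset.sum_congr rfl fun i _ => Finset.sum_congr rfl fun j _ => ?_
    congr 1
    · congr 1
      have hq := q_ne_zero
      split_ifs <;> simp [hq]
    · split_ifs <;> simp [smul_sub, mul_smul]
  rw [h1]
  ext ⟨a, b⟩ ⟨c, d⟩
  rw [Matrix.add_apply, Matrix.sub_apply, sum_EE_diag (fun i j => (if i = j then q else 1) *
        (if (i : ℤ) = -j then q⁻¹ else 1)),
    sum_EE_flip (fun i j => if (i : ℤ) < j then q - q⁻¹ else 0),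
    sum_EE_neg (fun i j => if (i : ℤ) < j then (q - q⁻¹) * t.coef KK i j else 0)]
  simp only [SkewForm.Rq, SkewForm.diag, SkewForm.upperQ, upperFlip, Matrix.add_apply,
    Matrix.smul_apply, Matrix.of_apply, Matrix.sub_apply,
    Matrix.diagonal_apply, Prod.mk.injEq, ltLab, smul_eq_mul, skew, Subtype.ext_iff, mul_sub]
  congr 1
  congr 1
  · by_cases h1 : (a : ℤ) = d <;> by_cases h2 : (b : ℤ) = c <;> simp [h1, h2]
  · by_cases h1 : (b : ℤ) = -a <;> by_cases h2 : (d : ℤ) = -c <;> simp [h1, h2]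

/-- The order of the labels with `1` and `-1` interchanged. -/
def ltLab' (t : AffineType) (a b : t.Lab) : Prop :=
  Equiv.swap (1 : ℤ) (-1) a < Equiv.swap (1 : ℤ) (-1) b

instance : DecidableRel t.ltLab' := fun a b =>
  inferInstanceAs (Decidable (Equiv.swap (1 : ℤ) (-1) a < Equiv.swap (1 : ℤ) (-1) b))

theorem ltLab'_iff (h0 : (0 : ℤ) ∉ t.labels) (a b : t.Lab) : t.ltLab' a b ↔
    ((a : ℤ) < b ∧ ¬ ((a : ℤ) = -1 ∧ (b : ℤ) = 1)) ∨ ((a : ℤ) = 1 ∧ (b : ℤ) = -1) := by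
  have ha : (a : ℤ) ≠ 0 := fun h => h0 (h ▸ a.2)
  have hb : (b : ℤ) ≠ 0 := fun h => h0 (h ▸ b.2)
  rw [ltLab', Equiv.swap_apply_def, Equiv.swap_apply_def]
  split_ifs <;> omega

/-- In type D one has ν_1 = ν_{-1} = 0, so at the positions (1, -1) and (-1, 1) the flip term and
the Q_q term coincide and drop out of their difference. The relative order of 1 and -1 is therefore
immaterial to R_q. The interchanged order is the one in which the labels of x_n are neighbours. -/
theorem Rconst_D (hf : t.family = .D) :
    t.Rconst KK = (t.skew (by simp [hf])).Rq q t.ltLab' := by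
  rw [Rconst_BCD (by simp [hf])]
  have h0 : (0 : ℤ) ∉ t.labels := by rw [mem_labels, hf]; simp
  rw [SkewForm.Rq, SkewForm.Rq]
  congr 2
  ext ⟨a, b⟩ ⟨c, d⟩
  simp only [SkewForm.upperQ, upperFlip, Matrix.of_apply, Matrix.sub_apply, skew, Subtype.ext_iff,
    ltLab'_iff h0]
  by_cases h1 : ((a : ℤ) = 1 ∧ (c : ℤ) = -1) ∨ ((a : ℤ) = -1 ∧ (c : ℤ) = 1)
  · have hc : t.coef KK a c = 1 := by
      rcases h1 with ⟨h1, h2⟩ | ⟨h1, h2⟩ <;> simp [coef, theta, twoNu, hf, h1, h2]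
    rw [hc]
    have e1 : ((a : ℤ) = d ∧ (b : ℤ) = c) ↔ ((b : ℤ) = -a ∧ (d : ℤ) = -c) := by omega
    simp only [← and_assoc, e1, sub_self]
  · have : ((a : ℤ) < c ∧ ¬ ((a : ℤ) = -1 ∧ (c : ℤ) = 1)) ∨ ((a : ℤ) = 1 ∧ (c : ℤ) = -1) ↔
      t.ltLab a c := by
      rw [ltLab]; omega
    simp only [this]

end AffineType

/-! ### Root vectors as pairs of elementary matrices -/

namespace AffineType

variable {t : AffineType}

theorem q_zpow_ite (p : Prop) [Decidable p] : q ^ (if p then 1 else 0 : ℤ) = if p then q else 1 := by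
  split_ifs <;> simp

theorem q_zpow_neg_ite (p : Prop) [Decidable p] :
    q ^ (-(if p then 1 else 0) : ℤ) = if p then q⁻¹ else 1 := by
  split_ifs <;> simp

/-- The pairing of `ε_k - ε_l` with `ε_b`. -/
def rootPairing (k l b : ℤ) : ℤ :=
  (if k = b then 1 else 0) - (if k = -b then 1 else 0) - (if l = b then 1 else 0) +
    (if l = -b then 1 else 0)

theorem rootPairing_neg (k l b : ℤ) : rootPairing k l (-b) = -rootPairing k l b := by
  simp only [rootPairing, _root_.neg_neg]
  ring

/-- Since ε_{-b} = -ε_b, the two summands of `pairMat` have the same weight. -/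
theorem rootPairing_symm (k l b : ℤ) : rootPairing (-l) (-k) b = rootPairing k l b := by
  simp only [rootPairing]
  split_ifs <;> omega

theorem q_zpow_rootPairing (k l b : ℤ) : q ^ rootPairing k l b =
    (if k = b then q else 1) * (if k = -b then q⁻¹ else 1) * (if l = b then q⁻¹ else 1) *
      (if l = -b then q else 1) := by
  rw [rootPairing, sub_eq_add_neg, sub_eq_add_neg, zpow_add₀ q_ne_zero, zpow_add₀ q_ne_zero,
    zpow_add₀ q_ne_zero, q_zpow_ite, q_zpow_ite, q_zpow_neg_ite, q_zpow_neg_ite]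

/-- The matrix `x E_kl + y E_{-l,-k}`. -/
noncomputable def pairMat (t : AffineType) (k l : ℤ) (x y : KK) : Matrix t.Lab t.Lab KK :=
  x • t.E KK k l + y • t.E KK (-l) (-k)

theorem pairMat_apply (k l : ℤ) (x y : KK) (a b : t.Lab) :
    t.pairMat k l x y a b = (if (a : ℤ) = k ∧ (b : ℤ) = l then x else 0) +
      (if (a : ℤ) = -l ∧ (b : ℤ) = -k then y else 0) := by
  simp [pairMat, E_apply]

theorem pairMat_support {k l : ℤ} {x y : KK} {a b : t.Lab} (h : t.pairMat k l x y a b ≠ 0) :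
    ((a : ℤ) = k ∧ (b : ℤ) = l) ∨ ((a : ℤ) = -l ∧ (b : ℤ) = -k) := by
  by_contra h'
  push Not at h'
  apply h
  rw [pairMat_apply, if_neg (fun h => h'.1 h.1 h.2), if_neg (fun h => h'.2 h.1 h.2), add_zero]

theorem coef_eq (a b : ℤ) : t.coef KK a b =
    ((t.theta a * t.theta b : ℤ) : KK) * qh ^ (t.twoNu a - t.twoNu b) := by
  simp [coef]

/-- The matrix lives on the positions (k, l) and (-l, -k), so crossing amounts to one scalar
identity at each. The positions coincide when `l = -k`, as for x_0 and x_n in type C; the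
conditional summands in `h1` then cover both. -/
theorem pairMat_rootVector (hf : t.family ≠ .A) {k l : ℤ} {x y e : KK} (hkl : k ≠ l)
    (h1 : q ^ rootPairing k l k * (y + if l = -k then x else 0) =
      -(e * t.coef KK l k * (x + if l = -k then y else 0)))
    (h2 : l ≠ -k → q ^ rootPairing k l l * y * e * t.coef KK (-k) (-l)  = - x) (h3 : e ≠ 0) :
    (t.skew hf).RootVector q e (fun b => q ^ rootPairing k l b) (t.pairMat k l x y) := by
  constructor
  · intro a c h h'
    have := congrArg Subtype.val h'
    rcases pairMat_support h with h | h <;> omega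
  · intro a c h b
    simp only [skew, Subtype.ext_iff]
    rcases pairMat_support h with ⟨ha, hc⟩ | ⟨ha, hc⟩
    · rw [ha, hc, q_zpow_rootPairing]
    · rw [ha, hc, ← q_zpow_rootPairing, rootPairing_symm]
  · intro b
    simp only [skew]
    rw [rootPairing_neg, ← zpow_add₀ q_ne_zero, add_neg_cancel, zpow_zero]
  · intro a d
    simp only [skew]
    rw [pairMat_apply, pairMat_apply]
    simp only [neg_inj, neg_eq_iff_eq_neg]
    by_cases c1 : (a : ℤ) = k ∧ (d : ℤ) = l
    · obtain ⟨ha, hd⟩ := c1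
      rw [ha, hd]
      simp only [and_self, if_true]
      by_cases hl : l = -k
      · subst hl
        simp only [if_true, _root_.neg_neg, and_self] at h1 ⊢
        linear_combination h1
      · have hl' : ¬ k = -l := fun h => hl (by omega)
        simp only [hl, hl', false_and, if_false, add_zero, zero_add, _root_.neg_neg, and_self, if_true] at h1 ⊢
        linear_combination h1
    · by_cases c2 : (a : ℤ) = -l ∧ (d : ℤ) = -k
      · obtain ⟨ha, hd⟩ := c2
        have hl : l ≠ -k := fun h => c1 ⟨by omega, by omega⟩
        have hl' : ¬ (-l = k) := fun h => hl (by omega)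
        rw [ha, hd]
        simp only [hl', false_and, if_false, add_zero, zero_add, and_self, if_true,
          rootPairing_neg, zpow_neg, _root_.neg_neg, Ne.symm hl, hl]
        have h2 := h2 hl
        have hq : q ^ rootPairing k l l ≠ 0 := zpow_ne_zero _ q_ne_zero
        field_simp
        linear_combination h2
      · rw [if_neg c1, if_neg c2, if_neg (fun h => c2 ⟨by omega, by omega⟩),
          if_neg (fun h => c1 ⟨by omega, by omega⟩)]
        simp

theorem pairMat_adj {lt : t.Lab → t.Lab → Prop} {k l : ℤ} {x y : KK}
    (h1 : ∀ a c b : t.Lab, (a : ℤ) = k → (c : ℤ) = l →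
      (lt a b ↔ b = c ∨ lt c b) ∧ ¬ lt c c ∧ (lt b c ↔ b = a ∨ lt b a) ∧ ¬ lt a a)
    (h2 : ∀ a c b : t.Lab, (a : ℤ) = -l → (c : ℤ) = -k →
      (lt a b ↔ b = c ∨ lt c b) ∧ ¬ lt c c ∧ (lt b c ↔ b = a ∨ lt b a) ∧ ¬ lt a a) :
    AdjSupport lt (t.pairMat k l x y) := by
  constructor
  · intro a c h b
    rcases pairMat_support h with h | h
    · exact ⟨(h1 a c b h.1 h.2).1, (h1 a c b h.1 h.2).2.1⟩
    · exact ⟨(h2 a c b h.1 h.2).1, (h2 a c b h.1 h.2).2.1⟩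
  · intro a c h b
    rcases pairMat_support h with h | h
    · exact (h1 a c b h.1 h.2).2.2
    · exact (h2 a c b h.1 h.2).2.2

theorem q_zpow_eq (m : ℤ) : q ^ m = qh ^ (2 * m) := by
  rw [← qh_sq, ← zpow_natCast, ← zpow_mul]; rfl

end AffineType

/-! ### Constant relations for the vectors x_i -/

namespace AffineType

variable {t : AffineType}

/-- The constant conditions on `R_q` and `Q_q` for the vector `x_i`, `i ≥ 1`. -/
structure FiniteRelation (t : AffineType) (w : t.Lab → KK) (X : Matrix t.Lab t.Lab KK) : Prop where
  Rq : t.Rconst KK * ((1 : Matrix t.Lab t.Lab KK) ⊗ₖ X + X ⊗ₖ Matrix.diagonal w) =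
    (X ⊗ₖ (1 : Matrix t.Lab t.Lab KK) + Matrix.diagonal w ⊗ₖ X) * t.Rconst KK
  Q_left : t.Qmat KK * ((1 : Matrix t.Lab t.Lab KK) ⊗ₖ X) =
    -(t.Qmat KK * (X ⊗ₖ Matrix.diagonal w))
  Q_right : (Matrix.diagonal w ⊗ₖ X) * t.Qmat KK =
    -((X ⊗ₖ (1 : Matrix t.Lab t.Lab KK)) * t.Qmat KK)

theorem finiteRelation_of (hf : t.family ≠ .A) {w : t.Lab → KK} {X : Matrix t.Lab t.Lab KK}
    (h : (t.skew hf).RootVector q 1 w X) {lt : t.Lab → t.Lab → Prop} [DecidableRel lt]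
    (hlt : AdjSupport lt X) (hR : t.Rconst KK = (t.skew hf).Rq q lt) : t.FiniteRelation w X where
  Rq := by rw [hR]; exact SkewForm.Rq_finite q_ne_zero h hlt
  Q_left := by rw [Qmat_eq hf, SkewForm.Q_cross_left h, one_smul]
  Q_right := by rw [Qmat_eq hf, SkewForm.Q_cross_right h, one_smul]

theorem finite_skew_middle (hf : t.family ≠ .A) {i : ℕ} (hi : 0 < i) (hin : i < t.n) :
    t.FiniteRelation (fun b => q ^ t.wt i b) (t.vecX (1 : KK) i) := by
  -- Here `p` is the barred index n + 1 - i. As `p ≥ 2`, the labels `-p` and `-p + 1` are both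
  -- negative, so their signs ϑ agree and ν increases by exactly one.
  obtain ⟨p, hp⟩ : ∃ p : ℤ, p = t.n + 1 - i := ⟨_, rfl⟩
  have hp2 : 2 ≤ p := by omega
  have hX : t.vecX (1 : KK) i = t.pairMat (-p) (-p + 1) 1
      (-((t.theta (-p) * t.theta (-p + 1) : ℤ) : KK)) := by
    cases h : t.family <;> simp only [vecX, h] <;> try contradiction
    all_goals
      rw [if_neg (by omega), if_neg (by omega), pairMat, Fm, ← hp]
      simp [sub_eq_add_neg]
  have hwt : ∀ b : ℤ, t.wt i b = rootPairing (-p) (-p + 1) b := by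
    intro b
    cases h : t.family <;> simp only [wt, h] <;> try contradiction
    all_goals
      rw [if_neg (by omega), if_neg (by omega), ← hp]
      simp only [fdiag, rootPairing]
      split_ifs <;> omega
  have hr1 : rootPairing (-p) (-p + 1) (-p) = 1 := by
    simp only [rootPairing]; split_ifs <;> omega
  have hr2 : rootPairing (-p) (-p + 1) (-p + 1) = -1 := by
    simp only [rootPairing]; split_ifs <;> omega
  have hth : t.theta (-p) * t.theta (-p + 1) = 1 := by
    cases h : t.family <;> simp only [theta, h] <;> try rfl
    exact theta_pred p hp2
  have hnu : t.twoNu (-p + 1) - t.twoNu (-p) = 2 := by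
    cases h : t.family <;> simp only [twoNu, h] <;> try contradiction
    all_goals
      try rw [Int.sign_eq_neg_one_of_neg (by omega), Int.sign_eq_neg_one_of_neg (by omega)]
      ring
  have hnu' : t.twoNu (- -p) - t.twoNu (-(-p + 1)) = 2 := by
    cases h : t.family <;> simp only [twoNu, h] <;> try contradiction
    all_goals
      try rw [Int.sign_eq_one_of_pos (by omega), Int.sign_eq_one_of_pos (by omega)]
      ring
  have hth' : t.theta (- -p) * t.theta (-(-p + 1)) = 1 := by
    cases h : t.family <;> simp only [theta, h] <;> try rfl
    rw [Int.sign_eq_one_of_pos (by omega), Int.sign_eq_one_of_pos (by omega)]; rfl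
  have hq2 : qh ^ (2 : ℤ) = q := by rw [← qh_sq]; norm_cast
  rw [hX, hth]
  simp only [hwt]
  refine finiteRelation_of hf (lt := t.ltLab) (pairMat_rootVector hf (by omega) ?_ ?_ one_ne_zero)
    ?_ (Rconst_BCD hf)
  · rw [hr1, coef_eq, mul_comm (t.theta _), hth, hnu, hq2, if_neg (by omega), if_neg (by omega)]
    simp
  · intro _
    rw [hr2, coef_eq, hth', hnu', hq2]
    have := q_ne_zero
    simp [this]
  · apply pairMat_adj <;> intro a c b ha hc <;> have hb := b.2 <;> simp only [ltLab, Subtype.ext_iff]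
      <;> omega

/-- Crossing fixes the ratio `-q^(-1/2)` of the two coefficients of x_n, because ν_0 - ν_{-1} = 1/2.
-/
theorem finite_B_last (hf : t.family = .B) :
    t.FiniteRelation (fun b => q ^ t.wt t.n b) (t.vecX (1 : KK) t.n) := by
  have hn := t.le_n
  simp only [hf, Family.minRank] at hn
  have hf' : t.family ≠ .A := by simp [hf]
  have hX : t.vecX (1 : KK) t.n = t.pairMat (-1) 0 cst (-(cst * qh⁻¹)) := by
    simp only [vecX, hf]
    rw [if_neg (by omega), if_pos trivial, pairMat]
    simp only [Algebra.algebraMap_self_apply, smul_sub, smul_smul, neg_smul, sub_eq_add_neg]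
    simp [smul_smul]
  have hwt : ∀ b : ℤ, t.wt t.n b = rootPairing (-1) 0 b := by
    intro b
    simp only [wt, hf]
    rw [if_neg (by omega), if_pos trivial]
    simp only [fdiag, rootPairing]
    split_ifs <;> omega
  have hr1 : rootPairing (-1) 0 (-1) = 1 := by simp [rootPairing]
  have hr2 : rootPairing (-1) 0 0 = 0 := by simp [rootPairing]
  rw [hX]
  simp only [hwt]
  have hq := qh_ne_zero
  refine finiteRelation_of hf' (lt := t.ltLab) (pairMat_rootVector hf' (by omega) ?_ ?_ one_ne_zero)
    ?_ (Rconst_BCD hf')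
  · rw [hr1, coef_eq, ← qh_sq]
    simp [theta, twoNu, hf]
    field_simp
  · intro _
    rw [hr2, coef_eq]
    simp [theta, twoNu, hf, hq]
  · apply pairMat_adj <;> intro a c b ha hc <;> have hb := b.2 <;> simp only [ltLab, Subtype.ext_iff]
      <;> omega

/-- Here `l = -k`, so a single elementary matrix suffices and the second coefficient of `pairMat` is
0. The sign ϑ_{-1} ϑ_1 = -1 makes crossing hold, and -1 and 1 are neighbours because 0 is not a
label. -/
theorem finite_C_last (hf : t.family = .C) :
    t.FiniteRelation (fun b => q ^ t.wt t.n b) (t.vecX (1 : KK) t.n) := by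
  have hn := t.le_n
  simp only [hf, Family.minRank] at hn
  have hf' : t.family ≠ .A := by simp [hf]
  have hX : t.vecX (1 : KK) t.n = t.pairMat (-1) 1 1 0 := by
    simp only [vecX, hf]
    rw [if_neg (by omega), if_pos trivial, pairMat]
    simp
  have hwt : ∀ b : ℤ, t.wt t.n b = rootPairing (-1) 1 b := by
    intro b
    simp only [wt, hf]
    rw [if_neg (by omega), if_pos trivial]
    simp only [fdiag, rootPairing]
    split_ifs <;> omega
  have hr1 : rootPairing (-1) 1 (-1) = 2 := by simp [rootPairing]
  rw [hX]
  simp only [hwt]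
  have hq := qh_ne_zero
  refine finiteRelation_of hf' (lt := t.ltLab) (pairMat_rootVector hf' (by omega) ?_ ?_ one_ne_zero)
    ?_ (Rconst_BCD hf')
  · rw [hr1, coef_eq, ← qh_sq]
    simp [theta, twoNu, hf]
    norm_cast
    ring
  · intro h
    exact absurd rfl h
  · apply pairMat_adj <;> intro a c b ha hc <;> have hb := b.2 <;> rw [mem_labels, hf] at hb <;>
      simp only [ltLab, Subtype.ext_iff] <;> dsimp only at hb <;> omega

theorem finite_D_last (hf : t.family = .D) :
    t.FiniteRelation (fun b => q ^ t.wt t.n b) (t.vecX (1 : KK) t.n) := by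
  have hn := t.le_n
  simp only [hf, Family.minRank] at hn
  have hf' : t.family ≠ .A := by simp [hf]
  have hX : t.vecX (1 : KK) t.n = t.pairMat (-2) 1 1 (-1) := by
    simp only [vecX, hf]
    rw [if_neg (by omega), if_pos trivial, pairMat, Fm]
    simp [theta, hf, sub_eq_add_neg]
  have hwt : ∀ b : ℤ, t.wt t.n b = rootPairing (-2) 1 b := by
    intro b
    simp only [wt, hf]
    rw [if_neg (by omega), if_pos trivial]
    simp only [fdiag, rootPairing]
    split_ifs <;> omega
  have hr1 : rootPairing (-2) 1 (-2) = 1 := by simp [rootPairing]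
  have hr2 : rootPairing (-2) 1 1 = -1 := by simp [rootPairing]
  rw [hX]
  simp only [hwt]
  have hq := qh_ne_zero
  have hs2 : Int.sign (-2) = -1 := rfl
  have hs2' : Int.sign 2 = 1 := rfl
  -- In the standard order -1 separates -2 from 1. In `ltLab'` both pairs -2, 1 and -1, 2 consist of
  -- neighbours.
  refine finiteRelation_of hf' (lt := t.ltLab') (pairMat_rootVector hf' (by omega) ?_ ?_ one_ne_zero)
    ?_ (Rconst_D hf)
  · rw [hr1, coef_eq, ← qh_sq]
    simp [theta, twoNu, hf, hs2]
  · intro _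
    rw [hr2, coef_eq, ← qh_sq]
    simp [theta, twoNu, hf, hs2']
    norm_cast
    field_simp
  · have h0 : (0 : ℤ) ∉ t.labels := by rw [mem_labels, hf]; simp
    apply pairMat_adj <;> intro a c b ha hc <;> have hb := b.2 <;> rw [mem_labels, hf] at hb <;>
      simp only [ltLab'_iff h0, Subtype.ext_iff] <;> dsimp only at hb <;> omega

theorem finite_A (hf : t.family = .A) {i : ℕ} (hi : 0 < i) (hin : i ≤ t.n) :
    t.FiniteRelation (fun b => q ^ t.wt i b) (t.vecX (1 : KK) i) := by
  have hX : t.vecX (1 : KK) i = t.E KK i (i + 1) := by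
    simp only [vecX, hf]
    rw [if_neg (by omega)]
  have hQ : t.Qmat KK = 0 := by rw [Qmat, hf]
  refine ⟨?_, by simp [hQ], by simp [hQ]⟩
  have hsupp : ∀ a c : t.Lab, t.E KK i (i + 1) a c ≠ 0 → (a : ℤ) = i ∧ (c : ℤ) = i + 1 := by
    intro a c h
    by_contra h'
    exact h (by rw [E_apply, if_neg h'])
  rw [Rconst_A hf, hX]
  apply RqA_finite q_ne_zero
  · intro a c h
    obtain ⟨ha, hc⟩ := hsupp a c h
    refine ⟨fun h => by have := congrArg Subtype.val h; omega, fun b => ?_⟩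
    simp only [wt, hf]
    rw [if_neg (by omega), sub_eq_add_neg, zpow_add₀ q_ne_zero, q_zpow_ite, q_zpow_neg_ite]
    simp only [Subtype.ext_iff, ha, hc, eq_comm (a := (b : ℤ))]
  · constructor
    · intro a c h b
      obtain ⟨ha, hc⟩ := hsupp a c h
      simp only [ltLab, Subtype.ext_iff]; omega
    · intro a c h b
      obtain ⟨ha, hc⟩ := hsupp a c h
      simp only [ltLab, Subtype.ext_iff]; omega

theorem finiteRelation {i : ℕ} (hi : 0 < i) (hin : i ≤ t.n) :
    t.FiniteRelation (fun b => q ^ t.wt i b) (t.vecX (1 : KK) i) := by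
  by_cases hA : t.family = .A
  · exact finite_A hA hi hin
  · rcases hin.lt_or_eq with h | rfl
    · exact finite_skew_middle hA hi h
    · cases hf : t.family
      · exact absurd hf hA
      · exact finite_B_last hf
      · exact finite_C_last hf
      · exact finite_D_last hf

/-- The scalar `q^(2κ)`, with a harmless choice in type `A`. -/
noncomputable def eKap (t : AffineType) : KK :=
  match t.family with
  | .A => q
  | _ => q ^ t.twoKappa

theorem eKap_ne_zero : t.eKap ≠ 0 := by
  rw [eKap]; split
  · exact q_ne_zero
  · exact zpow_ne_zero _ q_ne_zero

/-- The constant conditions on `R_q` and `Q_q` for the vector `x_0`. -/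
structure AffineRelation (t : AffineType) (w : t.Lab → KK) (X : Matrix t.Lab t.Lab KK) : Prop where
  one : t.Rconst KK * ((1 : Matrix t.Lab t.Lab KK) ⊗ₖ X) =
    (Matrix.diagonal w ⊗ₖ X) * t.Rconst KK
  two : t.Rconst KK * (X ⊗ₖ Matrix.diagonal w) -
      (X ⊗ₖ (1 : Matrix t.Lab t.Lab KK)) * t.Rconst KK =
    (q - q⁻¹) • ((flipMat t.Lab KK - t.Qmat KK) * (X ⊗ₖ Matrix.diagonal w) -
        (X ⊗ₖ (1 : Matrix t.Lab t.Lab KK)) * (flipMat t.Lab KK - t.Qmat KK))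
  Q_left : t.Qmat KK * ((1 : Matrix t.Lab t.Lab KK) ⊗ₖ X) =
    -(t.eKap • (t.Qmat KK * (X ⊗ₖ Matrix.diagonal w)))
  Q_right : (Matrix.diagonal w ⊗ₖ X) * t.Qmat KK =
    -(t.eKap • ((X ⊗ₖ (1 : Matrix t.Lab t.Lab KK)) * t.Qmat KK))

theorem affineRelation_of (hf : t.family ≠ .A) {w : t.Lab → KK} {X : Matrix t.Lab t.Lab KK}
    (h : (t.skew hf).RootVector q t.eKap w X) (hX : (t.skew hf).AffineSupport t.eKap t.ltLab X) :
    t.AffineRelation w X where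
  one := by
    rw [Rconst_BCD hf]; exact SkewForm.Rq_affine_one q_ne_zero h hX
  two := by
    rw [Rconst_BCD hf, Qmat_eq hf]
    refine SkewForm.Rq_affine_two q_ne_zero eKap_ne_zero h hX ?_ ?_
    · intro a b; simp only [ltLab, Subtype.ext_iff]; omega
    · intro a b h; simp only [ltLab, skew] at h ⊢; omega
  Q_left := by rw [Qmat_eq hf, SkewForm.Q_cross_left h]
  Q_right := by rw [Qmat_eq hf, SkewForm.Q_cross_right h]

/-- The hypotheses `h1` and `h2` say that no label other than `k` and `-l` exceeds either of these
two. If they differ, the larger one is the only label above the other, and `h3` or `h4` normalises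
the coefficient there. The columns follow from the rows by negating labels. -/
theorem pairMat_affineSupport (hf : t.family ≠ .A) {k l : ℤ} {x y : KK}
    (h1 : ∀ c ∈ t.labels, k < c → c = -l) (h2 : ∀ c ∈ t.labels, -l < c → c = k)
    (h3 : k < -l → t.eKap * t.coef KK l (-l) = 1) (h4 : -l < k → t.eKap * t.coef KK (-k) k = 1) :
    (t.skew hf).AffineSupport t.eKap t.ltLab (t.pairMat k l x y) := by
  have g1 : ∀ c ∈ t.labels, c < l → c = -k := fun c hc h => by
    have := h1 (-c) (neg_mem_labels hf ⟨c, hc⟩) 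
    have := h2 (-c) (neg_mem_labels hf ⟨c, hc⟩) (by omega)
    omega
  have g2 : ∀ c ∈ t.labels, c < -k → c = l := fun c hc h => by
    have := h1 (-c) (neg_mem_labels hf ⟨c, hc⟩) (by omega)
    omega
  constructor
  · intro a m h c hac
    simp only [ltLab] at hac
    simp only [skew, Subtype.ext_iff]
    rcases pairMat_support h with ⟨ha, hm⟩ | ⟨ha, hm⟩
    · have hc := h1 c c.2 (by omega)
      refine ⟨by omega, ?_⟩
      rw [hc, neg_neg]; exact h3 (by omega)
    · have hc := h2 c c.2 (by omega)
      refine ⟨by omega, ?_⟩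
      rw [hc]; exact h4 (by omega)
  · intro b c h a hac
    simp only [ltLab] at hac
    simp only [skew, Subtype.ext_iff]
    rcases pairMat_support h with ⟨hb, hc⟩ | ⟨hb, hc⟩
    · have ha := g1 a a.2 (by omega)
      refine ⟨by omega, ?_⟩
      rw [ha, neg_neg]; exact h4 (by omega)
    · have ha := g2 a a.2 (by omega)
      refine ⟨by omega, ?_⟩
      rw [ha]; exact h3 (by omega)

theorem eKap_eq (hf : t.family ≠ .A) : t.eKap = qh ^ (2 * t.twoKappa) := by
  rw [eKap]; split
  · contradiction
  · rw [q_zpow_eq]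

/-- The two highest labels are `k = n - 1` and `-l = n`. The value of κ enters through ν_n - ν_{-n}
= 2κ, which gives `eKap * coef (-n) n = 1`, and through the crossing relation. -/
theorem affine_BD (hf : t.family = .B ∨ t.family = .D) (hn : 2 ≤ t.n) :
    t.AffineRelation (fun b => q ^ t.wt 0 b) (t.vecX (1 : KK) 0) := by
  have hf' : t.family ≠ .A := by rcases hf with h | h <;> simp [h]
  have hX : t.vecX (1 : KK) 0 = t.pairMat (t.n - 1) (-t.n) 1 (-1) := by
    rcases hf with h | h <;> simp only [vecX, h, if_true]
    · rw [if_neg (by omega), pairMat, Fm]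
      simp [theta, h, sub_eq_add_neg]
    · rw [pairMat, Fm]
      simp [theta, h, sub_eq_add_neg]
  have hwt : ∀ b : ℤ, t.wt 0 b = rootPairing (t.n - 1) (-t.n) b := by
    intro b
    rcases hf with h | h <;> simp only [wt, h, if_true]
    · rw [if_neg (by omega)]
      simp only [fdiag, rootPairing]
      split_ifs <;> omega
    · simp only [fdiag, rootPairing]
      split_ifs <;> omega
  have hr1 : rootPairing (t.n - 1) (-t.n) (t.n - 1) = 1 := by
    simp only [rootPairing]; split_ifs <;> omega
  have hr2 : rootPairing (t.n - 1) (-t.n) (-t.n) = -1 := by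
    simp only [rootPairing]; split_ifs <;> omega
  have hth : ∀ a, t.theta a = 1 := by
    intro a; rcases hf with h | h <;> simp [theta, h]
  have hs1 : Int.sign (-(t.n : ℤ)) = -1 := Int.sign_eq_neg_one_of_neg (by omega)
  have hs2 : Int.sign ((t.n : ℤ) - 1) = 1 := Int.sign_eq_one_of_pos (by omega)
  have hs3 : Int.sign (-((t.n : ℤ) - 1)) = -1 := Int.sign_eq_neg_one_of_neg (by omega)
  have hs4 : Int.sign (t.n : ℤ) = 1 := Int.sign_eq_one_of_pos (by omega)
  have hnu : t.twoNu (-t.n) - t.twoNu (t.n - 1) = 2 - 2 * t.twoKappa := by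
    rcases hf with h | h <;> simp only [twoNu, twoKappa, h, hs1, hs2] <;> ring
  have hnu2 : t.twoNu (-(t.n - 1)) - t.twoNu (- -t.n) = 2 - 2 * t.twoKappa := by
    rcases hf with h | h <;> simp only [twoNu, twoKappa, h, hs3, hs4, neg_neg] <;> ring
  have hnu3 : t.twoNu (-t.n) - t.twoNu (- -t.n) = - (2 * t.twoKappa) := by
    rcases hf with h | h <;> simp only [twoNu, twoKappa, h, hs1, hs4, neg_neg] <;> ring
  have hq2 : qh ^ (2 : ℤ) = q := by rw [← qh_sq]; norm_cast
  have hq := qh_ne_zero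
  rw [hX]
  simp only [hwt]
  refine affineRelation_of hf' (pairMat_rootVector hf' (by omega) ?_ ?_ eKap_ne_zero)
    (pairMat_affineSupport hf' ?_ ?_ ?_ ?_)
  · rw [hr1, coef_eq, hth, hth, hnu, eKap_eq hf', if_neg (by omega), if_neg (by omega),
      zpow_sub₀ hq, hq2]
    have := zpow_ne_zero (2 * t.twoKappa) hq
    simp
    field_simp
  · intro _
    rw [hr2, coef_eq, hth, hth, hnu2, eKap_eq hf', zpow_sub₀ hq, hq2]
    have := zpow_ne_zero (2 * t.twoKappa) hq
    have := q_ne_zero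
    simp
    field_simp
  · intro c hc hlt
    have := (mem_labels c).1 hc
    rcases hf with h | h <;> simp only [h] at this <;> omega
  · intro c hc hlt
    have := (mem_labels c).1 hc
    rcases hf with h | h <;> simp only [h] at this <;> omega
  · intro _
    rw [coef_eq, hth, hth, hnu3, eKap_eq hf', zpow_neg]
    have := zpow_ne_zero (2 * t.twoKappa) hq
    simp [this]
  · intro h; omega

/-- For n = 1 the vector x_0 has the shape of a short root vector: the relevant labels are 1 and 0,
and q^(2κ) = q. -/
theorem affine_B_one (hf : t.family = .B) (hn : t.n = 1) :
    t.AffineRelation (fun b => q ^ t.wt 0 b) (t.vecX (1 : KK) 0) := by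
  have hf' : t.family ≠ .A := by simp [hf]
  have hX : t.vecX (1 : KK) 0 = t.pairMat 1 0 (-(cst * qh)) cst := by
    simp only [vecX, hf, if_true, hn]
    rw [pairMat]
    simp only [Algebra.algebraMap_self_apply, smul_sub, smul_smul, neg_smul, one_smul]
    simp [sub_eq_neg_add]
  have hwt : ∀ b : ℤ, t.wt 0 b = rootPairing 1 0 b := by
    intro b
    simp only [wt, hf, if_true, hn, fdiag, rootPairing]
    split_ifs <;> omega
  have hr1 : rootPairing 1 0 1 = 1 := by simp [rootPairing]
  have hr2 : rootPairing 1 0 0 = 0 := by simp [rootPairing]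
  have he : t.eKap = qh ^ 2 := by
    rw [eKap_eq hf']; simp only [twoKappa, hf, hn]; norm_num
  have hq := qh_ne_zero
  rw [hX]
  simp only [hwt]
  refine affineRelation_of hf' (pairMat_rootVector hf' (by omega) ?_ ?_ eKap_ne_zero)
    (pairMat_affineSupport hf' ?_ ?_ ?_ ?_)
  · rw [hr1, coef_eq, he, ← qh_sq]
    simp [theta, twoNu, hf]
    field_simp
  · intro _
    rw [hr2, coef_eq, he]
    simp [theta, twoNu, hf]
    field_simp
  · intro c hc hlt
    have := (mem_labels c).1 hc
    simp only [hf, hn] at this; omega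
  · intro c hc hlt
    have := (mem_labels c).1 hc
    simp only [hf, hn] at this; omega
  · intro h; omega
  · intro h
    rw [coef_eq, he]
    simp [theta, twoNu, hf]
    norm_cast
    field_simp

/-- As `l = -k`, the single highest label n plays both roles and the normalisation conditions are
vacuous. The sign ϑ_{-n} ϑ_n = -1 makes crossing hold for one elementary matrix. -/
theorem affine_C (hf : t.family = .C) :
    t.AffineRelation (fun b => q ^ t.wt 0 b) (t.vecX (1 : KK) 0) := by
  have hn := t.le_n
  simp only [hf, Family.minRank] at hn
  have hf' : t.family ≠ .A := by simp [hf]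
  have hX : t.vecX (1 : KK) 0 = t.pairMat t.n (-t.n) 1 0 := by
    simp only [vecX, hf, if_true]
    rw [pairMat]
    simp
  have hwt : ∀ b : ℤ, t.wt 0 b = rootPairing t.n (-t.n) b := by
    intro b
    simp only [wt, hf, if_true, fdiag, rootPairing]
    split_ifs <;> omega
  have hr1 : rootPairing t.n (-t.n) t.n = 2 := by
    simp only [rootPairing]; split_ifs <;> omega
  have hq := qh_ne_zero
  have hs1 : Int.sign (-(t.n : ℤ)) = -1 := Int.sign_eq_neg_one_of_neg (by omega)
  have hs4 : Int.sign (t.n : ℤ) = 1 := Int.sign_eq_one_of_pos (by omega)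
  have hnu : t.twoNu (-t.n) - t.twoNu t.n = 4 - 2 * t.twoKappa := by
    simp only [twoNu, twoKappa, hf]; ring
  have hth : t.theta (-t.n) * t.theta t.n = -1 := by
    simp only [theta, hf, hs1, hs4]; rfl
  rw [hX]
  simp only [hwt]
  refine affineRelation_of hf' (pairMat_rootVector hf' (by omega) ?_ ?_ eKap_ne_zero)
    (pairMat_affineSupport hf' ?_ ?_ ?_ ?_)
  · rw [hr1, coef_eq, hth, hnu, eKap_eq hf', zpow_sub₀ hq, q_zpow_eq]
    have := zpow_ne_zero (2 * t.twoKappa) hq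
    simp
    field_simp
  · intro h
    exact absurd rfl h
  · intro c hc hlt
    have := (mem_labels c).1 hc
    simp only [hf] at this; omega
  · intro c hc hlt
    have := (mem_labels c).1 hc
    simp only [hf] at this; omega
  · intro h; omega
  · intro h; omega

theorem affine_A (hf : t.family = .A) :
    t.AffineRelation (fun b => q ^ t.wt 0 b) (t.vecX (1 : KK) 0) := by
  have hn := t.le_n
  simp only [hf, Family.minRank] at hn
  have hX : t.vecX (1 : KK) 0 = t.E KK (t.n + 1) 1 := by
    simp only [vecX, hf, if_true, one_smul]
  have hQ : t.Qmat KK = 0 := by rw [Qmat, hf]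
  have hsupp : ∀ a c : t.Lab, t.E KK (t.n + 1) 1 a c ≠ 0 → (a : ℤ) = t.n + 1 ∧ (c : ℤ) = 1 := by
    intro a c h
    by_contra h'
    exact h (by rw [E_apply, if_neg h'])
  have hlab : ∀ a : t.Lab, 1 ≤ (a : ℤ) ∧ (a : ℤ) ≤ t.n + 1 := by
    intro a
    have := (mem_labels _).1 a.2
    simpa only [hf] using this
  have hw : WeightA q (fun b : t.Lab => q ^ t.wt 0 b) (t.E KK (t.n + 1) 1) := by
    intro a c h
    obtain ⟨ha, hc⟩ := hsupp a c h
    refine ⟨fun h => by have := congrArg Subtype.val h; omega, fun b => ?_⟩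
    simp only [wt, hf, if_true]
    rw [sub_eq_add_neg, zpow_add₀ q_ne_zero, q_zpow_ite, q_zpow_neg_ite]
    simp only [Subtype.ext_iff, ha, hc, eq_comm (a := (b : ℤ))]
  rw [hX]
  refine ⟨?_, ?_, by simp [hQ], by simp [hQ]⟩
  · rw [Rconst_A hf]
    apply RqA_affine_one q_ne_zero hw
    · intro a c h b
      have := hsupp a c h
      have := hlab b
      simp only [ltLab]; omega
    · intro a c h b
      have := hsupp a c h
      have := hlab b
      simp only [ltLab]; omega
  · rw [Rconst_A hf, hQ, sub_zero]
    apply RqA_affine_two q_ne_zero hw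
    · intro a c h b
      have := hsupp a c h
      have := hlab b
      simp only [ltLab, ne_eq, Subtype.ext_iff]; omega
    · intro a c h b
      have := hsupp a c h
      have := hlab b
      simp only [ltLab, ne_eq, Subtype.ext_iff]; omega

theorem affineRelation : t.AffineRelation (fun b => q ^ t.wt 0 b) (t.vecX (1 : KK) 0) := by
  have hn := t.le_n
  cases hf : t.family <;> simp only [hf, Family.minRank] at hn
  · exact affine_A hf
  · by_cases h1 : t.n = 1
    · exact affine_B_one hf h1
    · exact affine_BD (Or.inl hf) (by omega)
  · exact affine_C hf
  · exact affine_BD (Or.inr hf) (by omega)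

end AffineType

/-! ### Transposed and dualised intertwining relations -/

section relations

variable {ι k : Type*} [Fintype ι] [DecidableEq ι] [Field k]

theorem transpose_kron (A B : Matrix ι ι k) : (A ⊗ₖ B).transpose = A.transpose ⊗ₖ B.transpose := by
  ext ⟨a, b⟩ ⟨c, d⟩; rfl

theorem kron_mul_kron (A B C D : Matrix ι ι k) : (A ⊗ₖ B) * (C ⊗ₖ D) = (A * C) ⊗ₖ (B * D) :=
  (Matrix.mul_kronecker_mul A C B D).symm

/-- The intertwining relation of `R` for a positive generator. -/
def XRel (R : Matrix (ι × ι) (ι × ι) k) (K X₁ X₂ : Matrix ι ι k) : Prop :=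
  R * (1 ⊗ₖ X₂ + X₁ ⊗ₖ K) = (X₁ ⊗ₖ 1 + K ⊗ₖ X₂) * R

/-- The intertwining relation of `R` for a negative generator. -/
def YRel (R : Matrix (ι × ι) (ι × ι) k) (K' Y₁ Y₂ : Matrix ι ι k) : Prop :=
  R * (K' ⊗ₖ Y₂ + Y₁ ⊗ₖ 1) = (Y₁ ⊗ₖ K' + 1 ⊗ₖ Y₂) * R

/-- Conjugation by the flip. -/
theorem flip_conj_kron (A B : Matrix ι ι k) :
    flipMat ι k * (A ⊗ₖ B) * flipMat ι k = B ⊗ₖ A := by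
  rw [flipMat_mul_kron, Matrix.mul_assoc, flipMat_mul_flipMat, Matrix.mul_one]

/-- Transposing reverses all products; expressing the transpose of `R` through the flip and
conjugating by the flip restores the order, with the roles of `M` and `N` exchanged. -/
theorem flip_transpose_relation {R M N : Matrix (ι × ι) (ι × ι) k}
    (hR : R.transpose = flipMat ι k * R * flipMat ι k) (h : R * M = N * R) :
    R * (flipMat ι k * N.transpose * flipMat ι k) =
      (flipMat ι k * M.transpose * flipMat ι k) * R := by
  have hP := flipMat_mul_flipMat (ι := ι) (k := k)
  have h1 := congrArg Matrix.transpose h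
  rw [Matrix.transpose_mul, Matrix.transpose_mul, hR] at h1
  calc R * (flipMat ι k * N.transpose * flipMat ι k)
      = (flipMat ι k * flipMat ι k) * R * (flipMat ι k * N.transpose * flipMat ι k) := by
        rw [hP, Matrix.one_mul]
    _ = flipMat ι k * (flipMat ι k * R * flipMat ι k * N.transpose) * flipMat ι k := by
        simp only [Matrix.mul_assoc]
    _ = flipMat ι k * (M.transpose * (flipMat ι k * R * flipMat ι k)) * flipMat ι k := by
        rw [h1]
    _ = flipMat ι k * M.transpose * flipMat ι k * R * (flipMat ι k * flipMat ι k) := by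
        simp only [Matrix.mul_assoc]
    _ = _ := by rw [hP, Matrix.mul_one]

variable {R : Matrix (ι × ι) (ι × ι) k} {K K' X₁ X₂ Y₁ Y₂ : Matrix ι ι k}

/-- The flip interchanges the legs, so the matrices with the two spectral parameters trade places
while the form of the relation is kept. -/
theorem XRel.transpose (hR : R.transpose = flipMat ι k * R * flipMat ι k)
    (hK : K.transpose = K) (h : XRel R K X₁ X₂) : XRel R K X₂.transpose X₁.transpose := by
  have := flip_transpose_relation hR h
  simpa only [Matrix.transpose_add, transpose_kron, mul_add, add_mul, flip_conj_kron,
    Matrix.transpose_one, hK, XRel] using this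

theorem YRel.transpose (hR : R.transpose = flipMat ι k * R * flipMat ι k)
    (hK : K'.transpose = K') (h : YRel R K' Y₁ Y₂) : YRel R K' Y₂.transpose Y₁.transpose := by
  have := flip_transpose_relation hR h
  simpa only [Matrix.transpose_add, transpose_kron, mul_add, add_mul, flip_conj_kron,
    Matrix.transpose_one, hK, YRel] using this

theorem kron_inv_comm (hKK : K * K' = 1) (hKK' : K' * K = 1)
    (hR : R * (K ⊗ₖ K) = (K ⊗ₖ K) * R) : R * (K' ⊗ₖ K') = (K' ⊗ₖ K') * R := by
  have e1 : (K ⊗ₖ K) * (K' ⊗ₖ K') = 1 := by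
    rw [kron_mul_kron, hKK, Matrix.one_kronecker_one]
  have e2 : (K' ⊗ₖ K') * (K ⊗ₖ K) = 1 := by
    rw [kron_mul_kron, hKK', Matrix.one_kronecker_one]
  calc R * (K' ⊗ₖ K') = ((K' ⊗ₖ K') * (K ⊗ₖ K)) * R * (K' ⊗ₖ K') := by rw [e2, Matrix.one_mul]
    _ = (K' ⊗ₖ K') * (R * (K ⊗ₖ K)) * (K' ⊗ₖ K') := by rw [hR]; simp only [Matrix.mul_assoc]
    _ = (K' ⊗ₖ K') * R * ((K ⊗ₖ K) * (K' ⊗ₖ K')) := by simp only [Matrix.mul_assoc]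
    _ = _ := by rw [e1, Matrix.mul_one]

/-- Left multiplication by `K' ⊗ K'`, which commutes with `R`, moves the Cartan factors so that the
coproduct of x becomes the coproduct of y. -/
theorem XRel.toYRel (hKK' : K' * K = 1) (hR : R * (K' ⊗ₖ K') = (K' ⊗ₖ K') * R)
    (h : XRel R K X₁ X₂) : YRel R K' (K' * X₁) (K' * X₂) := by
  have h1 : (K' ⊗ₖ K') * (R * (1 ⊗ₖ X₂ + X₁ ⊗ₖ K)) =
      (K' ⊗ₖ K') * ((X₁ ⊗ₖ 1 + K ⊗ₖ X₂) * R) := by rw [h]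
  rw [← Matrix.mul_assoc, ← hR, Matrix.mul_assoc, ← Matrix.mul_assoc _ _ R] at h1
  simpa only [YRel, mul_add, kron_mul_kron, hKK', Matrix.mul_one] using h1

theorem YRel.smul (s : k) (h : YRel R K' Y₁ Y₂) : YRel R K' (s • Y₁) (s • Y₂) := by
  have h1 := congrArg (fun Z => s • Z) h
  simp only [YRel, Matrix.kronecker_smul, Matrix.smul_kronecker, ← smul_add, mul_smul_comm,
    smul_mul_assoc] at h1 ⊢
  exact h1

/-- For transposed `X` the matrices `-(X * K')` are the values of the dual representation at x_i.
Right multiplication by `K' ⊗ K'` produces them and interchanges Δ with its opposite. -/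
theorem XRel.dual (hKK : K * K' = 1) (hR : R * (K' ⊗ₖ K') = (K' ⊗ₖ K') * R)
    (h : XRel R K X₁ X₂) :
    R * ((-(X₁ * K')) ⊗ₖ 1 + K' ⊗ₖ (-(X₂ * K'))) =
      (1 ⊗ₖ (-(X₂ * K')) + (-(X₁ * K')) ⊗ₖ K') * R := by
  have h1 : R * (1 ⊗ₖ X₂ + X₁ ⊗ₖ K) * (K' ⊗ₖ K') =
      (X₁ ⊗ₖ 1 + K ⊗ₖ X₂) * R * (K' ⊗ₖ K') := by rw [h]
  rw [Matrix.mul_assoc, Matrix.mul_assoc _ R, hR, ← Matrix.mul_assoc _ _ R] at h1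
  simp only [add_mul, kron_mul_kron, hKK, Matrix.one_mul] at h1
  have hn1 : ∀ A B : Matrix ι ι k, (-A) ⊗ₖ B = -(A ⊗ₖ B) := fun A B => by ext; simp
  have hn2 : ∀ A B : Matrix ι ι k, A ⊗ₖ (-B) = -(A ⊗ₖ B) := fun A B => by ext; simp
  simp only [hn1, hn2, ← neg_add, mul_neg, neg_mul]
  rw [add_comm (_ ⊗ₖ _), h1, add_comm, add_mul]

/-- Counterpart of `XRel.dual`: the dual values `-(K * Y)` arise from left multiplication by `K ⊗
K`. -/
theorem YRel.dual (hKK : K * K' = 1) (hR : R * (K ⊗ₖ K) = (K ⊗ₖ K) * R)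
    (h : YRel R K' Y₁ Y₂) :
    R * ((-(K * Y₁)) ⊗ₖ K + 1 ⊗ₖ (-(K * Y₂))) =
      (K ⊗ₖ (-(K * Y₂)) + (-(K * Y₁)) ⊗ₖ 1) * R := by
  have h1 : (K ⊗ₖ K) * (R * (K' ⊗ₖ Y₂ + Y₁ ⊗ₖ 1)) =
      (K ⊗ₖ K) * ((Y₁ ⊗ₖ K' + 1 ⊗ₖ Y₂) * R) := by rw [h]
  rw [← Matrix.mul_assoc, ← hR, Matrix.mul_assoc, ← Matrix.mul_assoc _ _ R] at h1
  simp only [mul_add, kron_mul_kron, hKK, Matrix.mul_one] at h1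
  have hn1 : ∀ A B : Matrix ι ι k, (-A) ⊗ₖ B = -(A ⊗ₖ B) := fun A B => by ext; simp
  have hn2 : ∀ A B : Matrix ι ι k, A ⊗ₖ (-B) = -(A ⊗ₖ B) := fun A B => by ext; simp
  simp only [hn1, hn2, ← neg_add, mul_neg, neg_mul]
  rw [neg_inj, add_comm (K ⊗ₖ _), add_mul, ← add_mul, ← h1, mul_add, add_comm]

theorem mul_kron_one_apply (M : Matrix (ι × ι) (ι × ι) k) (A : Matrix ι ι k) (a b c d : ι) :
    (M * (A ⊗ₖ (1 : Matrix ι ι k))) (a, b) (c, d) = ∑ m, M (a, b) (m, d) * A m c := by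
  simp [Matrix.mul_apply, Fintype.sum_prod_type, Matrix.one_apply]

theorem one_kron_mul_apply (M : Matrix (ι × ι) (ι × ι) k) (C : Matrix ι ι k) (a b c d : ι) :
    (((1 : Matrix ι ι k) ⊗ₖ C) * M) (a, b) (c, d) = ∑ m, C b m * M (a, m) (c, d) := by
  simp [Matrix.mul_apply, Fintype.sum_prod_type, Matrix.one_apply, Finset.sum_comm (γ := ι)]

/-- Partial transposition reverses multiplication in the first leg only, so a factor on that leg
passes to the other side of `R`. -/
theorem partialTranspose₁_mul_kron (A C : Matrix ι ι k) (R : Matrix (ι × ι) (ι × ι) k) :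
    partialTranspose₁ R * (A.transpose ⊗ₖ C) =
      partialTranspose₁ ((A ⊗ₖ 1) * R * (1 ⊗ₖ C)) := by
  ext ⟨a, b⟩ ⟨c, d⟩
  simp only [partialTranspose₁, Matrix.of_apply]
  rw [mul_one_kron_apply]
  simp only [kron_one_mul_apply]
  simp only [Matrix.mul_apply, Fintype.sum_prod_type, Matrix.of_apply,
    Matrix.kroneckerMap_apply, Matrix.transpose_apply, Finset.sum_mul]
  rw [Finset.sum_comm]
  exact Finset.sum_congr rfl fun _ _ => Finset.sum_congr rfl fun _ _ => by ring

theorem kron_mul_partialTranspose₁ (A C : Matrix ι ι k) (R : Matrix (ι × ι) (ι × ι) k) :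
    (A.transpose ⊗ₖ C) * partialTranspose₁ R =
      partialTranspose₁ ((1 ⊗ₖ C) * R * (A ⊗ₖ 1)) := by
  ext ⟨a, b⟩ ⟨c, d⟩
  simp only [partialTranspose₁, Matrix.of_apply]
  rw [mul_kron_one_apply]
  simp only [one_kron_mul_apply]
  simp only [Matrix.mul_apply, Fintype.sum_prod_type, Matrix.of_apply,
    Matrix.kroneckerMap_apply, Matrix.transpose_apply, Finset.sum_mul]
  exact Finset.sum_congr rfl fun _ _ => Finset.sum_congr rfl fun _ _ => by ring

theorem partialTranspose₁_add (M N : Matrix (ι × ι) (ι × ι) k) :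
    partialTranspose₁ (M + N) = partialTranspose₁ M + partialTranspose₁ N := rfl

/-- Undoing the partial transposition turns the claim into the relation for `R` multiplied by `K' ⊗
1`, with two terms carried across the equality sign; the sign in the antipode accounts for the
transfer. -/
theorem XRel.partial (hKK : K * K' = 1) (hKK' : K' * K = 1) (hK' : K'.transpose = K')
    (hR : R * (K ⊗ₖ K) = (K ⊗ₖ K) * R) (h : XRel R K X₁ X₂) :
    partialTranspose₁ R * ((-(K' * X₁)).transpose ⊗ₖ 1 + K' ⊗ₖ X₂) =
      (1 ⊗ₖ X₂ + (-(K' * X₁)).transpose ⊗ₖ K) * partialTranspose₁ R := by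
  have hT : partialTranspose₁ R * (K' ⊗ₖ X₂) = partialTranspose₁ R * (K'.transpose ⊗ₖ X₂) := by
    rw [hK']
  have hT' : (1 ⊗ₖ X₂) * partialTranspose₁ R =
      ((1 : Matrix ι ι k).transpose ⊗ₖ X₂) * partialTranspose₁ R := by
    rw [Matrix.transpose_one]
  rw [mul_add, add_mul, hT, hT', partialTranspose₁_mul_kron, partialTranspose₁_mul_kron,
    kron_mul_partialTranspose₁, kron_mul_partialTranspose₁, ← partialTranspose₁_add,
    ← partialTranspose₁_add]
  congr 1
  have hn1 : ∀ A B : Matrix ι ι k, (-A) ⊗ₖ B = -(A ⊗ₖ B) := fun A B => by ext; simp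
  have h1 : (K' ⊗ₖ 1) * (R * (1 ⊗ₖ X₂ + X₁ ⊗ₖ K)) =
      (K' ⊗ₖ 1) * ((X₁ ⊗ₖ 1 + K ⊗ₖ X₂) * R) := by rw [h]
  -- Complete the Cartan factor on the second leg to `K ⊗ K`, which passes through `R`.
  have h2 : (K' ⊗ₖ 1) * R * (X₁ ⊗ₖ K) = (1 ⊗ₖ K) * R * ((K' * X₁) ⊗ₖ 1) := by
    have e1 : X₁ ⊗ₖ K = (K ⊗ₖ K) * ((K' * X₁) ⊗ₖ 1) := by
      rw [kron_mul_kron, ← Matrix.mul_assoc, hKK, Matrix.one_mul, Matrix.mul_one]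
    rw [e1, Matrix.mul_assoc, ← Matrix.mul_assoc R, hR]
    simp only [← Matrix.mul_assoc]
    rw [kron_mul_kron, hKK', Matrix.one_mul]
  simp only [hn1, mul_add, add_mul, ← Matrix.mul_assoc, kron_mul_kron, hKK', Matrix.one_mul,
    Matrix.mul_one, Matrix.one_kronecker_one, neg_mul, mul_neg] at h1 ⊢
  rw [h2] at h1
  rw [neg_add_eq_iff_eq_add, eq_sub_of_add_eq h1]
  abel

theorem YRel.partial (hKK : K * K' = 1) (hKK' : K' * K = 1) (hK : K.transpose = K)
    (hR : R * (K ⊗ₖ K) = (K ⊗ₖ K) * R) (hR' : R * (K' ⊗ₖ K') = (K' ⊗ₖ K') * R)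
    (h : YRel R K' Y₁ Y₂) :
    partialTranspose₁ R * ((-(Y₁ * K)).transpose ⊗ₖ K' + 1 ⊗ₖ Y₂) =
      (K ⊗ₖ Y₂ + (-(Y₁ * K)).transpose ⊗ₖ 1) * partialTranspose₁ R := by
  have hT : partialTranspose₁ R * (1 ⊗ₖ Y₂) =
      partialTranspose₁ R * ((1 : Matrix ι ι k).transpose ⊗ₖ Y₂) := by
    rw [Matrix.transpose_one]
  have hT' : (K ⊗ₖ Y₂) * partialTranspose₁ R = (K.transpose ⊗ₖ Y₂) * partialTranspose₁ R := by
    rw [hK]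
  rw [mul_add, add_mul, hT, hT', partialTranspose₁_mul_kron, partialTranspose₁_mul_kron,
    kron_mul_partialTranspose₁, kron_mul_partialTranspose₁, ← partialTranspose₁_add,
    ← partialTranspose₁_add]
  congr 1
  have hn1 : ∀ A B : Matrix ι ι k, (-A) ⊗ₖ B = -(A ⊗ₖ B) := fun A B => by ext; simp
  have h1 : R * (K' ⊗ₖ Y₂ + Y₁ ⊗ₖ 1) * (K ⊗ₖ 1) =
      (Y₁ ⊗ₖ K' + 1 ⊗ₖ Y₂) * R * (K ⊗ₖ 1) := by rw [h]
  have h2 : (Y₁ ⊗ₖ K') * R * (K ⊗ₖ 1) = ((Y₁ * K) ⊗ₖ 1) * R * (1 ⊗ₖ K') := by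
    have e1 : Y₁ ⊗ₖ K' = ((Y₁ * K) ⊗ₖ 1) * (K' ⊗ₖ K') := by
      rw [kron_mul_kron, Matrix.mul_assoc, hKK, Matrix.one_mul, Matrix.mul_one]
    rw [e1, Matrix.mul_assoc _ _ R, ← hR']
    simp only [Matrix.mul_assoc]
    rw [kron_mul_kron, hKK', Matrix.mul_one]
  simp only [hn1, mul_add, add_mul, Matrix.mul_assoc, kron_mul_kron, hKK', Matrix.one_mul,
    Matrix.mul_one, Matrix.one_kronecker_one, neg_mul, mul_neg] at h1 h2 ⊢
  rw [h2] at h1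
  linear_combination (norm := abel) h1

end relations

/-! ### Flip symmetry and conservation of weight -/

section symmetry

variable {ι k : Type*} [Fintype ι] [DecidableEq ι] [Field k]

/-- Matrices whose transpose is their conjugate by the flip. -/
def FlipSymm (M : Matrix (ι × ι) (ι × ι) k) : Prop :=
  ∀ a b c d, M (c, d) (a, b) = M (b, a) (d, c)

/-- Matrices preserving the weight `w`. -/
def PreservesWeight (w : ι → k) (M : Matrix (ι × ι) (ι × ι) k) : Prop :=
  ∀ a b c d, M (a, b) (c, d) * (w c * w d) = w a * w b * M (a, b) (c, d)

theorem flipSymm_flipMat : FlipSymm (flipMat ι k) := by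
  intro a b c d
  simp only [flipMat, Matrix.of_apply]
  congr 1
  apply propext
  constructor <;> rintro ⟨rfl, rfl⟩ <;> simp

theorem preservesWeight_flipMat (w : ι → k) : PreservesWeight w (flipMat ι k) := by
  intro a b c d
  simp only [flipMat, Matrix.of_apply]
  split_ifs with h
  · obtain ⟨rfl, rfl⟩ := h; ring
  · ring

theorem flipSymm_RqA (q : k) (lt : ι → ι → Prop) [DecidableRel lt] : FlipSymm (RqA q lt) := by
  intro a b c d
  simp only [RqA, diagA, upperFlip, Matrix.add_apply, Matrix.smul_apply, Matrix.of_apply,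
    Matrix.diagonal_apply, Prod.mk.injEq]
  by_cases h1 : c = a <;> by_cases h2 : d = b <;> by_cases h3 : c = b <;> by_cases h4 : d = a <;>
    simp_all [eq_comm]

theorem preservesWeight_RqA (q : k) (lt : ι → ι → Prop) [DecidableRel lt] (w : ι → k) :
    PreservesWeight w (RqA q lt) := by
  intro a b c d
  simp only [RqA, diagA, upperFlip, Matrix.add_apply, Matrix.smul_apply, Matrix.of_apply,
    Matrix.diagonal_apply, Prod.mk.injEq]
  by_cases h1 : a = c ∧ b = d
  · obtain ⟨rfl, rfl⟩ := h1; ring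
  · by_cases h2 : a = d ∧ b = c
    · obtain ⟨rfl, rfl⟩ := h2; ring
    · have : ¬ (a = d ∧ b = c ∧ lt a c) := fun h => h2 ⟨h.1, h.2.1⟩
      simp [h1, this]

namespace SkewForm

variable (F : SkewForm ι k)

theorem flipSymm_upperQ {lt : ι → ι → Prop} [DecidableRel lt]
    (hlt : ∀ a c, lt (F.neg a) (F.neg c) ↔ lt c a)
    (hc : ∀ a c, F.coef (F.neg a) (F.neg c) = F.coef c a) : FlipSymm (F.upperQ lt) := by
  intro a b c d
  simp only [upperQ, Matrix.of_apply]
  by_cases h1 : d = F.neg c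
  · by_cases h2 : b = F.neg a
    · subst h1 h2
      simp [F.neg_neg, hlt, hc]
    · have : ¬ a = F.neg b := fun h => h2 (F.eq_neg_comm.1 h)
      simp [h2, this]
  · have : ¬ c = F.neg d := fun h => h1 (F.eq_neg_comm.1 h)
    simp [h1, this]

theorem preservesWeight_upperQ {lt : ι → ι → Prop} [DecidableRel lt] {w : ι → k}
    (hw : ∀ a, w a * w (F.neg a) = 1) : PreservesWeight w (F.upperQ lt) := by
  intro a b c d
  simp only [upperQ, Matrix.of_apply]
  split_ifs with h
  · obtain ⟨rfl, rfl, _⟩ := h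
    rw [hw, hw]; ring
  · ring

theorem flipSymm_Rq (q : k) {lt : ι → ι → Prop} [DecidableRel lt]
    (hlt : ∀ a c, lt (F.neg a) (F.neg c) ↔ lt c a)
    (hc : ∀ a c, F.coef (F.neg a) (F.neg c) = F.coef c a) : FlipSymm (F.Rq q lt) := by
  intro a b c d
  have h1 := F.flipSymm_upperQ hlt hc a b c d
  have h3 : upperFlip k lt (c, d) (a, b) = upperFlip k lt (b, a) (d, c) := by
    simp only [upperFlip, Matrix.of_apply]
    congr 1
    apply propext
    constructor <;> rintro ⟨rfl, rfl, h⟩ <;> simp [h]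
  have h4 : F.diag q (c, d) (a, b) = F.diag q (b, a) (d, c) := by
    simp only [diag, Matrix.diagonal_apply, Prod.mk.injEq]
    by_cases h : c = a ∧ d = b
    · obtain ⟨rfl, rfl⟩ := h
      simp [eq_comm, F.eq_neg_comm (a := d)]
    · have : ¬ (b = d ∧ a = c) := fun h' => h ⟨h'.2.symm, h'.1.symm⟩
      simp [h, this]
  simp only [Rq, Matrix.add_apply, Matrix.smul_apply, Matrix.sub_apply, h1, h3, h4]

theorem preservesWeight_Rq (q : k) {lt : ι → ι → Prop} [DecidableRel lt] {w : ι → k}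
    (hw : ∀ a, w a * w (F.neg a) = 1) : PreservesWeight w (F.Rq q lt) := by
  intro a b c d
  have h1 := F.preservesWeight_upperQ (lt := lt) hw a b c d
  have h3 : upperFlip k lt (a, b) (c, d) * (w c * w d) =
      w a * w b * upperFlip k lt (a, b) (c, d) := by
    simp only [upperFlip, Matrix.of_apply]
    split_ifs with h
    · obtain ⟨rfl, rfl, _⟩ := h; ring
    · ring
  have h4 : F.diag q (a, b) (c, d) * (w c * w d) = w a * w b * F.diag q (a, b) (c, d) := by
    simp only [diag, Matrix.diagonal_apply, Prod.mk.injEq]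
    by_cases h : a = c ∧ b = d
    · obtain ⟨rfl, rfl⟩ := h; ring
    · simp [h]
  simp only [Rq, Matrix.add_apply, Matrix.smul_apply, Matrix.sub_apply, smul_eq_mul]
  linear_combination h4 + (q - q⁻¹) * (h3 - h1)

end SkewForm

theorem FlipSymm.transpose_eq {M : Matrix (ι × ι) (ι × ι) k} (h : FlipSymm M) :
    M.transpose = flipMat ι k * M * flipMat ι k := by
  ext ⟨a, b⟩ ⟨c, d⟩
  rw [mul_flipMat_apply, flipMat_mul_apply, Matrix.transpose_apply]
  exact h a b c d

theorem PreservesWeight.comm {w : ι → k} {M : Matrix (ι × ι) (ι × ι) k}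
    (h : PreservesWeight w M) :
    M * (Matrix.diagonal w ⊗ₖ Matrix.diagonal w) =
      (Matrix.diagonal w ⊗ₖ Matrix.diagonal w) * M := by
  rw [Matrix.diagonal_kronecker_diagonal]
  ext ⟨a, b⟩ ⟨c, d⟩
  rw [Matrix.mul_diagonal, Matrix.diagonal_mul]
  exact h a b c d

theorem FlipSymm.add {M N : Matrix (ι × ι) (ι × ι) k} (hM : FlipSymm M) (hN : FlipSymm N) :
    FlipSymm (M + N) := fun a b c d => by
  rw [Matrix.add_apply, Matrix.add_apply, hM, hN]

theorem FlipSymm.smul {M : Matrix (ι × ι) (ι × ι) k} (s : k) (hM : FlipSymm M) :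
    FlipSymm (s • M) := fun a b c d => by
  rw [Matrix.smul_apply, Matrix.smul_apply, hM]

theorem PreservesWeight.add {w : ι → k} {M N : Matrix (ι × ι) (ι × ι) k}
    (hM : PreservesWeight w M) (hN : PreservesWeight w N) : PreservesWeight w (M + N) :=
  fun a b c d => by
    rw [Matrix.add_apply]
    linear_combination hM a b c d + hN a b c d

theorem PreservesWeight.smul {w : ι → k} {M : Matrix (ι × ι) (ι × ι) k} (s : k)
    (hM : PreservesWeight w M) : PreservesWeight w (s • M) :=
  fun a b c d => by
    rw [Matrix.smul_apply, smul_eq_mul]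
    linear_combination s * hM a b c d

end symmetry

/-! ### Symmetries of R_q and Q_q -/

namespace AffineType

variable {t : AffineType}

/-- The function ν is odd, and negating both labels leaves the product of the signs ϑ unchanged. -/
theorem skew_coef_neg (hf : t.family ≠ .A) (a c : t.Lab) :
    (t.skew hf).coef ((t.skew hf).neg a) ((t.skew hf).neg c) = (t.skew hf).coef c a := by
  have h1 : ∀ b : ℤ, t.twoNu (-b) = -t.twoNu b := by
    intro b
    cases h : t.family <;> simp only [twoNu, h, Int.sign_neg] <;> ring
  have h2 : t.theta (-a) * t.theta (-c) = t.theta c * t.theta a := by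
    cases h : t.family <;> simp only [theta, h, Int.sign_neg] <;> ring
  simp only [skew, coef, h1, h2]
  congr 2
  ring

theorem Rconst_flipSymm : FlipSymm (t.Rconst KK) := by
  by_cases hf : t.family = .A
  · rw [Rconst_A hf]; exact flipSymm_RqA _ _
  · rw [Rconst_BCD hf]
    refine (t.skew hf).flipSymm_Rq q (fun a c => ?_) (skew_coef_neg hf)
    simp [ltLab, skew]

theorem Qmat_A (hf : t.family = .A) : t.Qmat KK = 0 := by rw [Qmat, hf]

theorem Qmat_flipSymm : FlipSymm (t.Qmat KK) := by
  by_cases hf : t.family = .A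
  · rw [Qmat_A hf]; exact fun _ _ _ _ => rfl
  · rw [Qmat_eq hf]
    exact (t.skew hf).flipSymm_upperQ (fun a c => Iff.rfl) (skew_coef_neg hf)

theorem wt_neg (hf : t.family ≠ .A) (i : ℕ) (a : ℤ) : t.wt i (-a) = -t.wt i a := by
  have h : ∀ j : ℤ, fdiag j (-a) = -fdiag j a := by
    intro j
    simp only [fdiag]
    split_ifs <;> omega
  cases hf' : t.family <;> simp only [wt, hf', h] <;> (try exact absurd hf' hf) <;>
    split_ifs <;> ring

theorem q_wt_neg (hf : t.family ≠ .A) (i : ℕ) (a : t.Lab) :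
    q ^ t.wt i a * q ^ t.wt i ((t.skew hf).neg a) = 1 := by
  have : (((t.skew hf).neg a : t.Lab) : ℤ) = -a := rfl
  rw [this, wt_neg hf, ← zpow_add₀ q_ne_zero, add_neg_cancel, zpow_zero]

theorem Rconst_preservesWeight (i : ℕ) :
    PreservesWeight (fun a : t.Lab => q ^ t.wt i a) (t.Rconst KK) := by
  by_cases hf : t.family = .A
  · rw [Rconst_A hf]; exact preservesWeight_RqA _ _ _
  · rw [Rconst_BCD hf]
    exact (t.skew hf).preservesWeight_Rq q (q_wt_neg hf i)

theorem Qmat_preservesWeight (i : ℕ) :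
    PreservesWeight (fun a : t.Lab => q ^ t.wt i a) (t.Qmat KK) := by
  by_cases hf : t.family = .A
  · rw [Qmat_A hf]; intro _ _ _ _; simp
  · rw [Qmat_eq hf]
    exact (t.skew hf).preservesWeight_upperQ (q_wt_neg hf i)

/-! ### The R-matrix with denominators cleared -/

section polynomial

variable (t) {A : Type*} [CommRing A] [Algebra KK A]

/-- The R-matrix `R(x/y)` multiplied by `(q y - q⁻¹ x)(e y - x)`. -/
noncomputable def Rnum (x y : A) : Matrix (t.Lab × t.Lab) (t.Lab × t.Lab) A :=
  ((y - x) * (algebraMap KK A t.eKap * y - x)) • (t.Rconst KK).map (algebraMap KK A) +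
    (algebraMap KK A (q - q⁻¹) * x) •
      ((algebraMap KK A t.eKap * y - x) • (flipMat t.Lab KK).map (algebraMap KK A) -
        (y - x) • (t.Qmat KK).map (algebraMap KK A))

theorem Rnum_map {B : Type*} [CommRing B] [Algebra KK B] (f : A →ₐ[KK] B) (x y : A) :
    (t.Rnum x y).map f = t.Rnum (f x) (f y) := by
  ext a b
  simp [Rnum]

/-- Up to a scalar only the ratio x/y matters. This removes η from the parameters and relates the
pair (x, y) to (y⁻¹, x⁻¹). -/
theorem Rnum_scale (c x y : A) : t.Rnum (c * x) (c * y) = c ^ 2 • t.Rnum x y := by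
  ext a b
  simp [Rnum]
  ring

/-- The initial condition R(1) = P: the terms with R_q and Q_q carry the factor `y - x`. -/
theorem Rnum_self (x : KK) :
    t.Rnum x x = ((q - q⁻¹) * x * (t.eKap * x - x)) • flipMat t.Lab KK := by
  ext a b
  simp [Rnum]
  ring

theorem Rnum_point (x y : KK) : t.Rnum x y =
    ((y - x) * (t.eKap * y - x)) • t.Rconst KK +
      ((q - q⁻¹) * x * (t.eKap * y - x)) • flipMat t.Lab KK +
        (-((q - q⁻¹) * x * (y - x))) • t.Qmat KK := by
  ext a b
  simp [Rnum]
  ring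

theorem Rnum_flipSymm (x y : KK) : FlipSymm (t.Rnum x y) := by
  rw [Rnum_point]
  exact ((Rconst_flipSymm.smul _).add (flipSymm_flipMat.smul _)).add (Qmat_flipSymm.smul _)

theorem Rnum_preservesWeight (x y : KK) (i : ℕ) :
    PreservesWeight (fun a : t.Lab => q ^ t.wt i a) (t.Rnum x y) := by
  rw [Rnum_point]
  exact (((Rconst_preservesWeight i).smul _).add ((preservesWeight_flipMat _).smul _)).add
    ((Qmat_preservesWeight i).smul _)

/-- The label `n`. -/
def topLabel : t.Lab := ⟨t.n, by
  have := t.le_n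
  rw [mem_labels]
  cases hf : t.family <;> simp only [hf, Family.minRank] at this ⊢ <;> omega⟩

/-- The corresponding entry of R(z) is 1, so the cleared matrix shows exactly the cleared
denominator. Partial transposition fixes this position, which makes it a witness that both R and its
partial transpose are nonzero. -/
theorem Rnum_topLabel (x y : A) :
    t.Rnum x y (t.topLabel, t.topLabel) (t.topLabel, t.topLabel) =
      (algebraMap KK A q * y - algebraMap KK A q⁻¹ * x) * (algebraMap KK A t.eKap * y - x) := by
  have hn : (1 : ℤ) ≤ t.n := by
    have := t.le_n
    cases hf : t.family <;> simp only [hf, Family.minRank] at this ⊢ <;> omega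
  have h1 : t.Rconst KK (t.topLabel, t.topLabel) (t.topLabel, t.topLabel) = q := by
    by_cases hf : t.family = .A
    · rw [Rconst_A hf]; simp [RqA, diagA, upperFlip, ltLab]
    · rw [Rconst_BCD hf]
      have hne : t.topLabel ≠ (t.skew hf).neg t.topLabel := by
        intro h
        have h := congrArg Subtype.val h
        simp only [skew, topLabel] at h
        omega
      simp [SkewForm.Rq, SkewForm.diag, SkewForm.upperQ, upperFlip, ltLab, hne]
  have h2 : t.Qmat KK (t.topLabel, t.topLabel) (t.topLabel, t.topLabel) = 0 := by
    by_cases hf : t.family = .A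
    · rw [Qmat_A hf]; rfl
    · rw [Qmat_eq hf]
      have hne : t.topLabel ≠ (t.skew hf).neg t.topLabel := by
        intro h
        have h := congrArg Subtype.val h
        simp only [skew, topLabel] at h
        omega
      simp [SkewForm.Q, SkewForm.upperQ, hne]
  simp only [Rnum, Matrix.add_apply, Matrix.sub_apply, Matrix.smul_apply, Matrix.map_apply, h1, h2,
    flipMat, Matrix.of_apply, smul_eq_mul, map_zero, and_self, if_true, map_one, map_sub]
  ring

end polynomial

/-! ### Comparison with `R(z)` -/

section comparison

variable {F : Type*} [Field F] [Algebra KK F]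

theorem E_map (i j : ℤ) : t.E F i j = (t.E KK i j).map (algebraMap KK F) := by
  ext a b
  simp only [E, Matrix.map_apply, Matrix.of_apply]
  split_ifs <;> simp

theorem EE_map (i j k l : ℤ) : t.E F i j ⊗ₖ t.E F k l =
    (t.E KK i j ⊗ₖ t.E KK k l).map (algebraMap KK F) := by
  ext a b
  simp [E_map (F := F)]

theorem coef_map (i j : ℤ) : t.coef F i j = algebraMap KK F (t.coef KK i j) := by
  simp [coef]

theorem Rconst_map : t.Rconst F = (t.Rconst KK).map (algebraMap KK F) := by
  ext a b
  cases hf : t.family <;>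
  · simp only [Rconst, hf, Matrix.map_apply, Matrix.sum_apply, map_sum, Matrix.add_apply, map_add]
    refine Finset.sum_congr rfl fun i _ => Finset.sum_congr rfl fun j _ => ?_
    congr 1
    · split_ifs <;> simp [EE_map (F := F)]
    · split_ifs <;> simp [-algebraMap_smul, EE_map (F := F), coef_map (F := F)]

theorem Pmat_map : t.Pmat F = (flipMat t.Lab KK).map (algebraMap KK F) := by
  rw [Pmat_eq]
  ext a b
  simp only [flipMat, Matrix.map_apply, Matrix.of_apply]
  split_ifs <;> simp

theorem Qmat_map : t.Qmat F = (t.Qmat KK).map (algebraMap KK F) := by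
  ext a b
  cases hf : t.family <;>
    simp [-algebraMap_smul, Qmat, hf, Matrix.sum_apply, EE_map (F := F), coef_map (F := F)]

theorem R_div (x y : F) (hy : y ≠ 0)
    (h1 : algebraMap KK F q * y - algebraMap KK F q⁻¹ * x ≠ 0)
    (h2 : algebraMap KK F t.eKap * y - x ≠ 0) :
    ((algebraMap KK F q * y - algebraMap KK F q⁻¹ * x) * (algebraMap KK F t.eKap * y - x)) •
      t.R (x / y) = t.Rnum x y := by
  rw [map_inv₀] at h1 ⊢
  have e1 : algebraMap KK F q - (algebraMap KK F q)⁻¹ * (x / y) =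
      (algebraMap KK F q * y - (algebraMap KK F q)⁻¹ * x) / y := by field_simp
  -- In type A the matrix Q_q vanishes, so the conventional value of `eKap` there does no harm.
  have hQ : ((1 - x / y) / (algebraMap KK F q ^ t.twoKappa - x / y)) • t.Qmat F =
      ((y - x) / (algebraMap KK F t.eKap * y - x)) • t.Qmat F := by
    by_cases hf : t.family = .A
    · rw [Qmat_map, Qmat_A hf]; ext; simp
    · have : algebraMap KK F t.eKap = algebraMap KK F q ^ t.twoKappa := by
        rw [eKap]
        split
        · contradiction
        · rw [map_zpow₀]
      rw [← this]
      congr 1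
      field_simp
  rw [R, hQ, e1, Rconst_map, Pmat_map, Qmat_map, Rnum, map_sub, map_inv₀]
  generalize algebraMap KK F q = p at *
  generalize algebraMap KK F t.eKap = e at *
  ext a b
  simp only [Matrix.add_apply, Matrix.sub_apply, Matrix.smul_apply, smul_eq_mul]
  generalize (t.Rconst KK).map (algebraMap KK F) a b = r
  generalize (t.Qmat KK).map (algebraMap KK F) a b = s
  generalize (flipMat t.Lab KK).map (algebraMap KK F) a b = f
  generalize hz1 : p * y - p⁻¹ * x = z1 at *
  generalize hz2 : e * y - x = z2 at *
  field_simp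

end comparison

/-! ### Intertwining relations for the generators -/

theorem vecX_eq_smul (u : KK) : t.vecX u 0 = u • t.vecX (1 : KK) 0 := by
  cases hf : t.family <;> simp only [vecX, hf, if_true, one_smul]
  split_ifs <;> rfl

theorem vecX_eq_one (u : KK) {i : ℕ} (hi : i ≠ 0) : t.vecX u i = t.vecX (1 : KK) i := by
  cases hf : t.family <;> simp only [vecX, hf, if_neg hi]

theorem flipMat_mul_add (X Y : Matrix t.Lab t.Lab KK) :
    flipMat t.Lab KK * (1 ⊗ₖ X + X ⊗ₖ Y) = (X ⊗ₖ 1 + Y ⊗ₖ X) * flipMat t.Lab KK := by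
  rw [mul_add, add_mul, flipMat_mul_kron, flipMat_mul_kron]

/-- For i ≥ 1 the parameters play no role: R_q and the flip intertwine separately, and crossing with
factor 1 makes Q_q annihilate both combinations. -/
theorem FiniteRelation.xRel {w : t.Lab → KK} {X : Matrix t.Lab t.Lab KK}
    (h : t.FiniteRelation w X) (x y : KK) : XRel (t.Rnum x y) (Matrix.diagonal w) X X := by
  have h1 := h.Rq
  have h2 := flipMat_mul_add X (Matrix.diagonal w)
  have h3 : t.Qmat KK * (1 ⊗ₖ X + X ⊗ₖ Matrix.diagonal w) = 0 := by
    rw [mul_add, h.Q_left, neg_add_cancel]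
  have h4 : (X ⊗ₖ 1 + Matrix.diagonal w ⊗ₖ X) * t.Qmat KK = 0 := by
    rw [add_mul, h.Q_right, add_neg_cancel]
  rw [XRel, Rnum_point]
  generalize (1 : Matrix t.Lab t.Lab KK) ⊗ₖ X + X ⊗ₖ Matrix.diagonal w = M at *
  generalize X ⊗ₖ (1 : Matrix t.Lab t.Lab KK) + Matrix.diagonal w ⊗ₖ X = N at *
  simp only [add_mul, mul_add, Matrix.smul_mul, Matrix.mul_smul, h1, h2, h3, h4]

/-- `AffineRelation.one` removes the terms of R_q with `y`. The flip interchanges the two summands,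
hence contributes a multiple of `y - x`, while crossing turns the contribution of Q_q into a
multiple of `eKap * y - x`. Every remaining term then carries both factors, and their common
cofactor is `AffineRelation.two`. -/
theorem AffineRelation.xRel {w : t.Lab → KK} {X : Matrix t.Lab t.Lab KK}
    (h : t.AffineRelation w X) (x y : KK) :
    XRel (t.Rnum x y) (Matrix.diagonal w) (x • X) (y • X) := by
  have h1 := h.one
  have h2 := h.two
  have h3 := h.Q_left
  have h4 := h.Q_right
  have h5 := flipMat_mul_kron 1 X
  have h6 := flipMat_mul_kron X (Matrix.diagonal w)
  simp only [sub_mul, mul_sub] at h2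
  rw [XRel, Rnum_point]
  simp only [add_mul, mul_add, Matrix.smul_mul, Matrix.mul_smul, Matrix.kronecker_smul,
    Matrix.smul_kronecker] at h1 h2 h3 h4 h5 h6 ⊢
  rw [h1, h3, h4, h5, h6]
  rw [h6] at h2
  rw [sub_eq_iff_eq_add] at h2
  rw [h2]
  module

theorem vecK_one_eq (i : ℕ) :
    t.vecK KK i 1 = Matrix.diagonal fun b : t.Lab => q ^ t.wt i b := by
  simp [vecK]

theorem xRel (x y : KK) {i : ℕ} (hi : i ≤ t.n) :
    XRel (t.Rnum x y) (t.vecK KK i 1) (t.vecX x i) (t.vecX y i) := by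
  rw [vecK_one_eq]
  rcases Nat.eq_zero_or_pos i with rfl | h
  · rw [vecX_eq_smul x, vecX_eq_smul y]
    exact affineRelation.xRel x y
  · rw [vecX_eq_one x h.ne', vecX_eq_one y h.ne']
    exact (finiteRelation h hi).xRel x y

theorem E_transpose (i j : ℤ) : (t.E KK i j).transpose = t.E KK j i := by
  ext a b
  simp [E, and_comm]

theorem Fm_transpose (i j : ℤ) : (t.Fm KK i j).transpose = t.Fm KK j i := by
  simp [Fm, E_transpose, mul_comm]

theorem vecK_mul_Fm (i : ℕ) (e a b : ℤ) (h : t.wt i (-b) = t.wt i a) :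
    t.vecK KK i e * t.Fm KK a b = q ^ (e * t.wt i a) • t.Fm KK a b := by
  rw [Fm, Matrix.mul_sub, Matrix.mul_smul, vecK_mul_E, vecK_mul_E, h, smul_sub, smul_comm]
  rfl

/-- `T_w(y_i)` is a multiple of `T_w(k_i)⁻¹ T_{1/w}(x_i)ᵗ`. -/
theorem vecY_eq_smul {i : ℕ} (hi : i ≤ t.n) : ∃ s : KK, ∀ w : KK,
    t.vecY w i = s • (t.vecK KK i (-1) * (t.vecX w⁻¹ i).transpose) := by
  have hn := t.le_n
  have hq := q_ne_zero
  have hh := qh_ne_zero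
  -- When T(k_i) scales `Fm b a` by q⁻¹, its inverse scales it by q, which the scalar q⁻¹ undoes.
  have hF : ∀ a b : ℤ, t.wt i (-a) = t.wt i b → t.wt i b = -1 →
      q⁻¹ • (t.vecK KK i (-1) * t.Fm KK b a) = t.Fm KK b a := by
    intro a b h1 h2
    rw [vecK_mul_Fm _ _ _ _ h1, h2, smul_smul]
    simp [hq]
  have hE : ∀ (s : KK) (a b : ℤ), s = q ^ t.wt i b →
      s • (t.vecK KK i (-1) * t.E KK b a) = t.E KK b a := by
    intro s a b h2
    rw [vecK_mul_E, h2, smul_smul, Algebra.algebraMap_self_apply, ← zpow_add₀ hq]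
    simp
  cases hf : t.family <;> simp only [hf, Family.minRank] at hn
  · rcases Nat.eq_zero_or_pos i with rfl | h
    · refine ⟨q⁻¹, fun w => ?_⟩
      simp only [vecX, vecY, hf, if_true, Matrix.transpose_smul, E_transpose, Matrix.mul_smul]
      rw [smul_comm, hE]
      simp only [wt, hf, if_true]
      rw [if_neg (by omega)]; simp
    · refine ⟨q⁻¹, fun w => ?_⟩
      simp only [vecX, vecY, hf, if_neg h.ne', E_transpose]
      rw [hE]
      simp only [wt, hf, if_neg h.ne']
      rw [if_neg (by omega)]; simp
  · rcases Nat.eq_zero_or_pos i with rfl | h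
    · refine ⟨q⁻¹, fun w => ?_⟩
      simp only [vecX, vecY, hf, if_true, Matrix.transpose_smul, Matrix.mul_smul]
      split_ifs with h1
      · simp only [Matrix.transpose_sub, Matrix.transpose_smul, E_transpose, Matrix.mul_sub,
          Matrix.mul_smul, vecK_mul_E, Algebra.algebraMap_self_apply]
        have e1 : t.wt 0 (-1) = -1 := by simp [wt, hf, h1, fdiag]
        have e2 : t.wt 0 0 = 0 := by simp [wt, hf, h1, fdiag]
        rw [e1, e2, ← qh_sq]
        simp only [show (-1 * -1 : ℤ) = 1 by norm_num, show (-1 * 0 : ℤ) = 0 by norm_num, zpow_zero,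
          zpow_one]
        match_scalars <;> field_simp
      · rw [Matrix.transpose_smul, Fm_transpose, Matrix.mul_smul, smul_comm, hF]
        · simp only [wt, hf, if_true, if_neg h1, fdiag]
          split_ifs <;> omega
        · simp only [wt, hf, if_true, if_neg h1, fdiag]
          split_ifs <;> omega
    · by_cases h1 : i = t.n
      · refine ⟨1, fun w => ?_⟩
        simp only [vecX, vecY, hf, if_neg h.ne', if_pos h1, Matrix.transpose_smul,
          Matrix.transpose_sub, E_transpose, Matrix.mul_sub, Matrix.mul_smul, vecK_mul_E,
          Algebra.algebraMap_self_apply]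
        have e1 : t.wt i 1 = -1 := by simp [wt, hf, h1, fdiag, h1 ▸ h.ne']
        have e2 : t.wt i 0 = 0 := by simp [wt, hf, h1, fdiag, h1 ▸ h.ne']
        rw [e1, e2, ← qh_sq]
        simp only [show (-1 * -1 : ℤ) = 1 by norm_num, show (-1 * 0 : ℤ) = 0 by norm_num, zpow_zero,
          zpow_one]
        match_scalars <;> field_simp
      · refine ⟨q⁻¹, fun w => ?_⟩
        simp only [vecX, vecY, hf, if_neg h.ne', if_neg h1]
        rw [Fm_transpose, hF]
        · simp only [wt, hf, if_neg h.ne', if_neg h1, fdiag]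
          split_ifs <;> omega
        · simp only [wt, hf, if_neg h.ne', if_neg h1, fdiag]
          split_ifs <;> omega
  · rcases Nat.eq_zero_or_pos i with rfl | h
    · refine ⟨(q ^ 2)⁻¹, fun w => ?_⟩
      simp only [vecX, vecY, hf, if_true, Matrix.transpose_smul, E_transpose, Matrix.mul_smul]
      rw [smul_comm, hE]
      have e : t.wt 0 (-t.n) = -2 := by
        simp only [wt, hf, if_true, fdiag]
        split_ifs <;> omega
      rw [e, zpow_neg]; rfl
    · by_cases h1 : i = t.n
      · refine ⟨(q ^ 2)⁻¹, fun w => ?_⟩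
        simp only [vecX, vecY, hf, if_neg h.ne', if_pos h1, E_transpose]
        rw [hE]
        have e : t.wt i 1 = -2 := by
          simp only [wt, hf, if_neg h.ne', if_pos h1, fdiag]
          norm_num
        rw [e, zpow_neg]; rfl
      · refine ⟨q⁻¹, fun w => ?_⟩
        simp only [vecX, vecY, hf, if_neg h.ne', if_neg h1]
        rw [Fm_transpose, hF]
        · simp only [wt, hf, if_neg h.ne', if_neg h1, fdiag]
          split_ifs <;> omega
        · simp only [wt, hf, if_neg h.ne', if_neg h1, fdiag]
          split_ifs <;> omega
  · refine ⟨q⁻¹, fun w => ?_⟩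
    rcases Nat.eq_zero_or_pos i with rfl | h
    · simp only [vecX, vecY, hf, if_true, Matrix.transpose_smul, Matrix.mul_smul]
      rw [Fm_transpose, smul_comm, hF]
      · simp only [wt, hf, if_true, fdiag]
        split_ifs <;> omega
      · simp only [wt, hf, if_true, fdiag]
        split_ifs <;> omega
    · by_cases h1 : i = t.n
      · simp only [vecX, vecY, hf, if_neg h.ne', if_pos h1]
        rw [Fm_transpose, hF]
        · simp only [wt, hf, if_neg h.ne', if_pos h1, fdiag]
          norm_num
        · simp only [wt, hf, if_neg h.ne', if_pos h1, fdiag]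
          norm_num
      · simp only [vecX, vecY, hf, if_neg h.ne', if_neg h1]
        rw [Fm_transpose, hF]
        · simp only [wt, hf, if_neg h.ne', if_neg h1, fdiag]
          split_ifs <;> omega
        · simp only [wt, hf, if_neg h.ne', if_neg h1, fdiag]
          split_ifs <;> omega

theorem vecK_neg_mul (i : ℕ) : t.vecK KK i (-1) * t.vecK KK i 1 = 1 := by
  simp [vecK_mul]

theorem vecK_mul_neg (i : ℕ) : t.vecK KK i 1 * t.vecK KK i (-1) = 1 := by
  simp [vecK_mul]

theorem Rnum_vecK (x y : KK) (i : ℕ) :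
    t.Rnum x y * (t.vecK KK i 1 ⊗ₖ t.vecK KK i 1) =
      (t.vecK KK i 1 ⊗ₖ t.vecK KK i 1) * t.Rnum x y := by
  rw [vecK_one_eq]
  exact (t.Rnum_preservesWeight x y i).comm

theorem Rnum_vecK_neg (x y : KK) (i : ℕ) :
    t.Rnum x y * (t.vecK KK i (-1) ⊗ₖ t.vecK KK i (-1)) =
      (t.vecK KK i (-1) ⊗ₖ t.vecK KK i (-1)) * t.Rnum x y :=
  kron_inv_comm (vecK_mul_neg i) (vecK_neg_mul i) (Rnum_vecK x y i)

theorem vecK_transpose (i : ℕ) (e : ℤ) : (t.vecK KK i e).transpose = t.vecK KK i e :=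
  Matrix.diagonal_transpose _

theorem YRel.of_smul {ι k : Type*} [Fintype ι] [DecidableEq ι] [Field k] {s : k} (hs : s ≠ 0)
    {R : Matrix (ι × ι) (ι × ι) k} {K' Y₁ Y₂ : Matrix ι ι k} (h : YRel (s • R) K' Y₁ Y₂) :
    YRel R K' Y₁ Y₂ := by
  rw [YRel, Matrix.smul_mul, Matrix.mul_smul] at h
  exact smul_right_injective _ hs h

/-- The vectors for y are multiples of transposed x-vectors with inverted parameters, up to a Cartan
factor. Transposition exchanges the parameters, and `Rnum y⁻¹ x⁻¹` is `(x * y)⁻¹ ^ 2` times `Rnum x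
y`, so the relation for x returns to the original pair. -/
theorem yRel {x y : KK} (hx : x ≠ 0) (hy : y ≠ 0) {i : ℕ} (hi : i ≤ t.n) :
    YRel (t.Rnum x y) (t.vecK KK i (-1)) (t.vecY x i) (t.vecY y i) := by
  obtain ⟨s, hs⟩ := vecY_eq_smul hi
  rw [hs, hs]
  apply YRel.smul
  have hc : (x * y)⁻¹ ^ 2 ≠ 0 := by positivity
  apply YRel.of_smul hc
  rw [← Rnum_scale, mul_inv, show x⁻¹ * y⁻¹ * x = y⁻¹ by field_simp,
    show x⁻¹ * y⁻¹ * y = x⁻¹ by field_simp]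
  exact ((xRel y⁻¹ x⁻¹ hi).transpose (t.Rnum_flipSymm _ _).transpose_eq
    (vecK_transpose i 1)).toYRel (vecK_neg_mul i) (Rnum_vecK_neg _ _ i)

end AffineType

/-! ### Tensor products over a coideal subalgebra -/

section hopf

variable {k H : Type*} [Field k] [Ring H] [HopfAlgebra k H]
variable {m n : Type*} [Fintype m] [DecidableEq m] [Fintype n] [DecidableEq n]

/-- The linear map `x ⊗ y ↦ ρ(x) ⊗ σ(y)` with values in Kronecker products. -/
noncomputable def kronMap (ρ : H →ₐ[k] Matrix m m k) (σ : H →ₐ[k] Matrix n n k) :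
    H ⊗[k] H →ₐ[k] Matrix (m × n) (m × n) k :=
  (Matrix.kroneckerAlgEquiv m n k).toAlgHom.comp (Algebra.TensorProduct.map ρ σ)

theorem kronMap_tmul (ρ : H →ₐ[k] Matrix m m k) (σ : H →ₐ[k] Matrix n n k) (x y : H) :
    kronMap ρ σ (x ⊗ₜ y) = ρ x ⊗ₖ σ y := by
  simp [kronMap]

theorem tensorRep_apply (ρ : H →ₐ[k] Matrix m m k) (σ : H →ₐ[k] Matrix n n k) (h : H) :
    tensorRep ρ σ h = kronMap ρ σ (Coalgebra.comul h) := rfl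

/-- The tensor product with respect to the opposite coproduct. -/
noncomputable def tensorOp (ρ : H →ₐ[k] Matrix m m k) (σ : H →ₐ[k] Matrix n n k) :
    H →ₐ[k] Matrix (m × n) (m × n) k :=
  ((kronMap ρ σ).comp (Algebra.TensorProduct.comm k H H).toAlgHom).comp
    (Bialgebra.comulAlgHom k H)

theorem tensorOp_apply (ρ : H →ₐ[k] Matrix m m k) (σ : H →ₐ[k] Matrix n n k) (h : H) :
    tensorOp ρ σ h = kronMap ρ σ (Algebra.TensorProduct.comm k H H (Coalgebra.comul h)) := rfl

/-- Through this conjugation, irreducibility for Δ becomes applicable to intertwiners that start at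
a tensor product formed with the opposite coproduct. -/
theorem tensorOp_eq_flip (ρ σ : H →ₐ[k] Matrix m m k) (h : H) :
    tensorOp ρ σ h = flipMat m k * tensorRep σ ρ h * flipMat m k := by
  rw [tensorOp_apply, tensorRep_apply]
  generalize (Coalgebra.comul h : H ⊗[k] H) = z
  induction z using TensorProduct.induction_on with
  | zero => simp
  | tmul x y =>
    rw [Algebra.TensorProduct.comm_tmul, kronMap_tmul, kronMap_tmul, flip_conj_kron]
  | add x y hx hy => simp only [map_add, hx, hy, mul_add, add_mul]

theorem tensorRep_eq_flip (ρ σ : H →ₐ[k] Matrix m m k) (h : H) :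
    tensorRep ρ σ h = flipMat m k * tensorOp σ ρ h * flipMat m k := by
  rw [tensorOp_eq_flip]
  have hP := flipMat_mul_flipMat (ι := m) (k := k)
  calc tensorRep ρ σ h = (flipMat m k * flipMat m k) * tensorRep ρ σ h *
        (flipMat m k * flipMat m k) := by rw [hP, Matrix.one_mul, Matrix.mul_one]
    _ = _ := by simp only [Matrix.mul_assoc]

variable {B : Subalgebra k H} (hB : IsRightCoideal B)
include hB

/-- An intertwiner of representations of a right coideal subalgebra, applied in the first
factor, is an intertwiner of tensor products. -/
theorem IsRightCoideal.kron_one_intertwines {ρ ρ' : H →ₐ[k] Matrix m m k}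
    (σ : H →ₐ[k] Matrix n n k) {K : Matrix m m k} (hK : ∀ b ∈ B, K * ρ b = ρ' b * K) {b : H}
    (hb : b ∈ B) :
    (K ⊗ₖ (1 : Matrix n n k)) * tensorRep ρ σ b =
      tensorRep ρ' σ b * (K ⊗ₖ (1 : Matrix n n k)) := by
  rw [tensorRep_apply, tensorRep_apply]
  obtain ⟨z, hz⟩ := hB b hb
  rw [← hz]
  clear hz hb
  induction z using TensorProduct.induction_on with
  | zero => simp
  | tmul x y =>
    have hx := hK x x.2
    simp only [LinearMap.rTensor_tmul, kronMap_tmul, ← Matrix.mul_kronecker_mul, Matrix.one_mul,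
      Matrix.mul_one]
    congr 1
  | add x y hx hy => simp only [map_add, mul_add, add_mul, hx, hy]

/-- In the opposite coproduct of an element of `B` it is the second leg that lies in `B`, so an
intertwiner over `B` can act there. -/
theorem IsRightCoideal.one_kron_intertwines {ρ ρ' : H →ₐ[k] Matrix m m k}
    (σ : H →ₐ[k] Matrix n n k) {K : Matrix m m k} (hK : ∀ b ∈ B, K * ρ b = ρ' b * K) {b : H}
    (hb : b ∈ B) :
    ((1 : Matrix n n k) ⊗ₖ K) * tensorOp σ ρ b =
      tensorOp σ ρ' b * ((1 : Matrix n n k) ⊗ₖ K) := by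
  rw [tensorOp_apply, tensorOp_apply]
  obtain ⟨z, hz⟩ := hB b hb
  rw [← hz]
  clear hz hb
  induction z using TensorProduct.induction_on with
  | zero => simp
  | tmul x y =>
    have hx := hK x x.2
    simp only [LinearMap.rTensor_tmul, Algebra.TensorProduct.comm_tmul, kronMap_tmul,
      ← Matrix.mul_kronecker_mul, Matrix.one_mul, Matrix.mul_one]
    congr 1
  | add x y hx hy => simp only [map_add, mul_add, add_mul, hx, hy]

end hopf

/-! ### Schur's lemma over a subalgebra -/

section schur

variable {k H : Type*} [Field k] [Ring H] [HopfAlgebra k H]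
variable {m : Type*} [Fintype m] [DecidableEq m]

theorem restrictRep_apply (ρ : H →ₐ[k] Matrix m m k) (B : Subalgebra k H) (b : B) (x : m → k) :
    restrictRep ρ B b x = (ρ b).mulVec x := rfl

/-- An intertwiner from an irreducible representation is zero or invertible. -/
theorem intertwiner_isUnit {ρ : H →ₐ[k] Matrix m m k} {B : Subalgebra k H}
    (h : (restrictRep ρ B).IsIrreducible) {ρ' : H → Matrix m m k} {M : Matrix m m k}
    (hM : ∀ b ∈ B, M * ρ b = ρ' b * M) (h0 : M ≠ 0) : IsUnit M := by
  -- The kernel of an intertwiner is stable under `B`; this only requires its values on the target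
  -- side to have the form `ρ' b * M`, for an arbitrary function `ρ'`.
  let W : Subrepresentation (restrictRep ρ B) :=
    { toSubmodule := LinearMap.ker M.mulVecLin
      apply_mem_toSubmodule := by
        intro b x hx
        rw [LinearMap.mem_ker, Matrix.mulVecLin_apply] at hx ⊢
        rw [restrictRep_apply, Matrix.mulVec_mulVec, hM b b.2, ← Matrix.mulVec_mulVec, hx,
          Matrix.mulVec_zero] }
  rcases h.eq_bot_or_eq_top W with hW | hW
  · rw [← Matrix.mulVec_injective_iff_isUnit]
    intro x y hxy
    have : x - y ∈ W := by
      change x - y ∈ LinearMap.ker M.mulVecLin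
      rw [LinearMap.mem_ker, Matrix.mulVecLin_apply, Matrix.mulVec_sub, sub_eq_zero]
      exact hxy
    rw [hW] at this
    exact sub_eq_zero.1 this
  · exfalso
    apply h0
    rw [Matrix.ext_iff_mulVec]
    intro x
    have : x ∈ W := hW ▸ Set.mem_univ x
    rw [Matrix.zero_mulVec]
    exact this

/-- Schur's lemma. -/
theorem intertwiner_scalar [IsAlgClosed k] [Nonempty m] {ρ : H →ₐ[k] Matrix m m k}
    {B : Subalgebra k H}
    (h : (restrictRep ρ B).IsIrreducible) {ρ' : H → Matrix m m k} {L M : Matrix m m k}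
    (hL : ∀ b ∈ B, L * ρ b = ρ' b * L) (hM : ∀ b ∈ B, M * ρ b = ρ' b * M) (hu : IsUnit M) :
    ∃ c : k, L = c • M := by
  -- The matrix `N` is M⁻¹ L, which commutes with `ρ b` for `b ∈ B`. Subtracting an eigenvalue
  -- leaves a commuting matrix with nonzero kernel, which must vanish.
  obtain ⟨N, hN⟩ : ∃ N, M * N = L := by
    obtain ⟨U, rfl⟩ := hu
    exact ⟨(↑U⁻¹ : Matrix m m k) * L, by rw [← Matrix.mul_assoc, U.mul_inv, Matrix.one_mul]⟩
  have hN' : ∀ b ∈ B, N * ρ b = ρ b * N := by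
    intro b hb
    apply hu.mul_left_cancel
    rw [← Matrix.mul_assoc, hN, hL b hb, ← Matrix.mul_assoc, hM b hb, Matrix.mul_assoc, hN]
  obtain ⟨c, hc⟩ := Module.End.exists_eigenvalue (Matrix.toLin' N)
  refine ⟨c, ?_⟩
  obtain ⟨v, hv⟩ := hc.exists_hasEigenvector
  have hv1 := hv.apply_eq_smul
  rw [Matrix.toLin'_apply] at hv1
  have hz : N - c • 1 = 0 := by
    by_contra h0
    have hu := intertwiner_isUnit (ρ' := ρ) h (M := N - c • 1) (by
      intro b hb
      rw [Matrix.sub_mul, Matrix.mul_sub, hN' b hb, Matrix.smul_mul, Matrix.mul_smul,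
        Matrix.one_mul, Matrix.mul_one]) h0
    apply hv.2
    apply Matrix.mulVec_injective_iff_isUnit.2 hu
    rw [Matrix.mulVec_zero, Matrix.sub_mulVec, hv1, Matrix.smul_mulVec, Matrix.one_mulVec,
      sub_self]
  rw [← hN, sub_eq_zero.1 hz, Matrix.mul_smul, Matrix.mul_one]

end schur

/-! ### Intertwiners for the vector representation and its dual -/

namespace AffineType

variable {t : AffineType}

/-- The representation `b ↦ ρ(S(b))ᵗ`. -/
noncomputable def dualRep (ρ : t.Uqg →ₐ[KK] Matrix t.Lab t.Lab KK) :
    t.Uqg →ₐ[KK] Matrix t.Lab t.Lab KK :=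
  (Matrix.transposeAlgEquiv t.Lab KK KK).symm.toAlgHom.comp
    ((AlgHom.op ρ).comp (antipodeHom t.cartanMat t.Q))

theorem dualRep_apply (ρ : t.Uqg →ₐ[KK] Matrix t.Lab t.Lab KK) (b : t.Uqg) :
    dualRep ρ b = (ρ (HopfAlgebra.antipode KK b)).transpose := rfl

theorem dualRep_gen (ρ : t.Uqg →ₐ[KK] Matrix t.Lab t.Lab KK) (s : Gen t.I) :
    dualRep ρ (Uq.gen t.cartanMat t.Q s) =
      (ρ (antipodeGen t.cartanMat t.Q s)).transpose := by
  rw [dualRep_apply]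
  congr 2
  exact antipodeLin_gen _ _ s

theorem intertwines_of_gen {m l : Type*} [Fintype m] [DecidableEq m] [Fintype l] [DecidableEq l]
    {ρ : t.Uqg →ₐ[KK] Matrix m m KK}
    {σ : t.Uqg →ₐ[KK] Matrix l l KK} {M : Matrix l m KK}
    (h : ∀ s, M * ρ (Uq.gen t.cartanMat t.Q s) = σ (Uq.gen t.cartanMat t.Q s) * M) (a : t.Uqg) :
    M * ρ a = σ a * M := by
  induction a using Uq.induction with
  | hgen s => exact h s
  | hone => rw [map_one, map_one, Matrix.mul_one, Matrix.one_mul]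
  | hmul u v hu hv =>
    rw [map_mul, map_mul, ← Matrix.mul_assoc, hu, Matrix.mul_assoc, hv, Matrix.mul_assoc]
  | hadd u v hu hv => rw [map_add, map_add, Matrix.mul_add, Matrix.add_mul, hu, hv]
  | hsmul c u hu => rw [map_smul, map_smul, Matrix.mul_smul, Matrix.smul_mul, hu]

section values

variable (ρ σ : t.Uqg →ₐ[KK] Matrix t.Lab t.Lab KK)

local notation "g" => Uq.gen t.cartanMat t.Q

theorem tensorRep_x (i : t.I) : tensorRep ρ σ (g (.x i)) =
    ρ (g (.x i)) ⊗ₖ 1 + ρ (g (.k i)) ⊗ₖ σ (g (.x i)) := by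
  rw [tensorRep_apply, comul_gen, comulGen, map_add, kronMap_tmul, kronMap_tmul, map_one]

theorem tensorRep_y (i : t.I) : tensorRep ρ σ (g (.y i)) =
    ρ (g (.y i)) ⊗ₖ σ (g (.kInv i)) + 1 ⊗ₖ σ (g (.y i)) := by
  rw [tensorRep_apply, comul_gen, comulGen, map_add, kronMap_tmul, kronMap_tmul, map_one]

theorem tensorRep_k (i : t.I) : tensorRep ρ σ (g (.k i)) = ρ (g (.k i)) ⊗ₖ σ (g (.k i)) := by
  rw [tensorRep_apply, comul_gen, comulGen, kronMap_tmul]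

theorem tensorRep_kInv (i : t.I) :
    tensorRep ρ σ (g (.kInv i)) = ρ (g (.kInv i)) ⊗ₖ σ (g (.kInv i)) := by
  rw [tensorRep_apply, comul_gen, comulGen, kronMap_tmul]

theorem tensorOp_x (i : t.I) : tensorOp ρ σ (g (.x i)) =
    1 ⊗ₖ σ (g (.x i)) + ρ (g (.x i)) ⊗ₖ σ (g (.k i)) := by
  rw [tensorOp_eq_flip, tensorRep_x, mul_add, add_mul, flip_conj_kron, flip_conj_kron]

theorem tensorOp_y (i : t.I) : tensorOp ρ σ (g (.y i)) =
    ρ (g (.kInv i)) ⊗ₖ σ (g (.y i)) + ρ (g (.y i)) ⊗ₖ 1 := by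
  rw [tensorOp_eq_flip, tensorRep_y, mul_add, add_mul, flip_conj_kron, flip_conj_kron]

theorem tensorOp_k (i : t.I) : tensorOp ρ σ (g (.k i)) = ρ (g (.k i)) ⊗ₖ σ (g (.k i)) := by
  rw [tensorOp_eq_flip, tensorRep_k, flip_conj_kron]

theorem tensorOp_kInv (i : t.I) :
    tensorOp ρ σ (g (.kInv i)) = ρ (g (.kInv i)) ⊗ₖ σ (g (.kInv i)) := by
  rw [tensorOp_eq_flip, tensorRep_kInv, flip_conj_kron]

theorem dualRep_x (i : t.I) :
    dualRep ρ (g (.x i)) = (-(ρ (g (.kInv i)) * ρ (g (.x i)))).transpose := by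
  rw [dualRep_gen, antipodeGen, map_neg, map_mul]

theorem dualRep_y (i : t.I) :
    dualRep ρ (g (.y i)) = (-(ρ (g (.y i)) * ρ (g (.k i)))).transpose := by
  rw [dualRep_gen, antipodeGen, map_neg, map_mul]

theorem dualRep_k (i : t.I) : dualRep ρ (g (.k i)) = (ρ (g (.kInv i))).transpose := by
  rw [dualRep_gen, antipodeGen]

theorem dualRep_kInv (i : t.I) : dualRep ρ (g (.kInv i)) = (ρ (g (.k i))).transpose := by
  rw [dualRep_gen, antipodeGen]

end values

/-- `R` intertwines the opposite tensor product with the tensor product. -/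
theorem Rnum_intertwines (u v : KKˣ) (a : t.Uqg) :
    t.Rnum (u : KK) v * tensorOp (t.vecRep u) (t.vecRep v) a =
      tensorRep (t.vecRep u) (t.vecRep v) a * t.Rnum (u : KK) v := by
  apply intertwines_of_gen
  rintro (i | i | i | i)
  · simp only [tensorOp_x, tensorRep_x, vecRep_gen, vecGen]
    exact xRel _ _ (Nat.lt_succ_iff.1 i.2)
  · simp only [tensorOp_y, tensorRep_y, vecRep_gen, vecGen]
    exact yRel u.ne_zero v.ne_zero (Nat.lt_succ_iff.1 i.2)
  · simp only [tensorOp_k, tensorRep_k, vecRep_gen, vecGen]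
    exact Rnum_vecK _ _ _
  · simp only [tensorOp_kInv, tensorRep_kInv, vecRep_gen, vecGen]
    exact Rnum_vecK_neg _ _ _

/-- The dual representation inverts Cartan elements, so after partial transposition conservation of
weight involves `K' ⊗ K` in place of `K ⊗ K`. -/
theorem partialTranspose₁_kron_comm {ι k : Type*} [Fintype ι] [DecidableEq ι] [Field k]
    {R : Matrix (ι × ι) (ι × ι) k} {K K' : Matrix ι ι k} (hK' : K'.transpose = K')
    (hK : K.transpose = K) (hKK : K * K' = 1) (hKK' : K' * K = 1)
    (hR : R * (K ⊗ₖ K) = (K ⊗ₖ K) * R) :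
    partialTranspose₁ R * (K' ⊗ₖ K) = (K' ⊗ₖ K) * partialTranspose₁ R := by
  conv_lhs => rw [← hK', partialTranspose₁_mul_kron]
  conv_rhs => rw [← hK', kron_mul_partialTranspose₁]
  congr 1
  have e1 : (1 : Matrix ι ι k) ⊗ₖ K = (K ⊗ₖ K) * (K' ⊗ₖ 1) := by
    rw [kron_mul_kron, hKK, Matrix.mul_one]
  have e2 : (1 : Matrix ι ι k) ⊗ₖ K = (K' ⊗ₖ 1) * (K ⊗ₖ K) := by
    rw [kron_mul_kron, hKK', Matrix.one_mul]
  conv_rhs => rw [e2, Matrix.mul_assoc (K' ⊗ₖ 1), ← hR]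
  conv_lhs => rw [e1]
  simp only [Matrix.mul_assoc]

/-- `R^(t_1)` intertwines tensor products with the dual representation in the first factor. -/
theorem partialTranspose_intertwines (x y : KKˣ) (a : t.Uqg) :
    partialTranspose₁ (t.Rnum (x : KK) y) * tensorRep (dualRep (t.vecRep x)) (t.vecRep y) a =
      tensorOp (dualRep (t.vecRep x)) (t.vecRep y) a * partialTranspose₁ (t.Rnum (x : KK) y) := by
  apply intertwines_of_gen
  rintro (i | i | i | i)
  · simp only [tensorOp_x, tensorRep_x, dualRep_x, dualRep_k, vecRep_gen, vecGen, vecK_transpose]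
    exact (xRel _ _ (Nat.lt_succ_iff.1 i.2)).partial (vecK_mul_neg i) (vecK_neg_mul i)
      (vecK_transpose _ _) (Rnum_vecK _ _ _)
  · simp only [tensorOp_y, tensorRep_y, dualRep_y, dualRep_kInv, vecRep_gen, vecGen,
      vecK_transpose]
    exact (yRel x.ne_zero y.ne_zero (Nat.lt_succ_iff.1 i.2)).partial (vecK_mul_neg i)
      (vecK_neg_mul i) (vecK_transpose _ _) (Rnum_vecK _ _ _) (Rnum_vecK_neg _ _ _)
  · simp only [tensorOp_k, tensorRep_k, dualRep_k, vecRep_gen, vecGen, vecK_transpose]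
    exact partialTranspose₁_kron_comm (vecK_transpose _ _) (vecK_transpose _ _) (vecK_mul_neg i)
      (vecK_neg_mul i) (Rnum_vecK _ _ _)
  · simp only [tensorOp_kInv, tensorRep_kInv, dualRep_kInv, vecRep_gen, vecGen, vecK_transpose]
    exact partialTranspose₁_kron_comm (vecK_transpose _ _) (vecK_transpose _ _) (vecK_neg_mul i)
      (vecK_mul_neg i) (Rnum_vecK_neg _ _ _)

/-- Dualising both factors combines transposition with the antipode. The transposition exchanges the
parameters, whence `Rnum y x`; the antipode reverses the direction, now from Δ to its opposite. -/
theorem dual_Rnum_intertwines (x y : KKˣ) (a : t.Uqg) :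
    t.Rnum (y : KK) x * tensorRep (dualRep (t.vecRep x)) (dualRep (t.vecRep y)) a =
      tensorOp (dualRep (t.vecRep x)) (dualRep (t.vecRep y)) a * t.Rnum (y : KK) x := by
  have hT := (t.Rnum_flipSymm (y : KK) x).transpose_eq
  apply intertwines_of_gen
  rintro (i | i | i | i)
  · simp only [tensorOp_x, tensorRep_x, dualRep_x, dualRep_k, vecRep_gen, vecGen, vecK_transpose,
      Matrix.transpose_neg, Matrix.transpose_mul]
    exact ((xRel _ _ (Nat.lt_succ_iff.1 i.2)).transpose hT (vecK_transpose _ _)).dual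
      (vecK_mul_neg i) (Rnum_vecK_neg _ _ _)
  · simp only [tensorOp_y, tensorRep_y, dualRep_y, dualRep_kInv, vecRep_gen, vecGen,
      vecK_transpose, Matrix.transpose_neg, Matrix.transpose_mul]
    exact ((yRel y.ne_zero x.ne_zero (Nat.lt_succ_iff.1 i.2)).transpose hT
      (vecK_transpose _ _)).dual (vecK_mul_neg i) (Rnum_vecK _ _ _)
  · simp only [tensorOp_k, tensorRep_k, dualRep_k, vecRep_gen, vecGen, vecK_transpose]
    exact Rnum_vecK_neg _ _ _
  · simp only [tensorOp_kInv, tensorRep_kInv, dualRep_kInv, vecRep_gen, vecGen, vecK_transpose]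
    exact Rnum_vecK _ _ _

/-- Conjugating by the flip turns t_1 into t_2 and, by the symmetry, R into its transpose; the
transpose followed by t_2 is t_1. -/
theorem flip_partialTranspose {ι k : Type*} [Fintype ι] [DecidableEq ι] [Field k]
    {R : Matrix (ι × ι) (ι × ι) k} (h : FlipSymm R) :
    flipMat ι k * partialTranspose₁ R * flipMat ι k = partialTranspose₁ R := by
  ext ⟨a, b⟩ ⟨c, d⟩
  rw [mul_flipMat_apply, flipMat_mul_apply]
  exact (h _ _ _ _).symm

/-- Since the partial transpose is invariant under the flip, `partialTranspose_intertwines` can be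
conjugated so that the dual factor stands second. -/
theorem partialTranspose_intertwines' (x y : KKˣ) (a : t.Uqg) :
    partialTranspose₁ (t.Rnum (x : KK) y) * tensorOp (t.vecRep y) (dualRep (t.vecRep x)) a =
      tensorRep (t.vecRep y) (dualRep (t.vecRep x)) a * partialTranspose₁ (t.Rnum (x : KK) y) := by
  have h := partialTranspose_intertwines x y a
  rw [← flip_partialTranspose (t.Rnum_flipSymm (x : KK) y)]
  conv_lhs => rw [tensorOp_eq_flip]
  conv_rhs => rw [tensorRep_eq_flip]
  have hP := flipMat_mul_flipMat (ι := t.Lab) (k := KK)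
  have e : ∀ U V : Matrix (t.Lab × t.Lab) (t.Lab × t.Lab) KK,
      flipMat t.Lab KK * U * flipMat t.Lab KK * (flipMat t.Lab KK * V * flipMat t.Lab KK) =
        flipMat t.Lab KK * (U * V) * flipMat t.Lab KK := by
    intro U V
    calc _ = flipMat t.Lab KK * U * (flipMat t.Lab KK * flipMat t.Lab KK) * V * flipMat t.Lab KK :=
          by simp only [Matrix.mul_assoc]
      _ = _ := by rw [hP, Matrix.mul_one]; simp only [Matrix.mul_assoc]
  rw [e, e, h]

end AffineType

/-! ### Specialisation of rational functions -/

section specialisation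

open Polynomial

/-- The rational function `f` is regular at `a`, with value `c`. -/
def HasValue {k : Type*} [Field k] (a : k) (f : RatFunc k) (c : k) : Prop :=
  ∃ p d : k[X], d.eval a ≠ 0 ∧ f * algebraMap k[X] (RatFunc k) d = algebraMap k[X] (RatFunc k) p ∧
    c * d.eval a = p.eval a

namespace HasValue

variable {k : Type*} [Field k] {a : k} {f g : RatFunc k} {c e : k}

theorem add (hf : HasValue a f c) (hg : HasValue a g e) : HasValue a (f + g) (c + e) := by
  obtain ⟨p, d, h1, h2, h3⟩ := hf
  obtain ⟨p', d', h1', h2', h3'⟩ := hg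
  refine ⟨p * d' + p' * d, d * d', ?_, ?_, ?_⟩
  · rw [eval_mul]; exact mul_ne_zero h1 h1'
  · simp only [map_mul, map_add]
    linear_combination algebraMap k[X] (RatFunc k) d' * h2 + algebraMap k[X] (RatFunc k) d * h2'
  · simp only [eval_mul, eval_add]
    linear_combination d'.eval a * h3 + d.eval a * h3'

theorem mul (hf : HasValue a f c) (hg : HasValue a g e) : HasValue a (f * g) (c * e) := by
  obtain ⟨p, d, h1, h2, h3⟩ := hf
  obtain ⟨p', d', h1', h2', h3'⟩ := hg
  refine ⟨p * p', d * d', ?_, ?_, ?_⟩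
  · rw [eval_mul]; exact mul_ne_zero h1 h1'
  · simp only [map_mul]
    rw [← h2, ← h2']; ring
  · simp only [eval_mul]
    rw [← h3, ← h3']; ring

theorem poly (p : k[X]) : HasValue a (algebraMap k[X] (RatFunc k) p) (p.eval a) :=
  ⟨p, 1, by simp, by simp, by simp⟩

theorem const (c : k) : HasValue a (algebraMap k (RatFunc k) c) c := by
  have := poly (a := a) (C c)
  rwa [eval_C, RatFunc.algebraMap_C] at this

theorem zero : HasValue a (0 : RatFunc k) 0 := by simpa using const (a := a) 0

theorem one : HasValue a (1 : RatFunc k) 1 := by simpa using const (a := a) 1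

theorem X : HasValue a (RatFunc.X : RatFunc k) a := by simpa using poly (a := a) (Polynomial.X)

theorem neg (hf : HasValue a f c) : HasValue a (-f) (-c) := by
  simpa using (const (-1)).mul hf

theorem sub (hf : HasValue a f c) (hg : HasValue a g e) : HasValue a (f - g) (c - e) := by
  simpa [sub_eq_add_neg] using hf.add hg.neg

theorem inv (hf : HasValue a f c) (hc : c ≠ 0) : HasValue a f⁻¹ c⁻¹ := by
  obtain ⟨p, d, h1, h2, h3⟩ := hf
  have hp : p.eval a ≠ 0 := h3 ▸ mul_ne_zero hc h1
  have hf : f ≠ 0 := by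
    rintro rfl
    rw [zero_mul, eq_comm, map_eq_zero_iff _ (RatFunc.algebraMap_injective k)] at h2
    simp [h2] at hp
  refine ⟨d, p, hp, ?_, ?_⟩
  · rw [← h2, inv_mul_cancel_left₀ hf]
  · rw [← h3, inv_mul_cancel_left₀ hc]

/-- This transfers identities of rational functions to a point: values computed from the two sides
separately have to agree. -/
theorem unique (hf : HasValue a f c) (hf' : HasValue a f e) : c = e := by
  obtain ⟨p, d, h1, h2, h3⟩ := hf
  obtain ⟨p', d', h1', h2', h3'⟩ := hf'
  have h4 : p * d' = p' * d := by
    apply RatFunc.algebraMap_injective k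
    rw [map_mul, map_mul, ← h2, ← h2']; ring
  have h5 := congrArg (eval a) h4
  rw [eval_mul, eval_mul, ← h3, ← h3'] at h5
  apply mul_right_cancel₀ (mul_ne_zero h1 h1')
  linear_combination h5

theorem sum {ι : Type*} (s : Finset ι) {f : ι → RatFunc k} {c : ι → k}
    (h : ∀ i ∈ s, HasValue a (f i) (c i)) : HasValue a (∑ i ∈ s, f i) (∑ i ∈ s, c i) := by
  classical
  induction s using Finset.induction_on with
  | empty => simpa using zero
  | insert i s hi ih =>
    rw [Finset.sum_insert hi, Finset.sum_insert hi]
    exact (h i (by simp)).add (ih fun j hj => h j (by simp [hj]))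

end HasValue

/-- Entrywise values of a matrix of rational functions. -/
def MatHasValue {k m : Type*} [Field k] (a : k) (M : Matrix m m (RatFunc k)) (N : Matrix m m k) :
    Prop :=
  ∀ i j, HasValue a (M i j) (N i j)

namespace MatHasValue

variable {k m : Type*} [Field k] [Fintype m] [DecidableEq m] {a c : k} {f : RatFunc k}
  {M M' : Matrix m m (RatFunc k)} {N N' : Matrix m m k}

theorem add (h : MatHasValue a M N) (h' : MatHasValue a M' N') : MatHasValue a (M + M') (N + N') :=
  fun i j => (h i j).add (h' i j)

theorem sub (h : MatHasValue a M N) (h' : MatHasValue a M' N') : MatHasValue a (M - M') (N - N') :=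
  fun i j => (h i j).sub (h' i j)

theorem smul (hf : HasValue a f c) (h : MatHasValue a M N) : MatHasValue a (f • M) (c • N) :=
  fun i j => hf.mul (h i j)

theorem mul (h : MatHasValue a M N) (h' : MatHasValue a M' N') :
    MatHasValue a (M * M') (N * N') := fun i j => by
  rw [Matrix.mul_apply, Matrix.mul_apply]
  exact HasValue.sum _ fun x _ => (h i x).mul (h' x j)

theorem one : MatHasValue a (1 : Matrix m m (RatFunc k)) 1 := fun i j => by
  rw [Matrix.one_apply, Matrix.one_apply]
  split_ifs
  · exact HasValue.one
  · exact HasValue.zero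

theorem transpose (h : MatHasValue a M N) : MatHasValue a M.transpose N.transpose :=
  fun i j => h j i

theorem unique (h : MatHasValue a M N) (h' : MatHasValue a M N') : N = N' := by
  ext i j
  exact (h i j).unique (h' i j)

end MatHasValue

end specialisation

/-! ### Specialisation of the intertwining equation -/

namespace AffineType

variable {t : AffineType}

theorem matHasValue_E {a : KK} (i j : ℤ) : MatHasValue a (t.E (RatFunc KK) i j) (t.E KK i j) := by
  intro x y
  simp only [E, Matrix.of_apply]
  split_ifs
  · exact HasValue.one
  · exact HasValue.zero

theorem matHasValue_Fm {a : KK} (i j : ℤ) :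
    MatHasValue a (t.Fm (RatFunc KK) i j) (t.Fm KK i j) := by
  refine (matHasValue_E _ _).sub (MatHasValue.smul ?_ (matHasValue_E _ _))
  simpa using HasValue.const (a := a) ((t.theta i * t.theta j : ℤ) : KK)

theorem matHasValue_vecX {a : KK} {f : RatFunc KK} {c : KK} (h : HasValue a f c) (i : ℕ) :
    MatHasValue a (t.vecX f i) (t.vecX c i) := by
  have hc := HasValue.const (a := a) cst
  have hh := HasValue.const (a := a) qh
  have hh' := hh.inv qh_ne_zero
  cases hf : t.family <;> simp only [vecX, hf] <;> split_ifs <;>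
    first
    | exact matHasValue_E _ _
    | exact (matHasValue_E _ _).smul h
    | exact matHasValue_Fm _ _
    | exact (matHasValue_Fm _ _).smul h
    | exact (((matHasValue_E _ _).sub ((matHasValue_E _ _).smul hh)).smul hc).smul h
    | exact ((matHasValue_E _ _).sub ((matHasValue_E _ _).smul hh')).smul hc

theorem matHasValue_vecY {a : KK} {f : RatFunc KK} {c : KK} (h : HasValue a f c) (h0 : c ≠ 0)
    (i : ℕ) : MatHasValue a (t.vecY f i) (t.vecY c i) := by
  have hc := HasValue.const (a := a) cst
  have hh := HasValue.const (a := a) qh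
  have hh' := hh.inv qh_ne_zero
  have h' := h.inv h0
  cases hf : t.family <;> simp only [vecY, hf] <;> split_ifs <;>
    first
    | exact matHasValue_E _ _
    | exact (matHasValue_E _ _).smul h'
    | exact matHasValue_Fm _ _
    | exact (matHasValue_Fm _ _).smul h'
    | exact (((matHasValue_E _ _).sub ((matHasValue_E _ _).smul hh')).smul hc).smul h'
    | exact ((matHasValue_E _ _).sub ((matHasValue_E _ _).smul hh)).smul hc

theorem matHasValue_vecK {a : KK} (i : ℕ) (e : ℤ) :
    MatHasValue a (t.vecK (RatFunc KK) i e) (t.vecK KK i e) := by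
  intro x y
  simp only [vecK, Matrix.diagonal_apply]
  split_ifs
  · rw [← map_zpow₀]
    exact HasValue.const _
  · exact HasValue.zero

/-- The entries are Laurent polynomials in the spectral parameter, hence regular wherever its value
is nonzero. -/
theorem matHasValue_vecRep {a : KK} {w : (RatFunc KK)ˣ} {w₀ : KKˣ}
    (h : HasValue a (w : RatFunc KK) w₀) (b : t.Uqg) :
    MatHasValue a (t.vecRep w b) (t.vecRep w₀ b) := by
  induction b using Uq.induction with
  | hgen s =>
    rw [vecRep_gen, vecRep_gen]
    rcases s with i | i | i | i
    · exact matHasValue_vecX h i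
    · exact matHasValue_vecY h w₀.ne_zero i
    · exact matHasValue_vecK i 1
    · exact matHasValue_vecK i (-1)
  | hone => rw [map_one, map_one]; exact MatHasValue.one
  | hmul u v hu hv => rw [map_mul, map_mul]; exact hu.mul hv
  | hadd u v hu hv => rw [map_add, map_add]; exact hu.add hv
  | hsmul c u hu =>
    rw [map_smul, map_smul, ← algebraMap_smul (RatFunc KK) c]
    exact hu.smul (HasValue.const c)

open Polynomial in
/-- Specialisation of the twisted intertwining equation, with denominators of `K` cleared. -/
theorem TwistedIntertwining.specialise {B : Subalgebra KK t.Uqg}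
    {K : Matrix t.Lab t.Lab (RatFunc KK)} {η : KKˣ} (h : t.TwistedIntertwining B K η)
    {Kp : Matrix t.Lab t.Lab KK[X]} {d : KK[X]}
    (hKp : ∀ i j, algebraMap KK[X] (RatFunc KK) (Kp i j) = algebraMap KK[X] (RatFunc KK) d * K i j)
    (u : KKˣ) {b : t.Uqg} (hb : b ∈ B) :
    Kp.map (aeval (u : KK)) * t.vecRep (η * u) b =
      dualRep (t.vecRep (η / u)) b * Kp.map (aeval (u : KK)) := by
  have hK : MatHasValue (u : KK) (algebraMap KK[X] (RatFunc KK) d • K)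
      (Kp.map (aeval (u : KK))) := by
    intro i j
    rw [Matrix.smul_apply, smul_eq_mul, ← hKp, Matrix.map_apply, coe_aeval_eq_eval]
    exact HasValue.poly _
  have hη := HasValue.const (a := (u : KK)) (η : KK)
  have h1 : HasValue (u : KK) ((scal η * uVar : (RatFunc KK)ˣ) : RatFunc KK)
      ((η * u : KKˣ) : KK) := by
    rw [Units.val_mul, Units.val_mul]
    exact hη.mul HasValue.X
  have h2 : HasValue (u : KK) ((scal η / uVar : (RatFunc KK)ˣ) : RatFunc KK)
      ((η / u : KKˣ) : KK) := by
    rw [Units.val_div_eq_div_val, Units.val_div_eq_div_val, div_eq_mul_inv, div_eq_mul_inv]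
    exact hη.mul (HasValue.X.inv u.ne_zero)
  have e := h b hb
  have e1 := hK.mul (matHasValue_vecRep h1 b)
  have e2 := (matHasValue_vecRep h2 (HopfAlgebra.antipode KK b)).transpose.mul hK
  -- After this rewriting `e1` and `e2` are values at `u` of one and the same matrix, a side of the
  -- intertwining equation multiplied by `d`.
  rw [Matrix.smul_mul, e, ← Matrix.mul_smul] at e1
  exact e1.unique e2

end AffineType

/-! ### Proportional matrices over polynomial rings -/

section proportional

open MvPolynomial

variable {k : Type*} [Field k] [IsAlgClosed k] [CharZero k]

theorem eval_fin_two (x : Fin 2 → k) : x = ![x 0, x 1] := by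
  ext i; fin_cases i <;> rfl

theorem exists_eval_ne_zero {g : MvPolynomial (Fin 2) k} (hg : g ≠ 0) :
    ∃ a b : k, eval ![a, b] g ≠ 0 := by
  by_contra! h
  apply hg
  apply MvPolynomial.funext
  intro x
  rw [eval_fin_two x, h, map_zero]

/-- The product `g * h` vanishes at every point, hence is zero, and polynomials form a domain. -/
theorem eq_zero_of_generic {g h : MvPolynomial (Fin 2) k} (hg : g ≠ 0)
    (H : ∀ a b : k, eval ![a, b] g ≠ 0 → eval ![a, b] h = 0) : h = 0 := by
  have : g * h = 0 := by
    apply MvPolynomial.funext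
    intro x
    rw [eval_fin_two x, map_mul, map_zero]
    by_cases h0 : eval ![x 0, x 1] g = 0
    · rw [h0, zero_mul]
    · rw [H _ _ h0, mul_zero]
  exact (mul_eq_zero.1 this).resolve_left hg

/-- Two polynomials with equal powers are proportional, hence equal if they have a common nonzero
value. -/
theorem eq_of_pow_eq {a b : MvPolynomial (Fin 2) k} {m : ℕ} (hm : 0 < m) (h : a ^ m = b ^ m)
    (x : Fin 2 → k) (hx : eval x a = eval x b) (h0 : eval x b ≠ 0) : a = b := by
  haveI : NeZero m := ⟨hm.ne'⟩
  haveI : NeZero (m : k) := ⟨Nat.cast_ne_zero.2 hm.ne'⟩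
  obtain ⟨ω, hω⟩ := HasEnoughRootsOfUnity.exists_primitiveRoot k m
  have hω' := hω.map_of_injective (MvPolynomial.C_injective (Fin 2) k)
  -- The difference of powers splits into factors `a - ζ * b` over the roots of unity, so one factor
  -- is zero. All these ζ are constants, powers of the image of `ω`, so evaluation at `x` determines
  -- ζ.
  have h1 := hω'.pow_sub_pow_eq_prod_sub_mul a b hm
  rw [h, sub_self, eq_comm, Finset.prod_eq_zero_iff] at h1
  obtain ⟨ζ, hζ, h2⟩ := h1
  rw [Polynomial.mem_nthRootsFinset hm] at hζ
  obtain ⟨i, _, rfl⟩ := hω'.eq_pow_of_pow_eq_one hζ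
  have h3 := congrArg (eval x) h2
  rw [map_sub, map_mul, map_pow, eval_C, map_zero, hx] at h3
  have h4 : ω ^ i = 1 := by
    apply mul_right_cancel₀ h0
    linear_combination -h3
  rw [← map_pow, h4, map_one, one_mul] at h2
  exact sub_eq_zero.1 h2

/-- Generically proportional matrices of polynomials with the same nonzero determinant are equal
if they have the same nonzero value at some point. -/
theorem matrix_eq_of_proportional {ι : Type*} [Fintype ι] [DecidableEq ι]
    {L M : Matrix ι ι (MvPolynomial (Fin 2) k)} {g : MvPolynomial (Fin 2) k} (hg : g ≠ 0)
    (hdet : L.det = M.det)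
    (H : ∀ a b : k, eval ![a, b] g ≠ 0 → IsUnit (M.map (eval ![a, b])) ∧
      ∃ c : k, L.map (eval ![a, b]) = c • M.map (eval ![a, b]))
    (x : Fin 2 → k) (hx : L.map (eval x) = M.map (eval x)) (h0 : M.map (eval x) ≠ 0) : L = M := by
  obtain ⟨i, j, hij⟩ : ∃ i j, eval x (M i j) ≠ 0 := by
    by_contra! h
    exact h0 (by ext i j; exact h i j)
  have hxij : eval x (L i j) = eval x (M i j) := congrFun (congrFun hx i) j
  -- Proportionality at generic points makes these 2 × 2 minors vanish generically, hence
  -- identically.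
  have hminor : ∀ p r, L p r * M i j = L i j * M p r := by
    intro p r
    rw [← sub_eq_zero]
    apply eq_zero_of_generic hg
    intro a b hab
    obtain ⟨_, c, hc⟩ := H a b hab
    have h1 : eval ![a, b] (L p r) = c * eval ![a, b] (M p r) := congrFun (congrFun hc p) r
    have h2 : eval ![a, b] (L i j) = c * eval ![a, b] (M i j) := congrFun (congrFun hc i) j
    rw [map_sub, map_mul, map_mul, h1, h2]; ring
  have hMdet : M.det ≠ 0 := by
    intro h
    obtain ⟨a, b, hab⟩ := exists_eval_ne_zero hg
    have h1 := (H a b hab).1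
    rw [Matrix.isUnit_iff_isUnit_det, ← RingHom.mapMatrix_apply, ← RingHom.map_det, h, map_zero] at h1
    simp at h1
  -- Taking determinants in `M i j • L = L i j • M` and cancelling the common nonzero determinant
  -- leaves an equality of powers.
  have hpow : (L i j) ^ Fintype.card ι = (M i j) ^ Fintype.card ι := by
    have h1 : M i j • L = L i j • M := by
      ext1 p r
      rw [Matrix.smul_apply, Matrix.smul_apply, smul_eq_mul, smul_eq_mul, ← hminor, mul_comm]
    have h2 := congrArg Matrix.det h1
    rw [Matrix.det_smul, Matrix.det_smul, hdet] at h2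
    exact (mul_right_cancel₀ hMdet h2).symm
  have heq := eq_of_pow_eq (Fintype.card_pos_iff.2 ⟨i⟩) hpow x hxij hij
  have hne : M i j ≠ 0 := fun h => hij (by rw [h, map_zero])
  ext1 p r
  apply mul_right_cancel₀ hne
  rw [hminor, heq, mul_comm]

end proportional

/-! ### The two sides of the reflection equation -/

/-- The partial transpose over an arbitrary ring. -/
def partialTransp {m A : Type*} (M : Matrix (m × m) (m × m) A) : Matrix (m × m) (m × m) A :=
  Matrix.of fun a b => M (b.1, a.2) (a.1, b.2)

namespace AffineType

variable (t : AffineType)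

section sides

open Polynomial

variable {A : Type*} [CommRing A] [Algebra KK A] (Kp : Matrix t.Lab t.Lab KK[X])

/-- The left-hand side of the reflection equation, with denominators cleared. -/
noncomputable def reflL (x y : A) : Matrix (t.Lab × t.Lab) (t.Lab × t.Lab) A :=
  t.Rnum x y * (Kp.map (aeval x) ⊗ₖ (1 : Matrix t.Lab t.Lab A)) *
    partialTransp (t.Rnum 1 (x * y)) * ((1 : Matrix t.Lab t.Lab A) ⊗ₖ Kp.map (aeval y))

/-- The right-hand side of the reflection equation, with denominators cleared. -/
noncomputable def reflR (x y : A) : Matrix (t.Lab × t.Lab) (t.Lab × t.Lab) A :=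
  ((1 : Matrix t.Lab t.Lab A) ⊗ₖ Kp.map (aeval y)) * partialTransp (t.Rnum 1 (x * y)) *
    (Kp.map (aeval x) ⊗ₖ (1 : Matrix t.Lab t.Lab A)) * t.Rnum x y

/-- The two sides are products of the same four matrices in opposite orders. -/
theorem det_refl (x y : A) : (t.reflL Kp x y).det = (t.reflR Kp x y).det := by
  simp only [reflL, reflR, Matrix.det_mul]
  ring

variable {C : Type*} [CommRing C] [Algebra KK C] (f : A →ₐ[KK] C)

theorem partialTransp_map {m : Type*} (M : Matrix (m × m) (m × m) A) :
    (partialTransp M).map f = partialTransp (M.map f) := rfl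

theorem kron_one_map (x : A) :
    (Kp.map (aeval x) ⊗ₖ (1 : Matrix t.Lab t.Lab A)).map f =
      Kp.map (aeval (f x)) ⊗ₖ (1 : Matrix t.Lab t.Lab C) := by
  ext a b
  simp [Matrix.one_apply, apply_ite f, Polynomial.aeval_algHom_apply]

theorem one_kron_map (x : A) :
    ((1 : Matrix t.Lab t.Lab A) ⊗ₖ Kp.map (aeval x)).map f =
      (1 : Matrix t.Lab t.Lab C) ⊗ₖ Kp.map (aeval (f x)) := by
  ext a b
  simp [Matrix.one_apply, apply_ite f, Polynomial.aeval_algHom_apply]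

theorem reflL_map (x y : A) : (t.reflL Kp x y).map f = t.reflL Kp (f x) (f y) := by
  simp only [reflL, Matrix.map_mul, partialTransp_map, kron_one_map, one_kron_map, Rnum_map,
    map_mul, map_one]

theorem reflR_map (x y : A) : (t.reflR Kp x y).map f = t.reflR Kp (f x) (f y) := by
  simp only [reflR, Matrix.map_mul, partialTransp_map, kron_one_map, one_kron_map, Rnum_map,
    map_mul, map_one]

end sides

section points

open Polynomial

variable {t}

/-- This keeps `Rnum x x` a nonzero multiple of the flip for `x ≠ 0`. Outside type A the exponent 2κ
is positive and `q` is not a root of unity. -/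
theorem eKap_ne_one : t.eKap ≠ 1 := by
  by_cases hf : t.family = .A
  · rw [eKap, hf]
    intro h
    exact qh_not_root 2 two_pos (qh_sq.trans h)
  · rw [eKap_eq hf]
    have : ∃ r : ℕ, 0 < r ∧ 2 * t.twoKappa = r := by
      have hn := t.le_n
      refine ⟨(2 * t.twoKappa).toNat, ?_, ?_⟩ <;>
      · cases h : t.family <;> simp only [h, Family.minRank, twoKappa] at hn ⊢ <;>
          first | exact absurd h hf | omega
    obtain ⟨r, hr, h⟩ := this
    rw [h, zpow_natCast]
    exact qh_not_root r hr

theorem Rnum_ne_zero {x y : KK} (h1 : q * y - q⁻¹ * x ≠ 0) (h2 : t.eKap * y - x ≠ 0) :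
    t.Rnum x y ≠ 0 := by
  intro h
  have := t.Rnum_topLabel x y
  rw [h] at this
  exact mul_ne_zero h1 h2 this.symm

theorem partialTransp_Rnum_ne_zero {x y : KK} (h1 : q * y - q⁻¹ * x ≠ 0)
    (h2 : t.eKap * y - x ≠ 0) : partialTransp (t.Rnum x y) ≠ 0 := by
  intro h
  have := t.Rnum_topLabel x y
  exact mul_ne_zero h1 h2 (this.symm.trans (congrFun (congrFun h (t.topLabel, t.topLabel))
    (t.topLabel, t.topLabel)))

theorem intertwines_of_smul {m l : Type*} [Fintype m] [Fintype l] {c : KK} (hc : c ≠ 0)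
    {M : Matrix l m KK} {U : Matrix m m KK} {V : Matrix l l KK}
    (h : (c • M) * U = V * (c • M)) : M * U = V * M := by
  rw [Matrix.smul_mul, Matrix.mul_smul] at h
  exact smul_right_injective _ hc h

variable {B : Subalgebra KK t.Uqg} (hB : IsRightCoideal B) {η : KKˣ}
  {Kp : Matrix t.Lab t.Lab KK[X]}
  (hK : ∀ (u : KKˣ), ∀ b ∈ B, Kp.map (aeval (u : KK)) * t.vecRep (η * u) b =
    dualRep (t.vecRep (η / u)) b * Kp.map (aeval (u : KK)))

include hB hK

/-- Read from right to left: K(v) dualises the second factor under the opposite coproduct, the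
partial transpose passes to Δ, K(u) dualises the first factor under Δ, and R returns to the opposite
coproduct. The parameter ratios met on the way are (η/v)/(ηu) = 1/(uv) and (η/v)/(η/u) = u/v, so η
disappears. -/
theorem reflL_intertwines (u v : KKˣ) {b : t.Uqg} (hb : b ∈ B) :
    t.reflL Kp (u : KK) v * tensorOp (t.vecRep (η * u)) (t.vecRep (η * v)) b =
      tensorOp (dualRep (t.vecRep (η / u))) (dualRep (t.vecRep (η / v))) b *
        t.reflL Kp (u : KK) v := by
  have h1 := hB.one_kron_intertwines (t.vecRep (η * u)) (hK v) hb
  have h2 := partialTranspose_intertwines' (η / v) (η * u) b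
  have h3 := hB.kron_one_intertwines (dualRep (t.vecRep (η / v))) (hK u) hb
  have h4 := dual_Rnum_intertwines (η / u) (η / v) b
  have hη := η.ne_zero
  have hu := u.ne_zero
  have hv := v.ne_zero
  have e2 : t.Rnum ((η / v : KKˣ) : KK) ((η * u : KKˣ) : KK) =
      ((η / v : KK) ^ 2) • t.Rnum 1 ((u : KK) * v) := by
    rw [← Rnum_scale, Units.val_div_eq_div_val, Units.val_mul]
    congr 1
    · ring
    · field_simp
  have e4 : t.Rnum ((η / v : KKˣ) : KK) ((η / u : KKˣ) : KK) =
      ((η / (u * v) : KK) ^ 2) • t.Rnum (u : KK) v := by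
    rw [← Rnum_scale, Units.val_div_eq_div_val, Units.val_div_eq_div_val]
    congr 1
    · field_simp
    · field_simp
  rw [e2] at h2
  rw [e4] at h4
  replace h2 := intertwines_of_smul (M := partialTransp (t.Rnum 1 ((u : KK) * v)))
    (by positivity) h2
  replace h4 := intertwines_of_smul (by positivity) h4
  rw [reflL]
  simp only [Matrix.mul_assoc]
  rw [h1, ← Matrix.mul_assoc (partialTransp _), h2, Matrix.mul_assoc (tensorRep _ _ _),
    ← Matrix.mul_assoc (_ ⊗ₖ 1), h3, Matrix.mul_assoc (tensorRep _ _ _),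
    ← Matrix.mul_assoc (t.Rnum _ _), h4, Matrix.mul_assoc]

/-- The other route between the same representations: R passes to Δ first, then K(u), the partial
transpose back to the opposite coproduct, and finally K(v). -/
theorem reflR_intertwines (u v : KKˣ) {b : t.Uqg} (hb : b ∈ B) :
    t.reflR Kp (u : KK) v * tensorOp (t.vecRep (η * u)) (t.vecRep (η * v)) b =
      tensorOp (dualRep (t.vecRep (η / u))) (dualRep (t.vecRep (η / v))) b *
        t.reflR Kp (u : KK) v := by
  have h1 := hB.one_kron_intertwines (dualRep (t.vecRep (η / u))) (hK v) hb
  have h2 := partialTranspose_intertwines (η / u) (η * v) b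
  have h3 := hB.kron_one_intertwines (t.vecRep (η * v)) (hK u) hb
  have h4 := Rnum_intertwines (η * u) (η * v) b
  have hη := η.ne_zero
  have hu := u.ne_zero
  have hv := v.ne_zero
  have e2 : t.Rnum ((η / u : KKˣ) : KK) ((η * v : KKˣ) : KK) =
      ((η / u : KK) ^ 2) • t.Rnum 1 ((u : KK) * v) := by
    rw [← Rnum_scale, Units.val_div_eq_div_val, Units.val_mul]
    congr 1
    · ring
    · field_simp
  have e4 : t.Rnum ((η * u : KKˣ) : KK) ((η * v : KKˣ) : KK) =
      ((η : KK) ^ 2) • t.Rnum (u : KK) v := by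
    rw [← Rnum_scale, Units.val_mul, Units.val_mul]
  rw [e2] at h2
  rw [e4] at h4
  replace h2 := intertwines_of_smul (M := partialTransp (t.Rnum 1 ((u : KK) * v)))
    (by positivity) h2
  replace h4 := intertwines_of_smul (by positivity) h4
  rw [reflR]
  simp only [Matrix.mul_assoc]
  rw [h4, ← Matrix.mul_assoc (_ ⊗ₖ 1), h3, Matrix.mul_assoc (tensorRep _ _ _),
    ← Matrix.mul_assoc (partialTransp _), h2, Matrix.mul_assoc (tensorOp _ _ _),
    ← Matrix.mul_assoc (1 ⊗ₖ _), h1, Matrix.mul_assoc]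

/-- The matrix `K(u) ⊗ 1` is a nonzero intertwiner out of an irreducible representation, and its
determinant is a power of that of K(u). -/
theorem isUnit_of_irreducible {u w : KKˣ}
    (hirr : (restrictRep (tensorRep (t.vecRep (η * u)) (t.vecRep w)) B).IsIrreducible)
    (h0 : Kp.map (aeval (u : KK)) ≠ 0) : IsUnit (Kp.map (aeval (u : KK))) := by
  have hn : (Kp.map (aeval (u : KK)) ⊗ₖ (1 : Matrix t.Lab t.Lab KK)) ≠ 0 := by
    intro h
    apply h0
    ext i j
    have := congrFun (congrFun h (i, t.topLabel)) (j, t.topLabel)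
    simpa using this
  have h1 := intertwiner_isUnit hirr (fun b hb => hB.kron_one_intertwines _ (hK u) hb) hn
  rw [Matrix.isUnit_iff_isUnit_det] at h1 ⊢
  rw [Matrix.det_kronecker, Matrix.det_one, one_pow, mul_one] at h1
  haveI : Nonempty t.Lab := ⟨t.topLabel⟩
  exact (isUnit_pow_iff Fintype.card_ne_zero).1 h1

omit hB hK in
/-- An intertwiner from `ρ ⊗ᵒᵖ σ`, composed with the flip, is an intertwiner from `σ ⊗ ρ`. -/
theorem flip_intertwines {ρ σ : t.Uqg →ₐ[KK] Matrix t.Lab t.Lab KK} {b : t.Uqg}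
    {M V : Matrix (t.Lab × t.Lab) (t.Lab × t.Lab) KK} (h : M * tensorOp ρ σ b = V * M) :
    (M * flipMat t.Lab KK) * tensorRep σ ρ b = V * (M * flipMat t.Lab KK) := by
  rw [tensorRep_eq_flip, ← Matrix.mul_assoc V, ← h]
  calc _ = M * (flipMat t.Lab KK * flipMat t.Lab KK) * tensorOp ρ σ b * flipMat t.Lab KK := by
        simp only [Matrix.mul_assoc]
    _ = _ := by rw [flipMat_mul_flipMat, Matrix.mul_one]

/-- Irreducibility is needed in both orders of the parameters: with `u` first to invert K(u), with
`v` first to invert K(v) and because the flip turns the common source of the two sides into the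
tensor product with `v` first. The partial transpose only has to be nonzero: the right side is then
a nonzero intertwiner, hence invertible. -/
theorem refl_proportional {u v : KKˣ}
    (hirr : (restrictRep (tensorRep (t.vecRep (η * u)) (t.vecRep (η * v))) B).IsIrreducible)
    (hirr' : (restrictRep (tensorRep (t.vecRep (η * v)) (t.vecRep (η * u))) B).IsIrreducible)
    (hu : Kp.map (aeval (u : KK)) ≠ 0) (hv : Kp.map (aeval (v : KK)) ≠ 0)
    (h1 : q * (v : KK) - q⁻¹ * u ≠ 0) (h2 : t.eKap * (v : KK) - u ≠ 0)
    (h3 : q * ((u : KK) * v) - q⁻¹ * 1 ≠ 0) (h4 : t.eKap * ((u : KK) * v) - 1 ≠ 0) :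
    IsUnit (t.reflR Kp (u : KK) v) ∧ ∃ c : KK, t.reflL Kp (u : KK) v = c • t.reflR Kp (u : KK) v := by
  haveI : Nonempty t.Lab := ⟨t.topLabel⟩
  have hP := flipMat_mul_flipMat (ι := t.Lab) (k := KK)
  have hPu : IsUnit (flipMat t.Lab KK) := IsUnit.of_mul_eq_one _ hP
  have hcancel : ∀ {M : Matrix (t.Lab × t.Lab) (t.Lab × t.Lab) KK}, M * flipMat t.Lab KK = 0 →
      M = 0 := fun h => hPu.mul_left_eq_zero.1 h
  have hKu := isUnit_of_irreducible hB hK hirr hu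
  have hKv := isUnit_of_irreducible hB hK hirr' hv
  have hR : IsUnit (t.Rnum (u : KK) v) := by
    have e : t.Rnum ((η * u : KKˣ) : KK) ((η * v : KKˣ) : KK) =
        ((η : KK) ^ 2) • t.Rnum (u : KK) v := by
      rw [← Rnum_scale, Units.val_mul, Units.val_mul]
    have h := intertwiner_isUnit hirr' (M := t.Rnum (u : KK) v * flipMat t.Lab KK)
      (fun b _ => flip_intertwines (intertwines_of_smul (pow_ne_zero 2 η.ne_zero)
        (e ▸ Rnum_intertwines (η * u) (η * v) b)))
      (fun h => Rnum_ne_zero h1 h2 (hcancel h))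
    simpa [Matrix.mul_assoc, hP] using h.mul hPu
  have hKu1 : IsUnit (Kp.map (aeval (u : KK)) ⊗ₖ (1 : Matrix t.Lab t.Lab KK)) := by
    rw [Matrix.isUnit_iff_isUnit_det, Matrix.det_kronecker, Matrix.det_one, one_pow, mul_one]
    exact ((Matrix.isUnit_iff_isUnit_det _).1 hKu).pow _
  have hKv1 : IsUnit ((1 : Matrix t.Lab t.Lab KK) ⊗ₖ Kp.map (aeval (v : KK))) := by
    rw [Matrix.isUnit_iff_isUnit_det, Matrix.det_kronecker, Matrix.det_one, one_pow, one_mul]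
    exact ((Matrix.isUnit_iff_isUnit_det _).1 hKv).pow _
  have hM0 : t.reflR Kp (u : KK) v ≠ 0 := by
    intro h
    rw [reflR, hR.mul_left_eq_zero, hKu1.mul_left_eq_zero, hKv1.mul_right_eq_zero] at h
    exact partialTransp_Rnum_ne_zero h3 h4 h
  have hL := fun b (hb : b ∈ B) => flip_intertwines (reflL_intertwines hB hK u v hb)
  have hM := fun b (hb : b ∈ B) => flip_intertwines (reflR_intertwines hB hK u v hb)
  have hMu := intertwiner_isUnit hirr' hM (fun h => hM0 (hcancel h))
  obtain ⟨c, hc⟩ := intertwiner_scalar hirr' hL hM hMu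
  refine ⟨by simpa [Matrix.mul_assoc, hP] using hMu.mul hPu, c, ?_⟩
  apply hPu.mul_right_cancel
  rw [hc, Matrix.smul_mul]

end points

end AffineType

/-! ### The diagonal `u = v` and the passage to polynomials -/

namespace AffineType

variable {t : AffineType}

section diagonal

open Polynomial

/-- On the diagonal `u = v` the two sides agree. -/
theorem refl_self (Kp : Matrix t.Lab t.Lab KK[X]) (u : KK) :
    t.reflL Kp u u = t.reflR Kp u u := by
  have hT : partialTransp (t.Rnum 1 (u * u)) * flipMat t.Lab KK =
      flipMat t.Lab KK * partialTransp (t.Rnum 1 (u * u)) := by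
    have h : flipMat t.Lab KK * partialTransp (t.Rnum 1 (u * u)) * flipMat t.Lab KK =
      partialTransp (t.Rnum 1 (u * u)) := flip_partialTranspose (t.Rnum_flipSymm 1 (u * u))
    conv_lhs => rw [← h, Matrix.mul_assoc, flipMat_mul_flipMat, Matrix.mul_one]
  have h1 := flipMat_mul_kron (Kp.map (aeval u)) (1 : Matrix t.Lab t.Lab KK)
  have h2 := flipMat_mul_kron (1 : Matrix t.Lab t.Lab KK) (Kp.map (aeval u))
  simp only [reflL, reflR, Rnum_self, Matrix.smul_mul, Matrix.mul_smul]
  generalize partialTransp (t.Rnum 1 (u * u)) = T at *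
  generalize Kp.map (aeval u) ⊗ₖ (1 : Matrix t.Lab t.Lab KK) = K₁ at *
  generalize (1 : Matrix t.Lab t.Lab KK) ⊗ₖ Kp.map (aeval u) = K₂ at *
  congr 1
  rw [h1, Matrix.mul_assoc K₂, ← hT, ← Matrix.mul_assoc, Matrix.mul_assoc _ _ K₂, h2,
    ← Matrix.mul_assoc]

/-- On the diagonal R is a nonzero multiple of the flip and both K factors are invertible, so
everything rests on the partial transpose, which has a nonzero entry by `Rnum_topLabel`. -/
theorem reflR_self_ne_zero {Kp : Matrix t.Lab t.Lab KK[X]} {u : KK} (hu : u ≠ 0)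
    (hK : IsUnit (Kp.map (aeval u))) (h3 : q * (u * u) - q⁻¹ * 1 ≠ 0)
    (h4 : t.eKap * (u * u) - 1 ≠ 0) : t.reflR Kp u u ≠ 0 := by
  have hq : q - q⁻¹ ≠ 0 := by
    intro h
    apply qh_not_root 4 (by norm_num)
    have hq0 := q_ne_zero
    field_simp at h
    rw [show (4 : ℕ) = 2 * 2 by norm_num, pow_mul, qh_sq]
    linear_combination h
  have he : t.eKap * u - u ≠ 0 := by
    rw [← sub_one_mul]
    exact mul_ne_zero (sub_ne_zero.2 eKap_ne_one) hu
  have hP : IsUnit (flipMat t.Lab KK) := IsUnit.of_mul_eq_one _ flipMat_mul_flipMat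
  have hK1 : IsUnit (Kp.map (aeval u) ⊗ₖ (1 : Matrix t.Lab t.Lab KK)) := by
    rw [Matrix.isUnit_iff_isUnit_det, Matrix.det_kronecker, Matrix.det_one, one_pow, mul_one]
    exact ((Matrix.isUnit_iff_isUnit_det _).1 hK).pow _
  have hK2 : IsUnit ((1 : Matrix t.Lab t.Lab KK) ⊗ₖ Kp.map (aeval u)) := by
    rw [Matrix.isUnit_iff_isUnit_det, Matrix.det_kronecker, Matrix.det_one, one_pow, one_mul]
    exact ((Matrix.isUnit_iff_isUnit_det _).1 hK).pow _
  intro h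
  rw [reflR, Rnum_self, Matrix.mul_smul, smul_eq_zero,
    or_iff_right (mul_ne_zero (mul_ne_zero hq hu) he), hP.mul_left_eq_zero, hK1.mul_left_eq_zero,
    hK2.mul_right_eq_zero] at h
  exact partialTransp_Rnum_ne_zero h3 h4 h

end diagonal

section generic

open MvPolynomial

/-- The substitution `(u, v) ↦ (η u, η v)`. -/
noncomputable def scaleVars (η : KK) (a b : Fin 2) : MvPolynomial (Fin 2) KK →ₐ[KK]
    MvPolynomial (Fin 2) KK :=
  MvPolynomial.aeval ![C η * X a, C η * X b]

theorem eval_scaleVars (η : KK) (a b : Fin 2) (p : MvPolynomial (Fin 2) KK) (x : Fin 2 → KK) :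
    eval x (scaleVars η a b p) = eval ![η * x a, η * x b] p := by
  have : (MvPolynomial.aeval x).comp (scaleVars η a b) =
      (MvPolynomial.aeval ![η * x a, η * x b] : MvPolynomial (Fin 2) KK →ₐ[KK] KK) := by
    apply MvPolynomial.algHom_ext
    intro i
    fin_cases i <;> simp [scaleVars]
  have h := DFunLike.congr_fun this p
  simpa [MvPolynomial.aeval_eq_eval] using h

/-- The polynomial which vanishes at the points excluded from the generic argument. -/
noncomputable def genericPoly (t : AffineType) (η : KK) (p : MvPolynomial (Fin 2) KK)
    (f : Polynomial KK) : MvPolynomial (Fin 2) KK :=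
  scaleVars η 0 1 p * scaleVars η 1 0 p * Polynomial.aeval (X 0) f * Polynomial.aeval (X 1) f *
    (C q * X 1 - C q⁻¹ * X 0) * (C t.eKap * X 1 - X 0) *
    (C q * (X 0 * X 1) - C q⁻¹) * (C t.eKap * (X 0 * X 1) - 1) * (X 0 * X 1)

theorem genericPoly_ne_zero {η : KK} (hη : η ≠ 0) {p : MvPolynomial (Fin 2) KK} (hp : p ≠ 0)
    {f : Polynomial KK} (hf : f ≠ 0) : genericPoly t η p f ≠ 0 := by
  have hev : ∀ g : MvPolynomial (Fin 2) KK, (∃ x, eval x g ≠ 0) → g ≠ 0 := by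
    rintro g ⟨x, hx⟩ rfl
    exact hx (map_zero _)
  obtain ⟨a, b, hab⟩ := exists_eval_ne_zero hp
  have hfX : ∀ i : Fin 2, Polynomial.aeval (X i : MvPolynomial (Fin 2) KK) f ≠ 0 := by
    intro i h
    exact hf (transcendental_iff.1 (MvPolynomial.transcendental_X KK i) f h)
  have hq := q_ne_zero
  refine mul_ne_zero (mul_ne_zero (mul_ne_zero (mul_ne_zero (mul_ne_zero (mul_ne_zero (mul_ne_zero
    (mul_ne_zero ?_ ?_) (hfX 0)) (hfX 1)) ?_) ?_) ?_) ?_) (mul_ne_zero (X_ne_zero 0) (X_ne_zero 1))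
  · refine hev _ ⟨![a / η, b / η], ?_⟩
    rw [eval_scaleVars]
    simpa [mul_div_cancel₀, hη] using hab
  · refine hev _ ⟨![b / η, a / η], ?_⟩
    rw [eval_scaleVars]
    simpa [mul_div_cancel₀, hη] using hab
  · exact hev _ ⟨![0, 1], by simp [hq]⟩
  · exact hev _ ⟨![0, 1], by simp [eKap_ne_zero]⟩
  · exact hev _ ⟨![0, 0], by simp [hq]⟩
  · exact hev _ ⟨![0, 0], by simp⟩

end generic

open MvPolynomial in
/-- The reflection equation with denominators cleared. -/
theorem refl_polynomial {B : Subalgebra KK t.Uqg} (hB : IsRightCoideal B) {η : KKˣ}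
    {Kp : Matrix t.Lab t.Lab (Polynomial KK)}
    (hK : ∀ (u : KKˣ), ∀ b ∈ B, Kp.map (Polynomial.aeval (u : KK)) * t.vecRep (η * u) b =
      dualRep (t.vecRep (η / u)) b * Kp.map (Polynomial.aeval (u : KK)))
    (h0 : Kp ≠ 0) (hirr : t.GenericallyIrreducible B) :
    t.reflL Kp (X 0 : MvPolynomial (Fin 2) KK) (X 1) = t.reflR Kp (X 0) (X 1) := by
  obtain ⟨p, hp, hirr⟩ := hirr
  obtain ⟨i, j, hij⟩ : ∃ i j, Kp i j ≠ 0 := by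
    by_contra! h
    exact h0 (by ext1 i j; exact h i j)
  have hg := genericPoly_ne_zero (t := t) η.ne_zero hp hij
  have hmapL : ∀ x : Fin 2 → KK,
      (t.reflL Kp (X 0 : MvPolynomial (Fin 2) KK) (X 1)).map (eval x) = t.reflL Kp (x 0) (x 1) := by
    intro x
    have := t.reflL_map Kp (MvPolynomial.aeval x) (X 0 : MvPolynomial (Fin 2) KK) (X 1)
    simpa [MvPolynomial.aeval_eq_eval] using this
  have hmapR : ∀ x : Fin 2 → KK,
      (t.reflR Kp (X 0 : MvPolynomial (Fin 2) KK) (X 1)).map (eval x) = t.reflR Kp (x 0) (x 1) := by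
    intro x
    have := t.reflR_map Kp (MvPolynomial.aeval x) (X 0 : MvPolynomial (Fin 2) KK) (X 1)
    simpa [MvPolynomial.aeval_eq_eval] using this
  have hpoint : ∀ a b : KK, eval ![a, b] (genericPoly t η p (Kp i j)) ≠ 0 →
      IsUnit (t.reflR Kp a b) ∧ (∃ c : KK, t.reflL Kp a b = c • t.reflR Kp a b) ∧
        IsUnit (Kp.map (Polynomial.aeval a)) := by
    intro a b hab
    simp only [genericPoly, map_mul, map_sub, map_one, eval_scaleVars, eval_X, eval_C,
      ← Polynomial.aeval_algHom_apply, mul_ne_zero_iff, Matrix.cons_val_zero,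
      Matrix.cons_val_one, Matrix.cons_val_fin_one] at hab
    obtain ⟨⟨⟨⟨⟨⟨⟨⟨p1, p2⟩, f1⟩, f2⟩, h1⟩, h2⟩, h3⟩, h4⟩, ha, hb⟩ := hab
    have hf : ∀ c : KK, ∀ k : Fin 2, ∀ y : Fin 2 → KK, y k = c →
        eval y (Polynomial.aeval (X k : MvPolynomial (Fin 2) KK) (Kp i j)) ≠ 0 →
          Kp.map (Polynomial.aeval c) ≠ 0 := by
      rintro c k y rfl hne h
      apply hne
      have e := Polynomial.aeval_algHom_apply (MvPolynomial.aeval y : _ →ₐ[KK] KK) (X k) (Kp i j)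
      rw [MvPolynomial.aeval_X, MvPolynomial.aeval_eq_eval] at e
      exact e.symm.trans (congrFun (congrFun h i) j)
    lift a to KKˣ using isUnit_iff_ne_zero.2 ha
    lift b to KKˣ using isUnit_iff_ne_zero.2 hb
    have i1 := hirr (η * a) (η * b) (by simpa using p1)
    have i2 := hirr (η * b) (η * a) (by simpa using p2)
    have k1 := hf a 0 _ rfl f1
    have k2 := hf b 1 _ rfl f2
    obtain ⟨r1, r2⟩ := refl_proportional hB hK i1 i2 k1 k2 h1 h2 (by simpa using h3) h4
    exact ⟨r1, r2, isUnit_of_irreducible hB hK i1 k1⟩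
  -- Invertibility of `Kp` at a single generic point already shows that its determinant is not the
  -- zero polynomial.
  have hdet : Kp.det ≠ 0 := by
    intro h
    obtain ⟨a, b, hab⟩ := exists_eval_ne_zero hg
    have h1 := (hpoint a b hab).2.2
    rw [Matrix.isUnit_iff_isUnit_det] at h1
    have h2 := RingHom.map_det (Polynomial.aeval a : Polynomial KK →ₐ[KK] KK).toRingHom Kp
    rw [h, map_zero] at h2
    exact h1.ne_zero h2.symm
  -- The generic locus may miss the diagonal altogether, so the comparison point (u, u) is not taken
  -- from it. It suffices that K(u) is invertible, that `u ≠ 0`, and that the partial transpose is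
  -- nonzero there.
  obtain ⟨u, hu⟩ : ∃ u : KK, (Kp.det * Polynomial.X * (Polynomial.C q * (Polynomial.X * Polynomial.X)
      - Polynomial.C q⁻¹) * (Polynomial.C t.eKap * (Polynomial.X * Polynomial.X) - 1)).eval u ≠ 0 := by
    by_contra! h
    have h1 := Polynomial.funext (q := 0) (fun r => by rw [h r, Polynomial.eval_zero])
    simp only [mul_eq_zero, hdet, Polynomial.X_ne_zero, false_or] at h1
    rcases h1 with h1 | h1
    · have := congrArg (Polynomial.eval 0) h1
      simp [q_ne_zero] at this
    · have := congrArg (Polynomial.eval 0) h1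
      simp at this
  simp only [Polynomial.eval_mul, Polynomial.eval_sub, Polynomial.eval_X, Polynomial.eval_C,
    Polynomial.eval_one, mul_ne_zero_iff] at hu
  obtain ⟨⟨⟨hu1, hu2⟩, hu3⟩, hu4⟩ := hu
  have hKu : IsUnit (Kp.map (Polynomial.aeval u)) := by
    rw [Matrix.isUnit_iff_isUnit_det, isUnit_iff_ne_zero]
    have h2 := RingHom.map_det (Polynomial.aeval u : Polynomial KK →ₐ[KK] KK).toRingHom Kp
    have h3 : (Kp.map (Polynomial.aeval u)).det = Polynomial.aeval u Kp.det := h2.symm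
    rw [h3, Polynomial.coe_aeval_eq_eval]
    exact hu1
  refine matrix_eq_of_proportional hg (t.det_refl Kp _ _) ?_ ![u, u] ?_ ?_
  · intro a b hab
    rw [hmapL, hmapR]
    exact ⟨(hpoint a b hab).1, (hpoint a b hab).2.1⟩
  · rw [hmapL, hmapR]
    exact refl_self Kp u
  · rw [hmapR]
    exact reflR_self_ne_zero hu2 hKu (by simpa using hu3) hu4

/-! ### Return to rational functions -/

open Polynomial in
theorem subst₂_algebraMap (i : Fin 2) (p : KK[X]) :
    subst₂ i (algebraMap KK[X] (RatFunc KK) p) = aeval (var₂ i) p := by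
  have h := RatFunc.liftAlgHom_apply_div (aeval (R := KK) (var₂ i))
    (nonZeroDivisors_le_comap_nonZeroDivisors_of_injective _ (aeval_var₂_injective i)) p 1
  simpa [subst₂] using h

theorem var₂_ne_zero (i : Fin 2) : var₂ i ≠ 0 := by
  rw [var₂, Ne, map_eq_zero_iff _ (IsFractionRing.injective (MvPolynomial (Fin 2) KK) RatFunc₂)]
  exact MvPolynomial.X_ne_zero i

open MvPolynomial in
theorem algebraMap_eval_ne_zero {p : MvPolynomial (Fin 2) KK} (x : Fin 2 → KK)
    (h : eval x p ≠ 0) : algebraMap (MvPolynomial (Fin 2) KK) RatFunc₂ p ≠ 0 := by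
  rw [Ne, map_eq_zero_iff _ (IsFractionRing.injective (MvPolynomial (Fin 2) KK) RatFunc₂)]
  rintro rfl
  exact h (map_zero _)

theorem algebraMap_C (c : KK) :
    algebraMap (MvPolynomial (Fin 2) KK) RatFunc₂ (MvPolynomial.C c) = algebraMap KK RatFunc₂ c := by
  rw [IsScalarTower.algebraMap_apply KK (MvPolynomial (Fin 2) KK) RatFunc₂]
  rfl

-- Clearing denominators has multiplied both sides by the same scalar: the values of `d` at both
-- variables times the denominators of R(u/v) and R(1/(uv)). It is nonzero in the field of rational
-- functions and can be cancelled.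
open MvPolynomial in
theorem twistedReflection_of_polynomial {K : Matrix t.Lab t.Lab (RatFunc KK)}
    {Kp : Matrix t.Lab t.Lab (Polynomial KK)} {d : Polynomial KK} (hd : d ≠ 0)
    (hKp : ∀ i j, algebraMap (Polynomial KK) (RatFunc KK) (Kp i j) =
      algebraMap (Polynomial KK) (RatFunc KK) d * K i j)
    (h : t.reflL Kp (X 0 : MvPolynomial (Fin 2) KK) (X 1) = t.reflR Kp (X 0) (X 1)) :
    t.TwistedReflection K := by
  let f : MvPolynomial (Fin 2) KK →ₐ[KK] RatFunc₂ :=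
    IsScalarTower.toAlgHom KK (MvPolynomial (Fin 2) KK) RatFunc₂
  have h1 := congrArg (fun M => Matrix.map M f) h
  simp only [reflL_map, reflR_map] at h1
  change t.reflL Kp (var₂ 0) (var₂ 1) = t.reflR Kp (var₂ 0) (var₂ 1) at h1
  have hq := q_ne_zero
  have hmap : ∀ i : Fin 2, Kp.map (Polynomial.aeval (var₂ i)) =
      Polynomial.aeval (var₂ i) d • K.map (subst₂ i) := by
    intro i
    ext a b
    rw [Matrix.map_apply, ← subst₂_algebraMap, hKp, map_mul, subst₂_algebraMap]
    rfl
  have hd' : ∀ i : Fin 2, Polynomial.aeval (var₂ i) d ≠ 0 := fun i =>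
    (map_ne_zero_iff _ (aeval_var₂_injective i)).2 hd
  -- Each denominator is the image of a polynomial that takes a nonzero value at (0, 1) or at (0,
  -- 0).
  have n1 : algebraMap KK RatFunc₂ q * var₂ 1 - algebraMap KK RatFunc₂ q⁻¹ * var₂ 0 ≠ 0 := by
    have := algebraMap_eval_ne_zero (p := C q * X 1 - C q⁻¹ * X 0) ![0, 1] (by simp [hq])
    simpa only [map_sub, map_mul, algebraMap_C, var₂] using this
  have n2 : algebraMap KK RatFunc₂ t.eKap * var₂ 1 - var₂ 0 ≠ 0 := by
    have := algebraMap_eval_ne_zero (p := C t.eKap * X 1 - X 0) ![0, 1] (by simp [eKap_ne_zero])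
    simpa only [map_sub, map_mul, algebraMap_C, var₂] using this
  have n3 : algebraMap KK RatFunc₂ q * (var₂ 0 * var₂ 1) - algebraMap KK RatFunc₂ q⁻¹ * 1 ≠ 0 := by
    have := algebraMap_eval_ne_zero (p := C q * (X 0 * X 1) - C q⁻¹ * 1) ![0, 0] (by simp [hq])
    simpa only [map_sub, map_mul, algebraMap_C, map_one, var₂] using this
  have n4 : algebraMap KK RatFunc₂ t.eKap * (var₂ 0 * var₂ 1) - 1 ≠ 0 := by
    have := algebraMap_eval_ne_zero (p := C t.eKap * (X 0 * X 1) - 1) ![0, 0] (by simp)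
    simpa only [map_sub, map_mul, algebraMap_C, map_one, var₂] using this
  have r1 := t.R_div (var₂ 0) (var₂ 1) (var₂_ne_zero 1) n1 n2
  have r2 := t.R_div 1 (var₂ 0 * var₂ 1) (mul_ne_zero (var₂_ne_zero 0) (var₂_ne_zero 1)) n3 n4
  have hT : ∀ (c : RatFunc₂) (M : Matrix (t.Lab × t.Lab) (t.Lab × t.Lab) RatFunc₂),
      partialTransp (c • M) = c • partialTranspose₁ M := fun _ _ => rfl
  simp only [reflL, reflR, hmap, ← r1, ← r2, hT, Matrix.smul_kronecker, Matrix.kronecker_smul,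
    Matrix.smul_mul, Matrix.mul_smul, smul_smul] at h1
  rw [TwistedReflection]
  refine smul_right_injective _ (mul_ne_zero (mul_ne_zero (mul_ne_zero (hd' 1) (mul_ne_zero n3 n4))
    (hd' 0)) (mul_ne_zero n1 n2)) ?_
  simp only
  convert h1 using 2
  all_goals ring

end AffineType

end QRefl

open QRefl
theorem propositionP (t : AffineType) (B : Subalgebra KK t.Uqg) (hB : IsRightCoideal B)
    (K : Matrix t.Lab t.Lab (RatFunc KK)) (η : KKˣ) (hK : K ≠ 0)
    (hintw : t.TwistedIntertwining B K η) (hirr : t.GenericallyIrreducible B) :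
    t.TwistedReflection K := by
  -- A common denominator of all entries of `K`.
  obtain ⟨d, hd⟩ := IsLocalization.exist_integer_multiples_of_finite
    (nonZeroDivisors (Polynomial KK)) (fun p : t.Lab × t.Lab => K p.1 p.2)
  choose f hf using hd
  have hKp : ∀ i j, algebraMap (Polynomial KK) (RatFunc KK) (Matrix.of (fun i j => f (i, j)) i j) =
      algebraMap (Polynomial KK) (RatFunc KK) d * K i j := by
    intro i j
    rw [Matrix.of_apply, hf, Algebra.smul_def]
  have hd0 := nonZeroDivisors.ne_zero d.2
  refine AffineType.twistedReflection_of_polynomial hd0 hKp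
    (AffineType.refl_polynomial hB (fun u b hb => hintw.specialise hKp u hb) ?_ hirr)
  intro h0
  apply hK
  ext i j
  have h1 := hKp i j
  rw [h0, Matrix.zero_apply, map_zero, eq_comm, mul_eq_zero] at h1
  exact h1.resolve_left fun h =>
    hd0 ((map_eq_zero_iff _ (RatFunc.algebraMap_injective KK)).1 h)
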